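/- Let $K$ be a commutative ring with unit and let $\mathfrak C$ be a $K$-linear (strict) 2-category: each hom-category is $K$-linear and horizontal composition of 2-morphisms is $K$-bilinear. Write $\cdot$ for vertical composition and $\circ$ for composition of 1-morphisms and horizontal composition of 2-morphisms. **Semigroupal structures.** A semigroupal structure on a 2-category consists of a pseudofunctor $\otimes:\mathfrak C\times\mathfrak C\to\mathfrak C$ with structural 2-isomorphisms $\widehat\otimes((f',g'),(f,g)):(f'\otimes g')\circ(f\otimes g)\Rightarrow(f'\circ f)\otimes(g'\circ g)$ and $\otimes_0(X,Y):id_X\otimes id_Y\Rightarrow id_{X\otimes Y}$, of a pseudonatural isomorphism $a$ with invertible 1-morphisms $a_{X,Y,Z}:X\otimes(Y\otimes Z)\to(X\otimes Y)\otimes Z$ and 2-isomorphisms $\widehat a(f,g,h):((f\otimes g)\otimes h)\circ a_{X,Y,Z}\Rightarrow a_{X',Y',Z'}\circ(f\otimes(g\otimes h))$, and of an invertible modification $\pi$ (the pentagonator) with components $\pi_{X,Y,Z,W}:(a_{X,Y,Z}\otimes id_W)\circ a_{X,Y\otimes Z,W}\circ(id_X\otimes a_{Y,Z,W})\Rightarrow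 a_{X\otimes Y,Z,W}\circ a_{X,Y,Z\otimes W}$ satisfying the $K_5$ (associahedron) coherence relation. A *$K$-linear Gray semigroup* $(\mathfrak C,\otimes)$ is such a structure on $\mathfrak C$ with $\otimes$ $K$-bilinear on 2-morphisms, in which $\otimes$ is cubical (all $\widehat\otimes((f',id),(f,g))$, all $\widehat\otimes((f,g'),(id,g))$ and all $\otimes_0(X,Y)$ are identities) and all $a_{X,Y,Z}$, $\widehat a(f,g,h)$ and $\pi_{X,Y,Z,W}$ are identities. **Deformations.** Let $\mathfrak C_{(1)}$ be the 2-category with the objects and 1-morphisms of $\mathfrak C$ and with 2-morphisms $\tau_0+\tau_1\varepsilon$ ($\tau_0,\tau_1$ 2-morphisms of $\mathfrak C$ with the same source and target), where $\varepsilon^2=0$; the compositions and $\otimes$ are extended $K[\varepsilon]/(\varepsilon^2)$-bilinearly. A *first order associator-deformation* of $(\mathfrak C,\otimes)$ is a semigroupal structure on $\mathfrak C_{(1)}$ with the same $\otimes$ on objects, 1- and 2-morphisms, the same $\widehat\otimes,\otimes_0,\pi$ and the same 1-morphisms $a_{X,Y,Z}$, and with $\widehat a_\varepsilon(f,g,h)=1_{f\otimes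 g\otimes h}+\widehat a^{(1)}(f,g,h)\,\varepsilon$. Two such deformations are *$\psi$-equivalent* if the identity 2-functor of $\mathfrak C_{(1)}$ admits a semigroupal structure from the first to the second, that is, a pseudonatural isomorphism $\psi$ between the two tensor products and an invertible modification $\omega$ satisfying the coherence relations of a semigroupal pseudofunctor, such that all 1-morphisms $\psi_{X,Y}$ are identities, the 2-isomorphisms have the form $\widehat\psi_\varepsilon(f,g)=1_{f\otimes g}+\widehat\psi^{(1)}(f,g)\,\varepsilon$, and $\omega$ is trivial (all $\omega_{X,Y,Z}$ are identities). **The complex.** For $n\ge 0$ let $\otimes(n+1)$ be the iterated tensor product of $n+1$ factors, a pseudofunctor with structural 2-isomorphisms $\widehat{\otimes(n+1)}$. Let $X^{0,n}_s$ be the $K$-module of families of 2-morphisms $$\phi(f_0,\dots,f_n):f_0\otimes\cdots\otimes f_n\Rightarrow f_0\otimes\cdots\otimes f_n ,$$ indexed by $(n+1)$-tuples of 1-morphisms of $\mathfrak C$, which are natural with respect to 2-morphisms in the $f_i$ and vanish when all $f_i$ are identities. For tuples $f=(f_0,\dots,f_n)$ and $g=(g_0,\dots,g_n)$ of composable 1-morphisms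 ($g\circ f$ defined) put $$(\delta_h\phi)(f,g)=\widehat{\otimes(n+1)}(g,f)\cdot\bigl(\phi(g)\circ 1_{f_0\otimes\cdots\otimes f_n}\bigr)-\phi(g\circ f)\cdot\widehat{\otimes(n+1)}(g,f)+\widehat{\otimes(n+1)}(g,f)\cdot\bigl(1_{g_0\otimes\cdots\otimes g_n}\circ\phi(f)\bigr),$$ and put $$(\delta_v\phi)(f_0,\dots,f_{n+1})=1_{f_0}\otimes\phi(f_1,\dots,f_{n+1})+\sum_{i=1}^{n+1}(-1)^i\phi(f_0,\dots,f_{i-1}\otimes f_i,\dots,f_{n+1})+(-1)^{n+2}\phi(f_0,\dots,f_n)\otimes 1_{f_{n+1}} .$$ Let $X^n_{ass}$ be the kernel of $\delta_h$ on $X^{0,n}_s$. **Theorem.** $\delta_v$ maps $X^1_{ass}$ into $\{\phi\in X^2_{ass}:\delta_v\phi=0\}$, so that $$H^2_{ass}=\frac{\ker(\delta_v|_{X^2_{ass}})}{\delta_v(X^1_{ass})}$$ is defined. The relation of $\psi$-equivalence between first order associator-deformations of $(\mathfrak C,\otimes)$ is an equivalence relation, and $\psi$-equivalence classes of first order associator-deformations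 of $(\mathfrak C,\otimes)$ are in bijection with the elements of $H^2_{ass}$: for every deformation, $\widehat a^{(1)}$ is a 2-cocycle, and sending the class of the deformation to the class of $\widehat a^{(1)}$ is a well-defined bijection. -/

import Mathlib

open CategoryTheory Bicategory

universe w v u

namespace GrayDeformation

/-! ### Linear 2-categories

A 2-category is a strict bicategory: `[Bicategory B] [Bicategory.Strict B]`. Composition is written
in diagrammatic order, so `f ≫ g` is the composite usually written `g ∘ f`. -/

/-- The compatibility making a bicategory with `K`-linear hom-categories a `K`-linear bicategory:
horizontal composition of 2-cells is `K`-bilinear. -/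
class LinearBicategory (K : Type*) [CommRing K] (B : Type u) [Bicategory.{w, v} B]
    [∀ X Y : B, Preadditive (X ⟶ Y)] [∀ X Y : B, Linear K (X ⟶ Y)] : Prop where
  whiskerLeft_add : ∀ {X Y Z : B} (f : X ⟶ Y) {g h : Y ⟶ Z} (α β : g ⟶ h),
    f ◁ (α + β) = f ◁ α + f ◁ β
  whiskerLeft_smul : ∀ {X Y Z : B} (f : X ⟶ Y) {g h : Y ⟶ Z} (r : K) (α : g ⟶ h),
    f ◁ (r • α) = r • (f ◁ α)
  add_whiskerRight : ∀ {X Y Z : B} {f g : X ⟶ Y} (α β : f ⟶ g) (h : Y ⟶ Z),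
    (α + β) ▷ h = α ▷ h + β ▷ h
  smul_whiskerRight : ∀ {X Y Z : B} {f g : X ⟶ Y} (r : K) (α : f ⟶ g) (h : Y ⟶ Z),
    (r • α) ▷ h = r • (α ▷ h)

section Semigroupal

variable {B : Type u} [Bicategory.{w, v} B]

/-- Horizontal composition of 2-cells. -/
def hcomp {X Y Z : B} {f g : X ⟶ Y} {h k : Y ⟶ Z} (α : f ⟶ g) (β : h ⟶ k) : f ≫ h ⟶ g ≫ k :=
  α ▷ h ≫ g ◁ β

/-- A 1-cell is an identity. -/
def IsIdentity₁ {X Y : B} (f : X ⟶ Y) : Prop := ∃ h : X = Y, f = eqToHom h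

/-- A 2-cell is an identity. -/
def IsIdentity₂ {X Y : B} {f g : X ⟶ Y} (α : f ⟶ g) : Prop := ∃ h : f = g, α = eqToHom h

variable (B) in
/-- The part of a semigroupal structure that stays fixed under deformation: the tensor product of
objects, the functors `B(X, X') × B(Y, Y') ⥤ B(X ⊗ Y, X' ⊗ Y')`, and the associator 1-isomorphisms
`X ⊗ (Y ⊗ Z) ⟶ (X ⊗ Y) ⊗ Z`. -/
structure TensorCore where
  obj : B → B → B
  map : ∀ {X X' Y Y' : B}, (X ⟶ X') → (Y ⟶ Y') → (obj X Y ⟶ obj X' Y')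
  map₂ : ∀ {X X' Y Y' : B} {f f' : X ⟶ X'} {g g' : Y ⟶ Y'},
    (f ⟶ f') → (g ⟶ g') → (map f g ⟶ map f' g')
  map₂_id : ∀ {X X' Y Y' : B} (f : X ⟶ X') (g : Y ⟶ Y'), map₂ (𝟙 f) (𝟙 g) = 𝟙 (map f g)
  map₂_comp : ∀ {X X' Y Y' : B} {f f' f'' : X ⟶ X'} {g g' g'' : Y ⟶ Y'}
    (α : f ⟶ f') (α' : f' ⟶ f'') (β : g ⟶ g') (β' : g' ⟶ g''),
    map₂ (α ≫ α') (β ≫ β') = map₂ α β ≫ map₂ α' β'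
  assoc : ∀ X Y Z : B, obj X (obj Y Z) ⟶ obj (obj X Y) Z
  assoc_iso : ∀ X Y Z : B, ∃ b : obj (obj X Y) Z ⟶ obj X (obj Y Z),
    assoc X Y Z ≫ b = 𝟙 _ ∧ b ≫ assoc X Y Z = 𝟙 _

/-- The tensor product is `K`-bilinear on 2-cells. -/
structure TensorCore.IsBilinear (K : Type*) [CommRing K] [∀ X Y : B, Preadditive (X ⟶ Y)]
    [∀ X Y : B, Linear K (X ⟶ Y)] (T : TensorCore B) : Prop where
  add_map₂ : ∀ {X X' Y Y' : B} {f f' : X ⟶ X'} {g g' : Y ⟶ Y'} (α β : f ⟶ f') (γ : g ⟶ g'),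
    T.map₂ (α + β) γ = T.map₂ α γ + T.map₂ β γ
  map₂_add : ∀ {X X' Y Y' : B} {f f' : X ⟶ X'} {g g' : Y ⟶ Y'} (α : f ⟶ f') (β γ : g ⟶ g'),
    T.map₂ α (β + γ) = T.map₂ α β + T.map₂ α γ
  smul_map₂ : ∀ {X X' Y Y' : B} {f f' : X ⟶ X'} {g g' : Y ⟶ Y'} (r : K) (α : f ⟶ f')
    (β : g ⟶ g'), T.map₂ (r • α) β = r • T.map₂ α β
  map₂_smul : ∀ {X X' Y Y' : B} {f f' : X ⟶ X'} {g g' : Y ⟶ Y'} (r : K) (α : f ⟶ f')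
    (β : g ⟶ g'), T.map₂ α (r • β) = r • T.map₂ α β

/-- The structural 2-isomorphisms of a semigroupal structure: those of the pseudofunctor `⊗`
(`tens` for composites and `unit` for identities), those of the associator (`ahat`), and the
pentagonator (`pi`). -/
structure SemigroupalCells (T : TensorCore B) where
  tens : ∀ {X X' X'' Y Y' Y'' : B} (f : X ⟶ X') (f' : X' ⟶ X'') (g : Y ⟶ Y') (g' : Y' ⟶ Y''),
    T.map f g ≫ T.map f' g' ≅ T.map (f ≫ f') (g ≫ g')
  unit : ∀ X Y : B, T.map (𝟙 X) (𝟙 Y) ≅ 𝟙 (T.obj X Y)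
  ahat : ∀ {X X' Y Y' Z Z' : B} (f : X ⟶ X') (g : Y ⟶ Y') (h : Z ⟶ Z'),
    T.assoc X Y Z ≫ T.map (T.map f g) h ≅ T.map f (T.map g h) ≫ T.assoc X' Y' Z'
  pi : ∀ X Y Z W : B,
    T.map (𝟙 X) (T.assoc Y Z W) ≫ T.assoc X (T.obj Y Z) W ≫ T.map (T.assoc X Y Z) (𝟙 W) ≅
      T.assoc X Y (T.obj Z W) ≫ T.assoc (T.obj X Y) Z W

namespace SemigroupalCells

variable {T : TensorCore B} (S : SemigroupalCells T)

/-- The structural 2-isomorphism of `⊗` for three composable 1-cells. -/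
def tens₃ {X X' X'' X''' Y Y' Y'' Y''' : B} (f : X ⟶ X') (f' : X' ⟶ X'') (f'' : X'' ⟶ X''')
    (g : Y ⟶ Y') (g' : Y' ⟶ Y'') (g'' : Y'' ⟶ Y''') :
    T.map f g ≫ T.map f' g' ≫ T.map f'' g'' ≅ T.map (f ≫ f' ≫ f'') (g ≫ g' ≫ g'') :=
  whiskerLeftIso (T.map f g) (S.tens f' f'' g' g'') ≪≫ S.tens f (f' ≫ f'') g (g' ≫ g'')

/-- The pasting of `1_{id_X} ⊗ π_{Y,Z,W,U}` with structural 2-isomorphisms of `⊗`. -/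
def idPi (X Y Z W U : B) :
    T.map (𝟙 X) (T.map (𝟙 Y) (T.assoc Z W U)) ≫ T.map (𝟙 X) (T.assoc Y (T.obj Z W) U) ≫
        T.map (𝟙 X) (T.map (T.assoc Y Z W) (𝟙 U)) ⟶
      T.map (𝟙 X) (T.assoc Y Z (T.obj W U)) ≫ T.map (𝟙 X) (T.assoc (T.obj Y Z) W U) :=
  (S.tens₃ _ _ _ _ _ _).hom ≫ T.map₂ (λ_ (𝟙 X ≫ 𝟙 X)).hom (S.pi Y Z W U).hom ≫
    (S.tens _ _ _ _).inv

/-- The pasting of `π_{X,Y,Z,W} ⊗ 1_{id_U}` with structural 2-isomorphisms of `⊗`. -/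
def piId (X Y Z W U : B) :
    T.map (T.map (𝟙 X) (T.assoc Y Z W)) (𝟙 U) ≫ T.map (T.assoc X (T.obj Y Z) W) (𝟙 U) ≫
        T.map (T.map (T.assoc X Y Z) (𝟙 W)) (𝟙 U) ⟶
      T.map (T.assoc X Y (T.obj Z W)) (𝟙 U) ≫ T.map (T.assoc (T.obj X Y) Z W) (𝟙 U) :=
  (S.tens₃ _ _ _ _ _ _).hom ≫ T.map₂ (S.pi X Y Z W).hom (λ_ (𝟙 U ≫ 𝟙 U)).hom ≫
    (S.tens _ _ _ _).inv

/-- The structural equations of a semigroupal 2-category: `⊗` is a pseudofunctor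
(`tens_natural`, `tens_assoc`, `tens_id_right`, `tens_id_left`), the associator is a pseudonatural
isomorphism (`ahat_natural`, `ahat_comp`, `ahat_id`), the pentagonator is a modification
(`pi_natural`) and satisfies the `K₅` coherence relation (`pi_coherence`). In a strict bicategory
the coherence 2-cells inserted by `⊗≫`, `α_`, `λ_` and `ρ_` are identities. -/
structure IsSemigroupal : Prop where
  tens_natural : ∀ {X X' X'' Y Y' Y'' : B} {f f₁ : X ⟶ X'} {f' f₁' : X' ⟶ X''}
    {g g₁ : Y ⟶ Y'} {g' g₁' : Y' ⟶ Y''} (τ : f ⟶ f₁) (τ' : f' ⟶ f₁') (σ : g ⟶ g₁)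
    (σ' : g' ⟶ g₁'),
    hcomp (T.map₂ τ σ) (T.map₂ τ' σ') ≫ (S.tens f₁ f₁' g₁ g₁').hom =
      (S.tens f f' g g').hom ≫ T.map₂ (hcomp τ τ') (hcomp σ σ')
  tens_assoc : ∀ {X X' X'' X''' Y Y' Y'' Y''' : B} (f : X ⟶ X') (f' : X' ⟶ X'')
    (f'' : X'' ⟶ X''') (g : Y ⟶ Y') (g' : Y' ⟶ Y'') (g'' : Y'' ⟶ Y'''),
    T.map f g ◁ (S.tens f' f'' g' g'').hom ≫ (S.tens f (f' ≫ f'') g (g' ≫ g'')).hom =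
      (α_ _ _ _).inv ≫ (S.tens f f' g g').hom ▷ T.map f'' g'' ≫
        (S.tens (f ≫ f') f'' (g ≫ g') g'').hom ≫ T.map₂ (α_ f f' f'').hom (α_ g g' g'').hom
  tens_id_right : ∀ {X X' Y Y' : B} (f : X ⟶ X') (g : Y ⟶ Y'),
    (S.tens f (𝟙 X') g (𝟙 Y')).hom ≫ T.map₂ (ρ_ f).hom (ρ_ g).hom =
      T.map f g ◁ (S.unit X' Y').hom ≫ (ρ_ (T.map f g)).hom
  tens_id_left : ∀ {X X' Y Y' : B} (f : X ⟶ X') (g : Y ⟶ Y'),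
    (S.tens (𝟙 X) f (𝟙 Y) g).hom ≫ T.map₂ (λ_ f).hom (λ_ g).hom =
      (S.unit X Y).hom ▷ T.map f g ≫ (λ_ (T.map f g)).hom
  ahat_natural : ∀ {X X' Y Y' Z Z' : B} {f f₁ : X ⟶ X'} {g g₁ : Y ⟶ Y'} {h h₁ : Z ⟶ Z'}
    (τ : f ⟶ f₁) (σ : g ⟶ g₁) (η : h ⟶ h₁),
    (S.ahat f g h).hom ≫ T.map₂ τ (T.map₂ σ η) ▷ T.assoc X' Y' Z' =
      T.assoc X Y Z ◁ T.map₂ (T.map₂ τ σ) η ≫ (S.ahat f₁ g₁ h₁).hom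
  ahat_comp : ∀ {X X' X'' Y Y' Y'' Z Z' Z'' : B} (f : X ⟶ X') (f' : X' ⟶ X'') (g : Y ⟶ Y')
    (g' : Y' ⟶ Y'') (h : Z ⟶ Z') (h' : Z' ⟶ Z''),
    T.assoc X Y Z ◁ (S.tens (T.map f g) (T.map f' g') h h').hom ≫
        T.assoc X Y Z ◁ T.map₂ (S.tens f f' g g').hom (𝟙 (h ≫ h')) ≫
        (S.ahat (f ≫ f') (g ≫ g') (h ≫ h')).hom =
      (α_ _ _ _).inv ≫ (S.ahat f g h).hom ▷ T.map (T.map f' g') h' ≫ (α_ _ _ _).hom ≫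
        T.map f (T.map g h) ◁ (S.ahat f' g' h').hom ≫ (α_ _ _ _).inv ≫
        (S.tens f f' (T.map g h) (T.map g' h')).hom ▷ T.assoc X'' Y'' Z'' ≫
        T.map₂ (𝟙 (f ≫ f')) (S.tens g g' h h').hom ▷ T.assoc X'' Y'' Z''
  ahat_id : ∀ X Y Z : B,
    (S.ahat (𝟙 X) (𝟙 Y) (𝟙 Z)).hom =
      T.assoc X Y Z ◁ (T.map₂ (S.unit X Y).hom (𝟙 (𝟙 Z)) ≫ (S.unit (T.obj X Y) Z).hom) ⊗≫
        ((S.unit X (T.obj Y Z)).inv ≫ T.map₂ (𝟙 (𝟙 X)) (S.unit Y Z).inv) ▷ T.assoc X Y Z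
  pi_natural : ∀ {X X' Y Y' Z Z' W W' : B} (f : X ⟶ X') (g : Y ⟶ Y') (h : Z ⟶ Z') (k : W ⟶ W'),
    (S.pi X Y Z W).hom ▷ T.map (T.map (T.map f g) h) k ⊗≫
        T.assoc X Y (T.obj Z W) ◁ (S.ahat (T.map f g) h k).hom ⊗≫
        (S.ahat f g (T.map h k)).hom ▷ T.assoc (T.obj X' Y') Z' W' ⊗≫
        𝟙 (T.map f (T.map g (T.map h k)) ≫
          T.assoc X' Y' (T.obj Z' W') ≫ T.assoc (T.obj X' Y') Z' W') =
      𝟙 ((T.map (𝟙 X) (T.assoc Y Z W) ≫ T.assoc X (T.obj Y Z) W ≫ T.map (T.assoc X Y Z) (𝟙 W)) ≫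
          T.map (T.map (T.map f g) h) k) ⊗≫
        (T.map (𝟙 X) (T.assoc Y Z W) ≫ T.assoc X (T.obj Y Z) W) ◁
          ((S.tens (T.assoc X Y Z) (T.map (T.map f g) h) (𝟙 W) k).hom ≫
            T.map₂ (S.ahat f g h).hom ((λ_ k).hom ≫ (ρ_ k).inv) ≫
            (S.tens (T.map f (T.map g h)) (T.assoc X' Y' Z') k (𝟙 W')).inv) ⊗≫
        T.map (𝟙 X) (T.assoc Y Z W) ◁ (S.ahat f (T.map g h) k).hom ▷
          T.map (T.assoc X' Y' Z') (𝟙 W') ⊗≫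
        ((S.tens (𝟙 X) f (T.assoc Y Z W) (T.map (T.map g h) k)).hom ≫
            T.map₂ ((λ_ f).hom ≫ (ρ_ f).inv) (S.ahat g h k).hom ≫
            (S.tens f (𝟙 X') (T.map g (T.map h k)) (T.assoc Y' Z' W')).inv) ▷
          (T.assoc X' (T.obj Y' Z') W' ≫ T.map (T.assoc X' Y' Z') (𝟙 W')) ⊗≫
        T.map f (T.map g (T.map h k)) ◁ (S.pi X' Y' Z' W').hom
  pi_coherence : ∀ X Y Z W U : B,
    𝟙 (T.map (𝟙 X) (T.map (𝟙 Y) (T.assoc Z W U)) ≫ T.map (𝟙 X) (T.assoc Y (T.obj Z W) U) ≫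
          T.assoc X (T.obj Y (T.obj Z W)) U ≫ T.map (T.map (𝟙 X) (T.assoc Y Z W)) (𝟙 U) ≫
          T.map (T.assoc X (T.obj Y Z) W) (𝟙 U) ≫ T.map (T.map (T.assoc X Y Z) (𝟙 W)) (𝟙 U)) ⊗≫
        (T.map (𝟙 X) (T.map (𝟙 Y) (T.assoc Z W U)) ≫ T.map (𝟙 X) (T.assoc Y (T.obj Z W) U) ≫
          T.assoc X (T.obj Y (T.obj Z W)) U) ◁ S.piId X Y Z W U ⊗≫
        T.map (𝟙 X) (T.map (𝟙 Y) (T.assoc Z W U)) ◁ (S.pi X Y (T.obj Z W) U).hom ▷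
          T.map (T.assoc (T.obj X Y) Z W) (𝟙 U) ⊗≫
        (S.ahat (𝟙 X) (𝟙 Y) (T.assoc Z W U)).inv ▷
          (T.assoc (T.obj X Y) (T.obj Z W) U ≫ T.map (T.assoc (T.obj X Y) Z W) (𝟙 U)) ⊗≫
        T.assoc X Y (T.obj Z (T.obj W U)) ◁
          T.map₂ (S.unit X Y).hom (𝟙 (T.assoc Z W U)) ▷
          (T.assoc (T.obj X Y) (T.obj Z W) U ≫ T.map (T.assoc (T.obj X Y) Z W) (𝟙 U)) ⊗≫
        T.assoc X Y (T.obj Z (T.obj W U)) ◁ (S.pi (T.obj X Y) Z W U).hom =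
      𝟙 (T.map (𝟙 X) (T.map (𝟙 Y) (T.assoc Z W U)) ≫ T.map (𝟙 X) (T.assoc Y (T.obj Z W) U) ≫
          T.assoc X (T.obj Y (T.obj Z W)) U ≫ T.map (T.map (𝟙 X) (T.assoc Y Z W)) (𝟙 U) ≫
          T.map (T.assoc X (T.obj Y Z) W) (𝟙 U) ≫ T.map (T.map (T.assoc X Y Z) (𝟙 W)) (𝟙 U)) ⊗≫
        (T.map (𝟙 X) (T.map (𝟙 Y) (T.assoc Z W U)) ≫ T.map (𝟙 X) (T.assoc Y (T.obj Z W) U)) ◁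
          (S.ahat (𝟙 X) (T.assoc Y Z W) (𝟙 U)).hom ▷
          (T.map (T.assoc X (T.obj Y Z) W) (𝟙 U) ≫
            T.map (T.map (T.assoc X Y Z) (𝟙 W)) (𝟙 U)) ⊗≫
        S.idPi X Y Z W U ▷
          (T.assoc X (T.obj (T.obj Y Z) W) U ≫ T.map (T.assoc X (T.obj Y Z) W) (𝟙 U) ≫
            T.map (T.map (T.assoc X Y Z) (𝟙 W)) (𝟙 U)) ⊗≫
        T.map (𝟙 X) (T.assoc Y Z (T.obj W U)) ◁ (S.pi X (T.obj Y Z) W U).hom ▷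
          T.map (T.map (T.assoc X Y Z) (𝟙 W)) (𝟙 U) ⊗≫
        (T.map (𝟙 X) (T.assoc Y Z (T.obj W U)) ≫ T.assoc X (T.obj Y Z) (T.obj W U)) ◁
          (S.ahat (T.assoc X Y Z) (𝟙 W) (𝟙 U)).hom ⊗≫
        (T.map (𝟙 X) (T.assoc Y Z (T.obj W U)) ≫ T.assoc X (T.obj Y Z) (T.obj W U)) ◁
          T.map₂ (𝟙 (T.assoc X Y Z)) (S.unit W U).hom ▷ T.assoc (T.obj (T.obj X Y) Z) W U ⊗≫
        (S.pi X Y Z (T.obj W U)).hom ▷ T.assoc (T.obj (T.obj X Y) Z) W U ⊗≫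
        𝟙 (T.assoc X Y (T.obj Z (T.obj W U)) ≫ T.assoc (T.obj X Y) Z (T.obj W U) ≫
          T.assoc (T.obj (T.obj X Y) Z) W U)

end SemigroupalCells

/-! ### Semigroupal structures on an identity 2-functor -/

section IdentityFunctor

variable {T : TensorCore B}

/-- The pasting of `1_{id_X} ⊗ ω_{Y,Z,W}` with structural 2-isomorphisms of `⊗`. -/
def idOmega (S' : SemigroupalCells T) (ψ : ∀ X Y : B, T.obj X Y ⟶ T.obj X Y)
    (ω : ∀ X Y Z : B, T.map (𝟙 X) (ψ Y Z) ≫ ψ X (T.obj Y Z) ≫ T.assoc X Y Z ≅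
      T.assoc X Y Z ≫ T.map (ψ X Y) (𝟙 Z) ≫ ψ (T.obj X Y) Z) (X Y Z W : B) :
    T.map (𝟙 X) (T.map (𝟙 Y) (ψ Z W)) ≫ T.map (𝟙 X) (ψ Y (T.obj Z W)) ≫
        T.map (𝟙 X) (T.assoc Y Z W) ⟶
      T.map (𝟙 X) (T.assoc Y Z W) ≫ T.map (𝟙 X) (T.map (ψ Y Z) (𝟙 W)) ≫
        T.map (𝟙 X) (ψ (T.obj Y Z) W) :=
  (S'.tens₃ _ _ _ _ _ _).hom ≫ T.map₂ (𝟙 (𝟙 X ≫ 𝟙 X ≫ 𝟙 X)) (ω Y Z W).hom ≫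
    (S'.tens₃ _ _ _ _ _ _).inv

/-- The pasting of `ω_{X,Y,Z} ⊗ 1_{id_W}` with structural 2-isomorphisms of `⊗`. -/
def omegaId (S' : SemigroupalCells T) (ψ : ∀ X Y : B, T.obj X Y ⟶ T.obj X Y)
    (ω : ∀ X Y Z : B, T.map (𝟙 X) (ψ Y Z) ≫ ψ X (T.obj Y Z) ≫ T.assoc X Y Z ≅
      T.assoc X Y Z ≫ T.map (ψ X Y) (𝟙 Z) ≫ ψ (T.obj X Y) Z) (X Y Z W : B) :
    T.map (T.map (𝟙 X) (ψ Y Z)) (𝟙 W) ≫ T.map (ψ X (T.obj Y Z)) (𝟙 W) ≫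
        T.map (T.assoc X Y Z) (𝟙 W) ⟶
      T.map (T.assoc X Y Z) (𝟙 W) ≫ T.map (T.map (ψ X Y) (𝟙 Z)) (𝟙 W) ≫
        T.map (ψ (T.obj X Y) Z) (𝟙 W) :=
  (S'.tens₃ _ _ _ _ _ _).hom ≫ T.map₂ (ω X Y Z).hom (𝟙 (𝟙 W ≫ 𝟙 W ≫ 𝟙 W)) ≫
    (S'.tens₃ _ _ _ _ _ _).inv

/-- The 2-cell exchanging `ψ_{X,Y}` and `ψ_{Z,W}` in the coherence relation for `ω`. -/
def chi (S S' : SemigroupalCells T) (ψ : ∀ X Y : B, T.obj X Y ⟶ T.obj X Y)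
    (ψhat : ∀ {X X' Y Y' : B} (f : X ⟶ X') (g : Y ⟶ Y'),
      ψ X Y ≫ T.map f g ≅ T.map f g ≫ ψ X' Y') (X Y Z W : B) :
    T.map (T.map (𝟙 X) (𝟙 Y)) (ψ Z W) ≫ T.map (ψ X Y) (𝟙 (T.obj Z W)) ⟶
      T.map (ψ X Y) (T.map (𝟙 Z) (𝟙 W)) ≫ T.map (𝟙 (T.obj X Y)) (ψ Z W) :=
  (S'.tens _ _ _ _).hom ≫
    T.map₂ ((ψhat (𝟙 X) (𝟙 Y)).inv ≫ ψ X Y ◁ (S.unit X Y).hom)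
      (ψ Z W ◁ (S.unit Z W).inv ≫ (ψhat (𝟙 Z) (𝟙 W)).hom) ≫
    (S'.tens _ _ _ _).inv

/-- The data `(ψ, ω)`, where the pseudonatural isomorphism `ψ` has 1-cells `ψ X Y` and 2-cells
`ψhat f g`, is a semigroupal structure on the identity 2-functor, from the semigroupal structure
with 2-cells `S` to the one with 2-cells `S'`. Here both structures have the same underlying
tensor product of objects, 1-cells and 2-cells and the same associator 1-cells. -/
structure IsSemigroupalStructureOnId (S S' : SemigroupalCells T)
    (ψ : ∀ X Y : B, T.obj X Y ⟶ T.obj X Y)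
    (ψhat : ∀ {X X' Y Y' : B} (f : X ⟶ X') (g : Y ⟶ Y'),
      ψ X Y ≫ T.map f g ≅ T.map f g ≫ ψ X' Y')
    (ω : ∀ X Y Z : B, T.map (𝟙 X) (ψ Y Z) ≫ ψ X (T.obj Y Z) ≫ T.assoc X Y Z ≅
      T.assoc X Y Z ≫ T.map (ψ X Y) (𝟙 Z) ≫ ψ (T.obj X Y) Z) : Prop where
  psi_iso : ∀ X Y : B, ∃ b : T.obj X Y ⟶ T.obj X Y, ψ X Y ≫ b = 𝟙 _ ∧ b ≫ ψ X Y = 𝟙 _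
  psi_natural : ∀ {X X' Y Y' : B} {f f₁ : X ⟶ X'} {g g₁ : Y ⟶ Y'} (τ : f ⟶ f₁) (σ : g ⟶ g₁),
    (ψhat f g).hom ≫ T.map₂ τ σ ▷ ψ X' Y' = ψ X Y ◁ T.map₂ τ σ ≫ (ψhat f₁ g₁).hom
  psi_comp : ∀ {X X' X'' Y Y' Y'' : B} (f : X ⟶ X') (f' : X' ⟶ X'') (g : Y ⟶ Y')
    (g' : Y' ⟶ Y''),
    ψ X Y ◁ (S.tens f f' g g').hom ≫ (ψhat (f ≫ f') (g ≫ g')).hom =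
      (α_ _ _ _).inv ≫ (ψhat f g).hom ▷ T.map f' g' ≫ (α_ _ _ _).hom ≫
        T.map f g ◁ (ψhat f' g').hom ≫ (α_ _ _ _).inv ≫ (S'.tens f f' g g').hom ▷ ψ X'' Y''
  psi_id : ∀ X Y : B,
    (ψhat (𝟙 X) (𝟙 Y)).hom =
      ψ X Y ◁ (S.unit X Y).hom ≫ (ρ_ (ψ X Y)).hom ≫ (λ_ (ψ X Y)).inv ≫ (S'.unit X Y).inv ▷ ψ X Y
  omega_natural : ∀ {X X' Y Y' Z Z' : B} (f : X ⟶ X') (g : Y ⟶ Y') (h : Z ⟶ Z'),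
    𝟙 ((T.map (𝟙 X) (ψ Y Z) ≫ ψ X (T.obj Y Z) ≫ T.assoc X Y Z) ≫ T.map (T.map f g) h) ⊗≫
        (T.map (𝟙 X) (ψ Y Z) ≫ ψ X (T.obj Y Z)) ◁ (S.ahat f g h).hom ⊗≫
        T.map (𝟙 X) (ψ Y Z) ◁ (ψhat f (T.map g h)).hom ▷ T.assoc X' Y' Z' ⊗≫
        ((S'.tens (𝟙 X) f (ψ Y Z) (T.map g h)).hom ≫
            T.map₂ ((λ_ f).hom ≫ (ρ_ f).inv) (ψhat g h).hom ≫
            (S'.tens f (𝟙 X') (T.map g h) (ψ Y' Z')).inv) ▷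
          (ψ X' (T.obj Y' Z') ≫ T.assoc X' Y' Z') ⊗≫
        T.map f (T.map g h) ◁ (ω X' Y' Z').hom =
      (ω X Y Z).hom ▷ T.map (T.map f g) h ⊗≫
        (T.assoc X Y Z ≫ T.map (ψ X Y) (𝟙 Z)) ◁ (ψhat (T.map f g) h).hom ⊗≫
        T.assoc X Y Z ◁
          ((S'.tens (ψ X Y) (T.map f g) (𝟙 Z) h).hom ≫
            T.map₂ (ψhat f g).hom ((λ_ h).hom ≫ (ρ_ h).inv) ≫
            (S'.tens (T.map f g) (ψ X' Y') h (𝟙 Z')).inv) ▷ ψ (T.obj X' Y') Z' ⊗≫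
        (S'.ahat f g h).hom ▷ (T.map (ψ X' Y') (𝟙 Z') ≫ ψ (T.obj X' Y') Z') ⊗≫
        𝟙 (T.map f (T.map g h) ≫
          T.assoc X' Y' Z' ≫ T.map (ψ X' Y') (𝟙 Z') ≫ ψ (T.obj X' Y') Z')
  omega_coherence : ∀ X Y Z W : B,
    𝟙 (T.map (𝟙 X) (T.map (𝟙 Y) (ψ Z W)) ≫ T.map (𝟙 X) (ψ Y (T.obj Z W)) ≫
          ψ X (T.obj Y (T.obj Z W)) ≫ T.map (𝟙 X) (T.assoc Y Z W) ≫ T.assoc X (T.obj Y Z) W ≫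
          T.map (T.assoc X Y Z) (𝟙 W)) ⊗≫
        (T.map (𝟙 X) (T.map (𝟙 Y) (ψ Z W)) ≫ T.map (𝟙 X) (ψ Y (T.obj Z W)) ≫
          ψ X (T.obj Y (T.obj Z W))) ◁ (S.pi X Y Z W).hom ⊗≫
        T.map (𝟙 X) (T.map (𝟙 Y) (ψ Z W)) ◁ (ω X Y (T.obj Z W)).hom ▷
          T.assoc (T.obj X Y) Z W ⊗≫
        (S'.ahat (𝟙 X) (𝟙 Y) (ψ Z W)).inv ▷
          (T.map (ψ X Y) (𝟙 (T.obj Z W)) ≫ ψ (T.obj X Y) (T.obj Z W) ≫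
            T.assoc (T.obj X Y) Z W) ⊗≫
        T.assoc X Y (T.obj Z W) ◁ chi S S' ψ ψhat X Y Z W ▷
          (ψ (T.obj X Y) (T.obj Z W) ≫ T.assoc (T.obj X Y) Z W) ⊗≫
        (T.assoc X Y (T.obj Z W) ≫ T.map (ψ X Y) (T.map (𝟙 Z) (𝟙 W))) ◁
          (ω (T.obj X Y) Z W).hom ⊗≫
        T.assoc X Y (T.obj Z W) ◁ (S'.ahat (ψ X Y) (𝟙 Z) (𝟙 W)).inv ▷
          (T.map (ψ (T.obj X Y) Z) (𝟙 W) ≫ ψ (T.obj (T.obj X Y) Z) W) ⊗≫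
        𝟙 (T.assoc X Y (T.obj Z W) ≫ T.assoc (T.obj X Y) Z W ≫
          T.map (T.map (ψ X Y) (𝟙 Z)) (𝟙 W) ≫ T.map (ψ (T.obj X Y) Z) (𝟙 W) ≫
          ψ (T.obj (T.obj X Y) Z) W) =
      𝟙 (T.map (𝟙 X) (T.map (𝟙 Y) (ψ Z W)) ≫ T.map (𝟙 X) (ψ Y (T.obj Z W)) ≫
          ψ X (T.obj Y (T.obj Z W)) ≫ T.map (𝟙 X) (T.assoc Y Z W) ≫ T.assoc X (T.obj Y Z) W ≫
          T.map (T.assoc X Y Z) (𝟙 W)) ⊗≫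
        (T.map (𝟙 X) (T.map (𝟙 Y) (ψ Z W)) ≫ T.map (𝟙 X) (ψ Y (T.obj Z W))) ◁
          (ψhat (𝟙 X) (T.assoc Y Z W)).hom ▷
          (T.assoc X (T.obj Y Z) W ≫ T.map (T.assoc X Y Z) (𝟙 W)) ⊗≫
        idOmega S' ψ ω X Y Z W ▷
          (ψ X (T.obj (T.obj Y Z) W) ≫ T.assoc X (T.obj Y Z) W ≫
            T.map (T.assoc X Y Z) (𝟙 W)) ⊗≫
        (T.map (𝟙 X) (T.assoc Y Z W) ≫ T.map (𝟙 X) (T.map (ψ Y Z) (𝟙 W))) ◁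
          (ω X (T.obj Y Z) W).hom ▷ T.map (T.assoc X Y Z) (𝟙 W) ⊗≫
        T.map (𝟙 X) (T.assoc Y Z W) ◁ (S'.ahat (𝟙 X) (ψ Y Z) (𝟙 W)).inv ▷
          (T.map (ψ X (T.obj Y Z)) (𝟙 W) ≫ ψ (T.obj X (T.obj Y Z)) W ≫
            T.map (T.assoc X Y Z) (𝟙 W)) ⊗≫
        (T.map (𝟙 X) (T.assoc Y Z W) ≫ T.assoc X (T.obj Y Z) W ≫
          T.map (T.map (𝟙 X) (ψ Y Z)) (𝟙 W) ≫ T.map (ψ X (T.obj Y Z)) (𝟙 W)) ◁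
          (ψhat (T.assoc X Y Z) (𝟙 W)).hom ⊗≫
        (T.map (𝟙 X) (T.assoc Y Z W) ≫ T.assoc X (T.obj Y Z) W) ◁
          omegaId S' ψ ω X Y Z W ▷ ψ (T.obj (T.obj X Y) Z) W ⊗≫
        (S'.pi X Y Z W).hom ▷
          (T.map (T.map (ψ X Y) (𝟙 Z)) (𝟙 W) ≫ T.map (ψ (T.obj X Y) Z) (𝟙 W) ≫
            ψ (T.obj (T.obj X Y) Z) W) ⊗≫
        𝟙 (T.assoc X Y (T.obj Z W) ≫ T.assoc (T.obj X Y) Z W ≫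
          T.map (T.map (ψ X Y) (𝟙 Z)) (𝟙 W) ≫ T.map (ψ (T.obj X Y) Z) (𝟙 W) ≫
          ψ (T.obj (T.obj X Y) Z) W)

/-- The modification `ω` that is required to be undeformed in a `ψ`-equivalence: when all `ψ_{X,Y}`
are identities, `ω_{X,Y,Z}` is built from `⊗₀(X, Y ⊗ Z)` and the inverse of `⊗₀(X ⊗ Y, Z)`. -/
def omegaNull (S : SemigroupalCells T) (X Y Z : B) :
    T.map (𝟙 X) (𝟙 (T.obj Y Z)) ≫ 𝟙 (T.obj X (T.obj Y Z)) ≫ T.assoc X Y Z ≅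
      T.assoc X Y Z ≫ T.map (𝟙 (T.obj X Y)) (𝟙 Z) ≫ 𝟙 (T.obj (T.obj X Y) Z) :=
  whiskerRightIso (S.unit X (T.obj Y Z)) (𝟙 _ ≫ T.assoc X Y Z) ≪≫ λ_ _ ≪≫ λ_ _ ≪≫
    (ρ_ (T.assoc X Y Z)).symm ≪≫
    whiskerLeftIso (T.assoc X Y Z) ((S.unit (T.obj X Y) Z).symm ≪≫ (ρ_ _).symm)

end IdentityFunctor

/-- The semigroupal structure is that of a Gray semigroup: `⊗` is a cubical pseudofunctor, and the
associator and the pentagonator consist of identities. -/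
structure IsGray (T : TensorCore B) (S : SemigroupalCells T) : Prop where
  semigroupal : S.IsSemigroupal
  tens_identity_left : ∀ {X X' X'' Y Y' : B} (f : X ⟶ X') (f' : X' ⟶ X'') (g : Y ⟶ Y'),
    IsIdentity₂ (S.tens f f' g (𝟙 Y')).hom
  tens_identity_right : ∀ {X X' Y Y' Y'' : B} (f : X ⟶ X') (g : Y ⟶ Y') (g' : Y' ⟶ Y''),
    IsIdentity₂ (S.tens (𝟙 X) f g g').hom
  unit_identity : ∀ X Y : B, IsIdentity₂ (S.unit X Y).hom
  assoc_identity : ∀ X Y Z : B, IsIdentity₁ (T.assoc X Y Z)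
  ahat_identity : ∀ {X X' Y Y' Z Z' : B} (f : X ⟶ X') (g : Y ⟶ Y') (h : Z ⟶ Z'),
    IsIdentity₂ (S.ahat f g h).hom
  pi_identity : ∀ X Y Z W : B, IsIdentity₂ (S.pi X Y Z W).hom

end Semigroupal

/-- A `K`-linear Gray semigroup structure on a `K`-linear 2-category. -/
structure GraySemigroup (K : Type*) [CommRing K] (B : Type u) [Bicategory.{w, v} B]
    [∀ X Y : B, Preadditive (X ⟶ Y)] [∀ X Y : B, Linear K (X ⟶ Y)] where
  core : TensorCore B
  cells : SemigroupalCells core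
  bilinear : core.IsBilinear K
  gray : IsGray core cells

/-! ### The extension of scalars to `K[ε]/(ε²)` -/

section Dual

/-- The objects of the `K[ε]/(ε²)`-linear extension of a `K`-linear 2-category `B`: those of `B`.
The 1-cells are those of `B`, and the 2-cells `f ⟶ g` are the expressions `τ₀ + τ₁ ε` with 2-cells
`τ₀ τ₁ : f ⟶ g` of `B`, that is, the elements of `Hom(f, g) ⊗[K] K[ε]/(ε²)`. -/
@[ext]
structure DualExt (K : Type*) (B : Type u) : Type u where
  obj : B

/-- A 1-cell of the extension. -/
@[ext]
structure DualHom {K : Type*} {B : Type u} [Bicategory.{w, v} B] (X Y : DualExt K B) :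
    Type v where
  hom : X.obj ⟶ Y.obj

/-- A 2-cell `re + eps ε` of the extension. -/
@[ext]
structure DualCell {K : Type*} {B : Type u} [Bicategory.{w, v} B] {X Y : DualExt K B}
    (f g : DualHom X Y) : Type w where
  re : f.hom ⟶ g.hom
  eps : f.hom ⟶ g.hom

section

variable {K : Type*} {B : Type u} [Bicategory.{w, v} B]

instance dualStruct : CategoryStruct.{v} (DualExt K B) where
  Hom X Y := DualHom X Y
  id X := ⟨𝟙 X.obj⟩
  comp f g := ⟨f.hom ≫ g.hom⟩

@[simp]
theorem dual_id_hom (X : DualExt K B) : (𝟙 X : X ⟶ X).hom = 𝟙 X.obj := rfl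

@[simp]
theorem dual_comp_hom {X Y Z : DualExt K B} (f : X ⟶ Y) (g : Y ⟶ Z) :
    (f ≫ g).hom = f.hom ≫ g.hom := rfl

variable [∀ X Y : B, Preadditive (X ⟶ Y)]

/-- Vertical composition: `(τ₀ + τ₁ ε) ≫ (σ₀ + σ₁ ε) = τ₀ ≫ σ₀ + (τ₀ ≫ σ₁ + τ₁ ≫ σ₀) ε`. -/
instance dualHomCategory (X Y : DualExt K B) : Category.{w} (X ⟶ Y) where
  Hom f g := DualCell f g
  id f := ⟨𝟙 f.hom, 0⟩
  comp α β := ⟨α.re ≫ β.re, α.re ≫ β.eps + α.eps ≫ β.re⟩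
  id_comp α := by apply DualCell.ext <;> simp
  comp_id α := by apply DualCell.ext <;> simp
  assoc α β γ := by
    apply DualCell.ext
    · simp
    · simp [add_assoc]

variable {X Y : DualExt K B}

@[simp]
theorem dual_comp_re {f g h : X ⟶ Y} (α : f ⟶ g) (β : g ⟶ h) : (α ≫ β).re = α.re ≫ β.re := rfl

@[simp]
theorem dual_comp_eps {f g h : X ⟶ Y} (α : f ⟶ g) (β : g ⟶ h) :
    (α ≫ β).eps = α.re ≫ β.eps + α.eps ≫ β.re := rfl

@[simp]
theorem dual_id_re (f : X ⟶ Y) : (𝟙 f : f ⟶ f).re = 𝟙 f.hom := rfl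

@[simp]
theorem dual_id_eps (f : X ⟶ Y) : (𝟙 f : f ⟶ f).eps = 0 := rfl

theorem dual_ext {f g : X ⟶ Y} {α β : f ⟶ g} (h : α.re = β.re) (h₁ : α.eps = β.eps) : α = β :=
  DualCell.ext h h₁

/-- The constant 2-isomorphism `α + 0 ε`. -/
@[simps]
def dualIso {f g : X ⟶ Y} (α : f.hom ≅ g.hom) : f ≅ g where
  hom := ⟨α.hom, 0⟩
  inv := ⟨α.inv, 0⟩
  hom_inv_id := by apply dual_ext <;> simp
  inv_hom_id := by apply dual_ext <;> simp

end

theorem whiskerLeft_zero (K : Type*) [CommRing K] {B : Type u} [Bicategory.{w, v} B]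
    [∀ X Y : B, Preadditive (X ⟶ Y)] [∀ X Y : B, Linear K (X ⟶ Y)] [LinearBicategory K B]
    {X Y Z : B} (f : X ⟶ Y) (g h : Y ⟶ Z) : f ◁ (0 : g ⟶ h) = 0 := by
  have := LinearBicategory.whiskerLeft_smul (K := K) f (0 : K) (0 : g ⟶ h)
  simpa using this

theorem zero_whiskerRight (K : Type*) [CommRing K] {B : Type u} [Bicategory.{w, v} B]
    [∀ X Y : B, Preadditive (X ⟶ Y)] [∀ X Y : B, Linear K (X ⟶ Y)] [LinearBicategory K B]
    {X Y Z : B} (f g : X ⟶ Y) (h : Y ⟶ Z) : (0 : f ⟶ g) ▷ h = 0 := by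
  have := LinearBicategory.smul_whiskerRight (K := K) (0 : K) (0 : f ⟶ g) h
  simpa using this

variable {K : Type*} [CommRing K] {B : Type u} [Bicategory.{w, v} B]
  [∀ X Y : B, Preadditive (X ⟶ Y)] [∀ X Y : B, Linear K (X ⟶ Y)]

/-- The extension is a bicategory: whiskering is `K[ε]/(ε²)`-linear, and the coherence 2-cells are
those of `B`. -/
instance dualBicategory [LinearBicategory K B] : Bicategory.{w, v} (DualExt K B) where
  homCategory := dualHomCategory
  whiskerLeft f _ _ η := ⟨f.hom ◁ η.re, f.hom ◁ η.eps⟩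
  whiskerRight η h := ⟨η.re ▷ h.hom, η.eps ▷ h.hom⟩
  associator f g h := dualIso (α_ f.hom g.hom h.hom)
  leftUnitor f := dualIso (λ_ f.hom)
  rightUnitor f := dualIso (ρ_ f.hom)
  whiskerLeft_id f g := dual_ext (by simp) (by simp [whiskerLeft_zero K])
  whiskerLeft_comp f _ _ _ η θ := dual_ext (by simp)
    (by simp [LinearBicategory.whiskerLeft_add (K := K)])
  id_whiskerLeft η := dual_ext (by simp) (by simp)
  comp_whiskerLeft f g _ _ η := dual_ext (by simp) (by simp)
  id_whiskerRight f g := dual_ext (by simp) (by simp [zero_whiskerRight K])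
  comp_whiskerRight η θ i := dual_ext (by simp)
    (by simp [LinearBicategory.add_whiskerRight (K := K)])
  whiskerRight_id η := dual_ext (by simp) (by simp)
  whiskerRight_comp η g h := dual_ext (by simp) (by simp)
  whisker_assoc f _ _ η h := dual_ext (by simp) (by simp)
  whisker_exchange η θ := dual_ext (by simp [whisker_exchange])
    (by simp [whisker_exchange, add_comm])
  pentagon f g h i := dual_ext (by simp) (by simp [whiskerLeft_zero K, zero_whiskerRight K])
  triangle f g := dual_ext (by simp) (by simp [whiskerLeft_zero K, zero_whiskerRight K])

/-- The tensor product on the extension, `K[ε]/(ε²)`-bilinear on 2-cells. -/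
def TensorCore.dual [LinearBicategory K B] (T : TensorCore B) (hT : T.IsBilinear K) :
    TensorCore (DualExt K B) where
  obj X Y := ⟨T.obj X.obj Y.obj⟩
  map f g := ⟨T.map f.hom g.hom⟩
  map₂ α β := ⟨T.map₂ α.re β.re, T.map₂ α.re β.eps + T.map₂ α.eps β.re⟩
  map₂_id f g := dual_ext (by simp [T.map₂_id]) (by
    have h₁ := hT.map₂_smul (0 : K) (𝟙 f.hom) (0 : g.hom ⟶ g.hom)
    have h₂ := hT.smul_map₂ (0 : K) (0 : f.hom ⟶ f.hom) (𝟙 g.hom)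
    simp only [zero_smul] at h₁ h₂
    simp [h₁, h₂])
  map₂_comp α α' β β' := dual_ext (by simp [T.map₂_comp])
    (by simp [T.map₂_comp, hT.map₂_add, hT.add_map₂]; abel)
  assoc X Y Z := ⟨T.assoc X.obj Y.obj Z.obj⟩
  assoc_iso X Y Z := by
    obtain ⟨b, h₁, h₂⟩ := T.assoc_iso X.obj Y.obj Z.obj
    exact ⟨⟨b⟩, DualHom.ext h₁, DualHom.ext h₂⟩

/-- The structural 2-isomorphisms of the null deformation. -/
def SemigroupalCells.dual [LinearBicategory K B] {T : TensorCore B} (S : SemigroupalCells T)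
    (hT : T.IsBilinear K) : SemigroupalCells (T.dual hT) where
  tens f f' g g' := dualIso (S.tens f.hom f'.hom g.hom g'.hom)
  unit X Y := dualIso (S.unit X.obj Y.obj)
  ahat f g h := dualIso (S.ahat f.hom g.hom h.hom)
  pi X Y Z W := dualIso (S.pi X.obj Y.obj Z.obj W.obj)

end Dual

/-! ### Deformations and their equivalence -/

section Deformation

variable {K : Type*} [CommRing K] {B : Type u} [Bicategory.{w, v} B]
  [∀ X Y : B, Preadditive (X ⟶ Y)] [∀ X Y : B, Linear K (X ⟶ Y)] [LinearBicategory K B]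
  {T : TensorCore B}

/-- A first order deformation of a `K`-linear semigroupal 2-category: a semigroupal structure on
the `K[ε]/(ε²)`-linear extension whose structural 2-isomorphisms reduce to the given ones modulo
`ε`; the tensor product of objects, 1-cells and 2-cells and the 1-cells of the associator are those
of the null deformation. -/
structure FirstOrderDeformation (S : SemigroupalCells T) (hT : T.IsBilinear K) where
  cells : SemigroupalCells (T.dual hT)
  semigroupal : cells.IsSemigroupal
  tens_re : ∀ {X X' X'' Y Y' Y'' : DualExt K B} (f : X ⟶ X') (f' : X' ⟶ X'') (g : Y ⟶ Y')
    (g' : Y' ⟶ Y''),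
    (cells.tens f f' g g').hom.re = (S.tens f.hom f'.hom g.hom g'.hom).hom
  unit_re : ∀ X Y : DualExt K B, (cells.unit X Y).hom.re = (S.unit X.obj Y.obj).hom
  ahat_re : ∀ {X X' Y Y' Z Z' : DualExt K B} (f : X ⟶ X') (g : Y ⟶ Y') (h : Z ⟶ Z'),
    (cells.ahat f g h).hom.re = (S.ahat f.hom g.hom h.hom).hom
  pi_re : ∀ X Y Z W : DualExt K B,
    (cells.pi X Y Z W).hom.re = (S.pi X.obj Y.obj Z.obj W.obj).hom

/-- A first order associator-deformation: a first order deformation in which only the associator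
2-isomorphisms `â(f, g, h)` are deformed. -/
structure AssociatorDeformation (S : SemigroupalCells T) (hT : T.IsBilinear K) extends
    FirstOrderDeformation S hT where
  tens_eq : ∀ {X X' X'' Y Y' Y'' : DualExt K B} (f : X ⟶ X') (f' : X' ⟶ X'') (g : Y ⟶ Y')
    (g' : Y' ⟶ Y''), cells.tens f f' g g' = (S.dual hT).tens f f' g g'
  unit_eq : ∀ X Y : DualExt K B, cells.unit X Y = (S.dual hT).unit X Y
  pi_eq : ∀ X Y Z W : DualExt K B, cells.pi X Y Z W = (S.dual hT).pi X Y Z W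

/-- Two first order deformations are `ψ`-equivalent if the identity 2-functor of the extension
admits a semigroupal structure `(ψ, ω)`, from the first to the second, such that all `ψ_{X,Y}` are
identity 1-cells, each `ψ̂(f, g)` is the identity modulo `ε`, and `ω` is undeformed. -/
def PsiEquivalent {S : SemigroupalCells T} {hT : T.IsBilinear K}
    (D D' : FirstOrderDeformation S hT) : Prop :=
  ∃ ψhat : ∀ {X X' Y Y' : DualExt K B} (f : X ⟶ X') (g : Y ⟶ Y'),
      𝟙 ((T.dual hT).obj X Y) ≫ (T.dual hT).map f g ≅
        (T.dual hT).map f g ≫ 𝟙 ((T.dual hT).obj X' Y'),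
    IsSemigroupalStructureOnId D.cells D'.cells (fun _ _ => 𝟙 _) ψhat
      (omegaNull (S.dual hT)) ∧
    ∀ {X X' Y Y' : DualExt K B} (f : X ⟶ X') (g : Y ⟶ Y'),
      (ψhat f g).hom.re =
        (λ_ (T.map f.hom g.hom)).hom ≫ (ρ_ (T.map f.hom g.hom)).inv

end Deformation

/-! ### The associator-deformation complex -/

section Tuples

/-- `(n + 1)`-tuples of objects. -/
def Tup (B : Type u) : ℕ → Type u
  | 0 => B
  | n + 1 => B × Tup B n

variable {B : Type u} [Bicategory.{w, v} B]

/-- `(n + 1)`-tuples of 1-cells. -/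
def TupHom : (n : ℕ) → Tup B n → Tup B n → Type v
  | 0, X, Y => Quiver.Hom (V := B) X Y
  | n + 1, X, Y => (X.1 ⟶ Y.1) × TupHom n X.2 Y.2

/-- `(n + 1)`-tuples of 2-cells. -/
def TupCell : (n : ℕ) → {X Y : Tup B n} → TupHom n X Y → TupHom n X Y → Type w
  | 0, X, Y, f, g => (Bicategory.homCategory (B := B) X Y).Hom f g
  | n + 1, _, _, f, g => (f.1 ⟶ g.1) × TupCell n f.2 g.2

/-- The tuple of identity 1-cells. -/
def tupId : (n : ℕ) → (X : Tup B n) → TupHom n X X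
  | 0, X => CategoryStruct.id (obj := B) X
  | n + 1, X => (𝟙 X.1, tupId n X.2)

/-- Componentwise composition of tuples of 1-cells. -/
def tupComp : (n : ℕ) → {X Y Z : Tup B n} → TupHom n X Y → TupHom n Y Z → TupHom n X Z
  | 0, _, _, _, f, g => CategoryStruct.comp (obj := B) f g
  | n + 1, _, _, _, f, g => (f.1 ≫ g.1, tupComp n f.2 g.2)

/-- The first `n + 1` entries of an `(n + 2)`-tuple. -/
def tupInit : (n : ℕ) → Tup B (n + 1) → Tup B n
  | 0, X => X.1
  | n + 1, X => (X.1, tupInit n X.2)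

/-- The last entry of an `(n + 2)`-tuple. -/
def tupLast : (n : ℕ) → Tup B (n + 1) → B
  | 0, X => X.2
  | n + 1, X => tupLast n X.2

/-- The first `n + 1` entries of an `(n + 2)`-tuple of 1-cells. -/
def tupHomInit : (n : ℕ) → {X Y : Tup B (n + 1)} → TupHom (n + 1) X Y →
    TupHom n (tupInit n X) (tupInit n Y)
  | 0, _, _, f => f.1
  | n + 1, _, _, f => (f.1, tupHomInit n f.2)

/-- The last entry of an `(n + 2)`-tuple of 1-cells. -/
def tupHomLast : (n : ℕ) → {X Y : Tup B (n + 1)} → TupHom (n + 1) X Y →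
    (tupLast n X ⟶ tupLast n Y)
  | 0, _, _, f => f.2
  | n + 1, _, _, f => tupHomLast n f.2

namespace TensorCore

variable (T : TensorCore B)

/-- The iterated tensor product `X₀ ⊗ (X₁ ⊗ (⋯ ⊗ Xₙ))` of objects. -/
def tObj : (n : ℕ) → Tup B n → B
  | 0, X => X
  | n + 1, X => T.obj X.1 (tObj n X.2)

/-- The iterated tensor product of 1-cells. -/
def tHom : (n : ℕ) → {X Y : Tup B n} → TupHom n X Y → (T.tObj n X ⟶ T.tObj n Y)
  | 0, _, _, f => f
  | n + 1, _, _, f => T.map f.1 (tHom n f.2)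

/-- The iterated tensor product of 2-cells. -/
def tCell : (n : ℕ) → {X Y : Tup B n} → {f g : TupHom n X Y} → TupCell n f g →
    (T.tHom n f ⟶ T.tHom n g)
  | 0, _, _, _, _, τ => τ
  | n + 1, _, _, _, _, τ => T.map₂ τ.1 (tCell n τ.2)

/-- Replace the entries `Xᵢ, Xᵢ₊₁` of an `(n + 2)`-tuple (`0 ≤ i ≤ n`) by `Xᵢ ⊗ Xᵢ₊₁`. -/
def merge : (n i : ℕ) → Tup B (n + 1) → Tup B n
  | 0, _, X => T.obj X.1 X.2
  | _ + 1, 0, X => (T.obj X.1 X.2.1, X.2.2)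
  | n + 1, i + 1, X => (X.1, merge n i X.2)

/-- Replace the entries `fᵢ, fᵢ₊₁` of an `(n + 2)`-tuple of 1-cells by `fᵢ ⊗ fᵢ₊₁`. -/
def mergeHom : (n i : ℕ) → {X Y : Tup B (n + 1)} → TupHom (n + 1) X Y →
    TupHom n (T.merge n i X) (T.merge n i Y)
  | 0, _, _, _, f => T.map f.1 f.2
  | _ + 1, 0, _, _, f => (T.map f.1 f.2.1, f.2.2)
  | n + 1, i + 1, _, _, f => (f.1, mergeHom n i f.2)

end TensorCore

/-- The structural 2-isomorphism of the iterated tensor product pseudofunctor `⊗(n + 1)`. -/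
def SemigroupalCells.tTens {T : TensorCore B} (S : SemigroupalCells T) :
    (n : ℕ) → {X Y Z : Tup B n} → (f : TupHom n X Y) → (g : TupHom n Y Z) →
    (T.tHom n f ≫ T.tHom n g ⟶ T.tHom n (tupComp n f g))
  | 0, X, _, Z, f, g => (Bicategory.homCategory (B := B) X Z).id (CategoryStruct.comp (obj := B) f g)
  | n + 1, _, _, _, f, g =>
    (S.tens f.1 g.1 (T.tHom n f.2) (T.tHom n g.2)).hom ≫
      T.map₂ (𝟙 (f.1 ≫ g.1)) (tTens S n f.2 g.2)

variable (B) in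
/-- A 1-cell together with its source and target. -/
abbrev TotalHom : Type (max u v) := Σ X Y : B, X ⟶ Y

/-- The 1-cell `f` as an element of the total type of 1-cells. -/
abbrev total {X Y : B} (f : X ⟶ Y) : TotalHom B := ⟨X, Y, f⟩

/-- Transport of endomorphism 2-cells along an equality of 1-cells (possibly with different, but
equal, sources and targets). -/
def transport {X Y X' Y' : B} {f : X ⟶ Y} {f' : X' ⟶ Y'} (h : total f = total f') (α : f ⟶ f) :
    f' ⟶ f' :=
  cast (congrArg (fun F : TotalHom B => (F.2.2 ⟶ F.2.2)) h) α

theorem total_of_eqToHom [Bicategory.Strict B] {X Y X' Y' : B} (f : X ⟶ Y) (f' : X' ⟶ Y')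
    (hX : X = X') (hY : Y = Y') (h : eqToHom hX ≫ f' = f ≫ eqToHom hY) : total f = total f' := by
  subst hX hY
  have h₁ : f' = f := by
    simpa [Bicategory.Strict.id_comp, Bicategory.Strict.comp_id] using h
  rw [h₁]

theorem total_map (T : TensorCore B) {X X' Y Y' Z Z' W W' : B} {f : X ⟶ X'} {g : Y ⟶ Y'}
    {h : Z ⟶ Z'} {k : W ⟶ W'} (h₁ : total f = total g) (h₂ : total h = total k) :
    total (T.map f h) = total (T.map g k) := by
  cases h₁
  cases h₂
  rfl

theorem total_assoc [Bicategory.Strict B] {T : TensorCore B} {S : SemigroupalCells T}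
    (hS : IsGray T S) {X X' Y Y' Z Z' : B} (f : X ⟶ X') (g : Y ⟶ Y') (h : Z ⟶ Z') :
    total (T.map (T.map f g) h) = total (T.map f (T.map g h)) := by
  obtain ⟨hX, h₁⟩ := hS.assoc_identity X Y Z
  obtain ⟨hY, h₂⟩ := hS.assoc_identity X' Y' Z'
  obtain ⟨h₃, -⟩ := hS.ahat_identity f g h
  rw [h₁, h₂] at h₃
  exact (total_of_eqToHom _ _ hX hY h₃).symm

theorem total_merge [Bicategory.Strict B] {T : TensorCore B} {S : SemigroupalCells T}
    (hS : IsGray T S) : ∀ (n i : ℕ) {X Y : Tup B (n + 1)} (f : TupHom (n + 1) X Y),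
    total (T.tHom n (T.mergeHom n i f)) = total (T.tHom (n + 1) f)
  | 0, _, _, _, _ => rfl
  | _ + 1, 0, _, _, _ => total_assoc hS _ _ _
  | n + 1, i + 1, _, _, f => total_map T rfl (total_merge hS n i f.2)

theorem total_init [Bicategory.Strict B] {T : TensorCore B} {S : SemigroupalCells T}
    (hS : IsGray T S) : ∀ (n : ℕ) {X Y : Tup B (n + 1)} (f : TupHom (n + 1) X Y),
    total (T.map (T.tHom n (tupHomInit n f)) (tupHomLast n f)) = total (T.tHom (n + 1) f)
  | 0, _, _, _ => rfl
  | n + 1, _, _, f =>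
    (total_assoc hS f.1 _ _).trans (total_map T rfl (total_init hS n f.2))

end Tuples

section Complex

variable {K : Type*} [CommRing K] {B : Type u} [Bicategory.{w, v} B]
  [∀ X Y : B, Preadditive (X ⟶ Y)] [∀ X Y : B, Linear K (X ⟶ Y)]

@[simp]
theorem transport_add {X Y X' Y' : B} {f : X ⟶ Y} {f' : X' ⟶ Y'} (h : total f = total f')
    (α β : f ⟶ f) : transport h (α + β) = transport h α + transport h β := by
  cases h
  rfl

variable (K) in
@[simp]
theorem transport_smul {X Y X' Y' : B} {f : X ⟶ Y} {f' : X' ⟶ Y'} (h : total f = total f')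
    (r : K) (α : f ⟶ f) : transport h (r • α) = r • transport h α := by
  cases h
  rfl

namespace GraySemigroup

variable (G : GraySemigroup K B)

/-- Families of 2-cells `φ(f₀, …, fₙ) : f₀ ⊗ ⋯ ⊗ fₙ ⟶ f₀ ⊗ ⋯ ⊗ fₙ`, not necessarily natural. -/
abbrev Family₀ (n : ℕ) : Type _ :=
  ∀ (X Y : Tup B n) (f : TupHom n X Y), G.core.tHom n f ⟶ G.core.tHom n f

/-- Families of 2-cells `(g₀ ⊗ ⋯ ⊗ gₙ) ∘ (f₀ ⊗ ⋯ ⊗ fₙ) ⟶ (g₀ ∘ f₀) ⊗ ⋯ ⊗ (gₙ ∘ fₙ)`, not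
necessarily natural. -/
abbrev Family₁ (n : ℕ) : Type _ :=
  ∀ (X Y Z : Tup B n) (f : TupHom n X Y) (g : TupHom n Y Z),
    G.core.tHom n f ≫ G.core.tHom n g ⟶ G.core.tHom n (tupComp n f g)

/-- The space `X^{0,n}` of natural families. -/
def X₀ (n : ℕ) : Submodule K (G.Family₀ n) where
  carrier := {φ | ∀ (X Y : Tup B n) (f g : TupHom n X Y) (τ : TupCell n f g),
    G.core.tCell n τ ≫ φ X Y g = φ X Y f ≫ G.core.tCell n τ}
  add_mem' hφ hψ X Y f g τ := by simp [hφ X Y f g τ, hψ X Y f g τ]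
  zero_mem' X Y f g τ := by simp
  smul_mem' r φ hφ X Y f g τ := by simp [hφ X Y f g τ]

/-- The space `X_s^{0,n}` of special cochains: natural families that vanish at tuples of identity
1-cells. -/
def Xs₀ (n : ℕ) : Submodule K (G.Family₀ n) where
  carrier := {φ | φ ∈ G.X₀ n ∧ ∀ X : Tup B n, φ X X (tupId n X) = 0}
  add_mem' hφ hψ := ⟨add_mem hφ.1 hψ.1, fun X => by simp [hφ.2 X, hψ.2 X]⟩
  zero_mem' := ⟨zero_mem _, fun X => by simp⟩
  smul_mem' r φ hφ := ⟨Submodule.smul_mem _ r hφ.1, fun X => by simp [hφ.2 X]⟩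

/-- The horizontal coboundary `δ_h` on `X^{0,n}`; on natural special families its values are natural
and special. -/
def δh [LinearBicategory K B] (n : ℕ) : G.Family₀ n →ₗ[K] G.Family₁ n where
  toFun φ X Y Z f g :=
    G.core.tHom n f ◁ φ Y Z g ≫ G.cells.tTens n f g -
      G.cells.tTens n f g ≫ φ X Z (tupComp n f g) +
      φ X Y f ▷ G.core.tHom n g ≫ G.cells.tTens n f g
  map_add' φ ψ := by
    funext X Y Z f g
    simp only [Pi.add_apply, LinearBicategory.whiskerLeft_add (K := K),
      LinearBicategory.add_whiskerRight (K := K), Preadditive.add_comp, Preadditive.comp_add]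
    abel
  map_smul' r φ := by
    funext X Y Z f g
    simp only [Pi.smul_apply, LinearBicategory.whiskerLeft_smul,
      LinearBicategory.smul_whiskerRight, Linear.smul_comp, Linear.comp_smul, RingHom.id_apply,
      smul_add, smul_sub]

/-- The 2-cell `1 ⊗ φ(f₁, …, fₙ₊₁)`. -/
def oneTensor {n : ℕ} (φ : G.Family₀ n) {X Y : Tup B (n + 1)} (f : TupHom (n + 1) X Y) :
    G.core.tHom (n + 1) f ⟶ G.core.tHom (n + 1) f :=
  G.core.map₂ (𝟙 f.1) (φ X.2 Y.2 f.2)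

theorem oneTensor_add {n : ℕ} (φ ψ : G.Family₀ n) {X Y : Tup B (n + 1)}
    (f : TupHom (n + 1) X Y) :
    G.oneTensor (φ + ψ) f = G.oneTensor φ f + G.oneTensor ψ f :=
  G.bilinear.map₂_add _ _ _

theorem oneTensor_smul {n : ℕ} (r : K) (φ : G.Family₀ n) {X Y : Tup B (n + 1)}
    (f : TupHom (n + 1) X Y) :
    G.oneTensor (r • φ) f = r • G.oneTensor φ f :=
  G.bilinear.map₂_smul _ _ _

/-- The vertical coboundary `δ_v` on `X^{0,n}`:
`(δ_v φ)(f₀, …, fₙ₊₁) = 1 ⊗ φ(f₁, …, fₙ₊₁) + ∑_{i=0}^{n} (-1)^{i+1} φ(f₀, …, fᵢ ⊗ fᵢ₊₁, …, fₙ₊₁)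
+ (-1)^{n+2} φ(f₀, …, fₙ) ⊗ 1`. The transports express the strict associativity of the tensor
product of 1-cells. -/
def δv [Bicategory.Strict B] (n : ℕ) : G.Family₀ n →ₗ[K] G.Family₀ (n + 1) where
  toFun φ X Y f :=
    G.oneTensor φ f +
      ∑ i ∈ Finset.range (n + 1), (-1 : K) ^ (i + 1) •
        transport (total_merge G.gray n i f) (φ _ _ (G.core.mergeHom n i f)) +
      (-1 : K) ^ (n + 2) • transport (total_init G.gray n f)
        (G.core.map₂ (φ _ _ (tupHomInit n f)) (𝟙 (tupHomLast n f)))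
  map_add' φ ψ := by
    funext X Y f
    simp only [Pi.add_apply, oneTensor_add, G.bilinear.add_map₂, transport_add, smul_add,
      Finset.sum_add_distrib]
    abel
  map_smul' r φ := by
    funext X Y f
    simp only [Pi.smul_apply, oneTensor_smul, G.bilinear.smul_map₂, transport_smul K,
      smul_add, Finset.smul_sum, RingHom.id_apply, smul_comm _ r]

variable [Bicategory.Strict B] [LinearBicategory K B]

/-- The associator-deformation complex in degree `n`: the kernel of `δ_h` on `X_s^{0,n}`. -/
def Xass (n : ℕ) : Submodule K (G.Family₀ n) := G.Xs₀ n ⊓ LinearMap.ker (G.δh n)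

/-- The `n`-cocycles of the associator-deformation complex. -/
def cocycles (n : ℕ) : Submodule K (G.Family₀ n) := G.Xass n ⊓ LinearMap.ker (G.δv n)

/-- The `n`-coboundaries of the associator-deformation complex. -/
def coboundaries : (n : ℕ) → Submodule K (G.Family₀ n)
  | 0 => ⊥
  | n + 1 => (G.Xass n).map (G.δv n)

/-- The cohomology `H^n_ass` of the associator-deformation complex: cocycles modulo coboundaries. -/
abbrev Hass (n : ℕ) : Type _ :=
  G.cocycles n ⧸ (G.coboundaries n).comap (G.cocycles n).subtype

/-- First order associator-deformations of a `K`-linear Gray semigroup. -/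
abbrev Deformation : Type _ := AssociatorDeformation G.cells G.bilinear

/-- `ψ`-equivalence of first order associator-deformations. -/
def PsiEquiv (D D' : G.Deformation) : Prop :=
  PsiEquivalent D.toFirstOrderDeformation D'.toFirstOrderDeformation

/-- The cochain `φ` is the first order part of the associator of the deformation `D`, that is,
`â_ε(f, g, h) = (1 + φ(f, g, h) ε) · â(f, g, h)`, where `φ(f, g, h)` is whiskered with the identity
1-cell `a`. -/
def IsFirstOrderPart (D : G.Deformation) (φ : G.Family₀ 2) : Prop :=
  ∀ {X X' Y Y' Z Z' : B} (f : X ⟶ X') (g : Y ⟶ Y') (h : Z ⟶ Z'),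
    (D.cells.ahat (X := ⟨X⟩) (X' := ⟨X'⟩) (Y := ⟨Y⟩) (Y' := ⟨Y'⟩) (Z := ⟨Z⟩) (Z' := ⟨Z'⟩)
        ⟨f⟩ ⟨g⟩ ⟨h⟩).hom.eps =
      (G.cells.ahat f g h).hom ≫
        φ (X, (Y, Z)) (X', (Y', Z')) (f, (g, h)) ▷ G.core.assoc X' Y' Z'

end GraySemigroup

end Complex

end GrayDeformation

/-! In a Gray semigroup every structural cell except the interchangers of `⊗` is an identity, and
2-cells `1 + a ε` compose by adding their `ε`-parts. Hence each axiom of a semigroupal structure,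
evaluated on an associator `1 + φ ε`, becomes a linear equation in `φ`. Naturality of the associator
is naturality of `φ`; compatibility with composition is `δ_h φ = 0`; compatibility with units is
vanishing of `φ` at identities. The modification axiom of the pentagonator involves five associator
cells, and the alternating sum of their `ε`-parts is `δ_v φ`. The `K₅` relation involves the
associator only at identity 1-cells, where a normalised `φ` vanishes, so it imposes nothing more.
Thus `1 + φ ε` is a semigroupal structure exactly when `φ` is a 2-cocycle
(`deformed_semigroupal_iff`), and every associator-deformation has this form for a unique `φ`
(`isFirstOrderPart_iff`, `isFirstOrderPart_unique`).

The same linearisation applies to a pseudonatural transformation `1 + θ ε`: its own axioms say `θ ∈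
X¹_ass`, and the modification axiom of the trivial `ω` says `φ + δ_v θ = φ'` (`psi_structure_iff`).
So `ψ`-equivalence is the kernel relation of the map sending a deformation to the class of its first
order part (`psiEquiv_iff_mk_eq`). It is therefore an equivalence relation, the induced map on
classes is injective, and it is surjective because every cocycle defines a deformation.

That `δ_v` sends `X¹_ass` to cocycles is verified directly (`δv_mem_cocycles`): `δ_v δ_v = 0` by the
simplicial identities, and `δ_h δ_v θ = 0` because each face of `θ` is separately compatible with
the interchangers.

Strict associativity of `⊗` and of composition holds only up to propositional equality of 1-cells.
The relation `Sim` compares 2-cells across such equalities, so that identity cells can be deleted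
from a pasting without bookkeeping of casts. -/

namespace GrayDeformation

/-! ### Equality of 2-cells up to identities -/

section Sim

variable {C : Type u} [Bicategory.{w, v} C]

/-- Two 2-cells, possibly with different but equal boundaries, are equal. -/
inductive Sim : ∀ {X Y X' Y' : C} {f g : X ⟶ Y} {f' g' : X' ⟶ Y'}, (f ⟶ g) → (f' ⟶ g') → Prop
  | refl {X Y : C} {f g : X ⟶ Y} (α : f ⟶ g) : Sim α α

variable {X Y X' Y' X'' Y'' Z Z' : C}

theorem Sim.eq {f g : X ⟶ Y} {α β : f ⟶ g} (h : Sim α β) : α = β := by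
  cases h
  rfl

theorem Sim.of_eq {f g : X ⟶ Y} {α β : f ⟶ g} (h : α = β) : Sim α β := by
  subst h
  exact .refl α

theorem Sim.symm {f g : X ⟶ Y} {f' g' : X' ⟶ Y'} {α : f ⟶ g} {β : f' ⟶ g'} (h : Sim α β) :
    Sim β α := by
  cases h
  exact .refl α

theorem Sim.trans {f g : X ⟶ Y} {f' g' : X' ⟶ Y'} {f'' g'' : X'' ⟶ Y''} {α : f ⟶ g}
    {β : f' ⟶ g'} {γ : f'' ⟶ g''} (h : Sim α β) (h' : Sim β γ) : Sim α γ := by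
  cases h
  exact h'

/-- This is the mechanism behind all the equivalences below: both sides of a pasting equation are
replaced by cells on one simpler common boundary, and the equation is read there. -/
theorem Sim.eq_iff {f g : X ⟶ Y} {f' g' : X' ⟶ Y'} {α β : f ⟶ g} {α' β' : f' ⟶ g'}
    (h : Sim α α') (h' : Sim β β') : α = β ↔ α' = β' :=
  ⟨fun e => (h.symm.trans ((Sim.of_eq e).trans h')).eq,
    fun e => (h.trans ((Sim.of_eq e).trans h'.symm)).eq⟩

theorem Sim.comp {f g h : X ⟶ Y} {f' g' h' : X' ⟶ Y'} {α : f ⟶ g} {β : g ⟶ h} {α' : f' ⟶ g'}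
    {β' : g' ⟶ h'} (hα : Sim α α') (hβ : Sim β β') : Sim (α ≫ β) (α' ≫ β') := by
  cases hα
  cases hβ
  exact .refl _

theorem Sim.whiskerLeft {f : X ⟶ Y} {f' : X' ⟶ Y'} {g h : Y ⟶ Z} {g' h' : Y' ⟶ Z'}
    {α : g ⟶ h} {α' : g' ⟶ h'} (hf : total f = total f') (hα : Sim α α') :
    Sim (f ◁ α) (f' ◁ α') := by
  cases hf
  cases hα
  exact .refl _

theorem Sim.whiskerRight {f : Y ⟶ Z} {f' : Y' ⟶ Z'} {g h : X ⟶ Y} {g' h' : X' ⟶ Y'}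
    {α : g ⟶ h} {α' : g' ⟶ h'} (hα : Sim α α') (hf : total f = total f') :
    Sim (α ▷ f) (α' ▷ f') := by
  cases hf
  cases hα
  exact .refl _

theorem Sim.map₂ (T : TensorCore C) {W W' V V' : C} {f g : X ⟶ Y} {f' g' : X' ⟶ Y'} {h k : W ⟶ V}
    {h' k' : W' ⟶ V'} {α : f ⟶ g} {α' : f' ⟶ g'} {β : h ⟶ k} {β' : h' ⟶ k'} (hα : Sim α α')
    (hβ : Sim β β') : Sim (T.map₂ α β) (T.map₂ α' β') := by
  cases hα
  cases hβ
  exact .refl _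

theorem Sim.id {f : X ⟶ Y} {f' : X' ⟶ Y'} (hf : total f = total f') : Sim (𝟙 f) (𝟙 f') := by
  cases hf
  exact .refl _

/-- Connects the casts in the definition of `δv` with `Sim`, so that cast terms are compared by
chaining relations instead of by manipulating casts. -/
theorem sim_transport {f : X ⟶ Y} {f' : X' ⟶ Y'} (h : total f = total f') (α : f ⟶ f) :
    Sim α (transport h α) := by
  cases h
  exact .refl _

theorem total_congr {f g : X ⟶ Y} (h : f = g) : total f = total g := by rw [h]

theorem total_comp {f : X ⟶ Y} {f' : X' ⟶ Y'} {g : Y ⟶ Z} {g' : Y' ⟶ Z'}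
    (hf : total f = total f') (hg : total g = total g') : total (f ≫ g) = total (f' ≫ g') := by
  cases hf
  cases hg
  rfl

/-! ### Identity 1-cells and 2-cells -/

theorem IsIdentity₁.id (X : C) : IsIdentity₁ (𝟙 X) := ⟨rfl, rfl⟩

theorem IsIdentity₁.comp [Bicategory.Strict C] {f : X ⟶ Y} {g : Y ⟶ Z} (hf : IsIdentity₁ f)
    (hg : IsIdentity₁ g) : IsIdentity₁ (f ≫ g) := by
  obtain ⟨rfl, rfl⟩ := hf
  obtain ⟨rfl, rfl⟩ := hg
  exact ⟨rfl, by simp⟩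

theorem IsIdentity₁.total_comp_left [Bicategory.Strict C] {f : X ⟶ Y} (hf : IsIdentity₁ f)
    (g : Y ⟶ Z) : total (f ≫ g) = total g := by
  obtain ⟨rfl, rfl⟩ := hf
  exact total_congr (by simp)

theorem IsIdentity₂.id (f : X ⟶ Y) : IsIdentity₂ (𝟙 f) := ⟨rfl, rfl⟩

theorem IsIdentity₂.comp {f g h : X ⟶ Y} {α : f ⟶ g} {β : g ⟶ h} (hα : IsIdentity₂ α)
    (hβ : IsIdentity₂ β) : IsIdentity₂ (α ≫ β) := by
  obtain ⟨rfl, rfl⟩ := hα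
  obtain ⟨rfl, rfl⟩ := hβ
  exact ⟨rfl, by simp⟩

theorem IsIdentity₂.whiskerLeft {g h : Y ⟶ Z} {α : g ⟶ h} (f : X ⟶ Y) (hα : IsIdentity₂ α) :
    IsIdentity₂ (f ◁ α) := by
  obtain ⟨rfl, rfl⟩ := hα
  exact ⟨rfl, by simp⟩

theorem IsIdentity₂.whiskerRight {g h : X ⟶ Y} {α : g ⟶ h} (hα : IsIdentity₂ α) (f : Y ⟶ Z) :
    IsIdentity₂ (α ▷ f) := by
  obtain ⟨rfl, rfl⟩ := hα
  exact ⟨rfl, by simp⟩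

theorem IsIdentity₂.inv {f g : X ⟶ Y} {α : f ≅ g} (hα : IsIdentity₂ α.hom) :
    IsIdentity₂ α.inv := by
  obtain ⟨rfl, h⟩ := hα
  exact ⟨rfl, by rw [← cancel_epi α.hom, Iso.hom_inv_id, h]; simp⟩

theorem IsIdentity₂.map₂ (T : TensorCore C) {f g : X ⟶ Y} {f' g' : X' ⟶ Y'} {α : f ⟶ g}
    {β : f' ⟶ g'} (hα : IsIdentity₂ α) (hβ : IsIdentity₂ β) : IsIdentity₂ (T.map₂ α β) := by
  obtain ⟨rfl, rfl⟩ := hα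
  obtain ⟨rfl, rfl⟩ := hβ
  exact ⟨rfl, by simp [T.map₂_id]⟩

theorem IsIdentity₂.eq {f g : X ⟶ Y} {α β : f ⟶ g} (hα : IsIdentity₂ α) (hβ : IsIdentity₂ β) :
    α = β := by
  obtain ⟨rfl, rfl⟩ := hα
  obtain ⟨_, rfl⟩ := hβ
  rfl

theorem IsIdentity₂.sim {f g : X ⟶ Y} {α : f ⟶ g} (hα : IsIdentity₂ α) : Sim α (𝟙 f) := by
  obtain ⟨rfl, rfl⟩ := hα
  exact .refl _

theorem IsIdentity₂.of_sim {f g : X ⟶ Y} {f' g' : X' ⟶ Y'} {α : f ⟶ g} {β : f' ⟶ g'}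
    (h : Sim α β) (hβ : IsIdentity₂ β) : IsIdentity₂ α := by
  cases h
  exact hβ

theorem Sim.comp_triv {f g h : X ⟶ Y} {f' g' : X' ⟶ Y'} {α : f ⟶ g} {β : g ⟶ h} {α' : f' ⟶ g'}
    (hα : Sim α α') (hβ : IsIdentity₂ β) : Sim (α ≫ β) α' := by
  obtain ⟨rfl, rfl⟩ := hβ
  simpa using hα

theorem Sim.triv_comp {f g h : X ⟶ Y} {f' g' : X' ⟶ Y'} {α : f ⟶ g} {β : g ⟶ h} {β' : f' ⟶ g'}
    (hα : IsIdentity₂ α) (hβ : Sim β β') : Sim (α ≫ β) β' := by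
  obtain ⟨rfl, rfl⟩ := hα
  simpa using hβ

/-! ### Deleting identity whiskers and coherence cells in a strict bicategory -/

section Strict

variable [Bicategory.Strict C]

theorem IsIdentity₂.associator_hom {W : C} (f : X ⟶ Y) (g : Y ⟶ Z) (h : Z ⟶ W) :
    IsIdentity₂ (α_ f g h).hom :=
  ⟨Strict.assoc f g h, by rw [Strict.associator_eqToIso]; rfl⟩

theorem IsIdentity₂.associator_inv {W : C} (f : X ⟶ Y) (g : Y ⟶ Z) (h : Z ⟶ W) :
    IsIdentity₂ (α_ f g h).inv :=
  (IsIdentity₂.associator_hom f g h).inv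

theorem IsIdentity₂.leftUnitor_hom (f : X ⟶ Y) : IsIdentity₂ (λ_ f).hom :=
  ⟨Strict.id_comp f, by rw [Strict.leftUnitor_eqToIso]; rfl⟩

theorem IsIdentity₂.leftUnitor_inv (f : X ⟶ Y) : IsIdentity₂ (λ_ f).inv :=
  (IsIdentity₂.leftUnitor_hom f).inv

theorem IsIdentity₂.rightUnitor_hom (f : X ⟶ Y) : IsIdentity₂ (ρ_ f).hom :=
  ⟨Strict.comp_id f, by rw [Strict.rightUnitor_eqToIso]; rfl⟩

theorem IsIdentity₂.rightUnitor_inv (f : X ⟶ Y) : IsIdentity₂ (ρ_ f).inv :=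
  (IsIdentity₂.rightUnitor_hom f).inv

theorem sim_whiskerLeft {f : X ⟶ Y} {g h : Y ⟶ Z} {g' h' : X' ⟶ Y'} {α : g ⟶ h} {α' : g' ⟶ h'}
    (hf : IsIdentity₁ f) (hα : Sim α α') : Sim (f ◁ α) α' := by
  obtain ⟨rfl, rfl⟩ := hf
  refine Sim.trans ?_ hα
  -- After substitution `eqToHom rfl` is `𝟙 X` by definition. Whiskering with it is conjugation by
  -- unitors, which are identities in a strict bicategory.
  change Sim (𝟙 X ◁ α) α
  rw [id_whiskerLeft]
  exact .triv_comp (.leftUnitor_hom g) (.comp_triv (.refl α) (.leftUnitor_inv h))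

theorem sim_whiskerRight {f : Y ⟶ Z} {g h : X ⟶ Y} {g' h' : X' ⟶ Y'} {α : g ⟶ h} {α' : g' ⟶ h'}
    (hα : Sim α α') (hf : IsIdentity₁ f) : Sim (α ▷ f) α' := by
  obtain ⟨rfl, rfl⟩ := hf
  refine Sim.trans ?_ hα
  change Sim (α ▷ 𝟙 Y) α
  rw [whiskerRight_id]
  exact .triv_comp (.rightUnitor_hom g) (.comp_triv (.refl α) (.rightUnitor_inv h))

/-- The coherence 2-cell inserted by `⊗≫` is an identity. -/
class TrivialCoherence (f g : X ⟶ Y) [BicategoricalCoherence f g] : Prop where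
  triv : IsIdentity₂ (BicategoricalCoherence.iso : f ≅ g).hom

namespace TrivialCoherence

/-- Each instance follows the `BicategoricalCoherence` instance of the same shape, so that
resolution retraces how the 2-cell inserted by `⊗≫` was built and finds each of its factors to be an
identity. -/
instance refl (f : X ⟶ Y) : TrivialCoherence f f := ⟨.id f⟩

instance whiskerLeft (f : X ⟶ Y) (g h : Y ⟶ Z) [BicategoricalCoherence g h]
    [TrivialCoherence g h] : TrivialCoherence (f ≫ g) (f ≫ h) :=
  ⟨.whiskerLeft f triv⟩

instance whiskerRight (f g : X ⟶ Y) (h : Y ⟶ Z) [BicategoricalCoherence f g]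
    [TrivialCoherence f g] : TrivialCoherence (f ≫ h) (g ≫ h) :=
  ⟨.whiskerRight triv h⟩

instance left' (f g : X ⟶ Y) [BicategoricalCoherence f g] [TrivialCoherence f g] :
    TrivialCoherence f (𝟙 X ≫ g) :=
  ⟨.comp triv (.leftUnitor_inv g)⟩

instance right (f g : X ⟶ Y) [BicategoricalCoherence f g] [TrivialCoherence f g] :
    TrivialCoherence (f ≫ 𝟙 Y) g :=
  ⟨.comp (.rightUnitor_hom f) triv⟩

instance assoc {W : C} (f : X ⟶ Y) (g : Y ⟶ Z) (h : Z ⟶ W) (i : X ⟶ W)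
    [BicategoricalCoherence (f ≫ g ≫ h) i] [TrivialCoherence (f ≫ g ≫ h) i] :
    TrivialCoherence ((f ≫ g) ≫ h) i :=
  ⟨.comp (.associator_hom f g h) triv⟩

instance assoc' {W : C} (f : X ⟶ Y) (g : Y ⟶ Z) (h : Z ⟶ W) (i : X ⟶ W)
    [BicategoricalCoherence i (f ≫ g ≫ h)] [TrivialCoherence i (f ≫ g ≫ h)] :
    TrivialCoherence i ((f ≫ g) ≫ h) :=
  ⟨.comp triv (.associator_inv f g h)⟩

end TrivialCoherence

variable {f g h i : X ⟶ Y} [BicategoricalCoherence g h] [TrivialCoherence g h]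

theorem IsIdentity₂.bicategoricalComp {α : f ⟶ g} {β : h ⟶ i} (hα : IsIdentity₂ α)
    (hβ : IsIdentity₂ β) : IsIdentity₂ (α ⊗≫ β) :=
  .comp hα (.comp TrivialCoherence.triv hβ)

/-- By definition `⊗≫` inserts one coherence cell between its arguments. Once that cell is dropped,
the representatives compose with plain `≫`. -/
theorem Sim.bicategoricalComp {f' g' h' : X' ⟶ Y'} {α : f ⟶ g} {β : h ⟶ i} {α' : f' ⟶ g'}
    {β' : g' ⟶ h'} (hα : Sim α α') (hβ : Sim β β') : Sim (α ⊗≫ β) (α' ≫ β') :=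
  .comp hα (.triv_comp TrivialCoherence.triv hβ)

theorem Sim.bicategoricalComp_triv {f' g' : X' ⟶ Y'} {α : f ⟶ g} {β : h ⟶ i} {α' : f' ⟶ g'}
    (hα : Sim α α') (hβ : IsIdentity₂ β) : Sim (α ⊗≫ β) α' :=
  .comp_triv hα (.comp TrivialCoherence.triv hβ)

theorem Sim.triv_bicategoricalComp {f' g' : X' ⟶ Y'} {α : f ⟶ g} {β : h ⟶ i} {β' : f' ⟶ g'}
    (hα : IsIdentity₂ α) (hβ : Sim β β') : Sim (α ⊗≫ β) β' :=
  .triv_comp hα (.triv_comp TrivialCoherence.triv hβ)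

end Strict

end Sim

/-! ### Cubical structures with trivial pentagonator -/

/-- A semigroupal structure whose only nontrivial structural 2-isomorphisms are the interchangers
of `⊗` and the 2-cells of the associator. -/
structure IsCubical {C : Type u} [Bicategory.{w, v} C] (T : TensorCore C) (S : SemigroupalCells T) :
    Prop where
  tens_identity_left : ∀ {X X' X'' Y Y' : C} (f : X ⟶ X') (f' : X' ⟶ X'') (g : Y ⟶ Y'),
    IsIdentity₂ (S.tens f f' g (𝟙 Y')).hom
  tens_identity_right : ∀ {X X' Y Y' Y'' : C} (f : X ⟶ X') (g : Y ⟶ Y') (g' : Y' ⟶ Y''),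
    IsIdentity₂ (S.tens (𝟙 X) f g g').hom
  unit_identity : ∀ X Y : C, IsIdentity₂ (S.unit X Y).hom
  assoc_identity : ∀ X Y Z : C, IsIdentity₁ (T.assoc X Y Z)
  pi_identity : ∀ X Y Z W : C, IsIdentity₂ (S.pi X Y Z W).hom

namespace IsCubical

variable {C : Type u} [Bicategory.{w, v} C] {T : TensorCore C} {S : SemigroupalCells T}

theorem map_id (hS : IsCubical T S) {X Y Z W : C} {f : X ⟶ Y} {g : Z ⟶ W} (hf : IsIdentity₁ f)
    (hg : IsIdentity₁ g) : IsIdentity₁ (T.map f g) := by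
  obtain ⟨rfl, rfl⟩ := hf
  obtain ⟨rfl, rfl⟩ := hg
  -- A 2-cell can be an identity only if its source and target are equal; that equality of 1-cells
  -- is all that is needed from `⊗₀`.
  obtain ⟨h, -⟩ := hS.unit_identity X Z
  exact ⟨rfl, h⟩

theorem tens_left (hS : IsCubical T S) {X X' X'' Y Y' Y'' : C} (f : X ⟶ X') (f' : X' ⟶ X'')
    (g : Y ⟶ Y') {g' : Y' ⟶ Y''} (hg : IsIdentity₁ g') : IsIdentity₂ (S.tens f f' g g').hom := by
  obtain ⟨rfl, rfl⟩ := hg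
  exact hS.tens_identity_left f f' g

theorem tens_right (hS : IsCubical T S) {X X' X'' Y Y' Y'' : C} {f : X ⟶ X'} (f' : X' ⟶ X'')
    (g : Y ⟶ Y') (g' : Y' ⟶ Y'') (hf : IsIdentity₁ f) : IsIdentity₂ (S.tens f f' g g').hom := by
  obtain ⟨rfl, rfl⟩ := hf
  exact hS.tens_identity_right f' g g'

variable [Bicategory.Strict C]

theorem tens₃_left (hS : IsCubical T S) {X X' X'' X₃ Y : C} (f : X ⟶ X') (f' : X' ⟶ X'')
    (f'' : X'' ⟶ X₃) : IsIdentity₂ (S.tens₃ f f' f'' (𝟙 Y) (𝟙 Y) (𝟙 Y)).hom :=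
  .comp (.whiskerLeft _ (hS.tens_left _ _ _ (.id Y)))
    (hS.tens_left _ _ _ (.comp (.id Y) (.id Y)))

theorem tens₃_right (hS : IsCubical T S) {X Y Y' Y'' Y₃ : C} (g : Y ⟶ Y') (g' : Y' ⟶ Y'')
    (g'' : Y'' ⟶ Y₃) : IsIdentity₂ (S.tens₃ (𝟙 X) (𝟙 X) (𝟙 X) g g' g'').hom :=
  .comp (.whiskerLeft _ (hS.tens_right _ _ _ (.id X))) (hS.tens_right _ _ _ (.id X))

theorem idPi (hS : IsCubical T S) (X Y Z W U : C) : IsIdentity₂ (S.idPi X Y Z W U) :=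
  .comp (hS.tens₃_right _ _ _) (.comp (.map₂ T (.leftUnitor_hom _) (hS.pi_identity _ _ _ _))
    (.inv (hS.tens_right _ _ _ (.id X))))

theorem piId (hS : IsCubical T S) (X Y Z W U : C) : IsIdentity₂ (S.piId X Y Z W U) :=
  .comp (hS.tens₃_left _ _ _) (.comp (.map₂ T (hS.pi_identity _ _ _ _) (.leftUnitor_hom _))
    (.inv (hS.tens_left _ _ _ (.id U))))

/-- The `K₅` coherence relation holds if the associator 2-cells at identities are identities. -/
theorem pi_coherence (hS : IsCubical T S)
    (ha : ∀ {X X' Y Y' Z Z' : C} {f : X ⟶ X'} {g : Y ⟶ Y'} {h : Z ⟶ Z'}, IsIdentity₁ f →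
      IsIdentity₁ g → IsIdentity₁ h → IsIdentity₂ (S.ahat f g h).hom) (X Y Z W U : C) :
    𝟙 (T.map (𝟙 X) (T.map (𝟙 Y) (T.assoc Z W U)) ≫ T.map (𝟙 X) (T.assoc Y (T.obj Z W) U) ≫
          T.assoc X (T.obj Y (T.obj Z W)) U ≫ T.map (T.map (𝟙 X) (T.assoc Y Z W)) (𝟙 U) ≫
          T.map (T.assoc X (T.obj Y Z) W) (𝟙 U) ≫ T.map (T.map (T.assoc X Y Z) (𝟙 W)) (𝟙 U)) ⊗≫
        (T.map (𝟙 X) (T.map (𝟙 Y) (T.assoc Z W U)) ≫ T.map (𝟙 X) (T.assoc Y (T.obj Z W) U) ≫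
          T.assoc X (T.obj Y (T.obj Z W)) U) ◁ S.piId X Y Z W U ⊗≫
        T.map (𝟙 X) (T.map (𝟙 Y) (T.assoc Z W U)) ◁ (S.pi X Y (T.obj Z W) U).hom ▷
          T.map (T.assoc (T.obj X Y) Z W) (𝟙 U) ⊗≫
        (S.ahat (𝟙 X) (𝟙 Y) (T.assoc Z W U)).inv ▷
          (T.assoc (T.obj X Y) (T.obj Z W) U ≫ T.map (T.assoc (T.obj X Y) Z W) (𝟙 U)) ⊗≫
        T.assoc X Y (T.obj Z (T.obj W U)) ◁
          T.map₂ (S.unit X Y).hom (𝟙 (T.assoc Z W U)) ▷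
          (T.assoc (T.obj X Y) (T.obj Z W) U ≫ T.map (T.assoc (T.obj X Y) Z W) (𝟙 U)) ⊗≫
        T.assoc X Y (T.obj Z (T.obj W U)) ◁ (S.pi (T.obj X Y) Z W U).hom =
      𝟙 (T.map (𝟙 X) (T.map (𝟙 Y) (T.assoc Z W U)) ≫ T.map (𝟙 X) (T.assoc Y (T.obj Z W) U) ≫
          T.assoc X (T.obj Y (T.obj Z W)) U ≫ T.map (T.map (𝟙 X) (T.assoc Y Z W)) (𝟙 U) ≫
          T.map (T.assoc X (T.obj Y Z) W) (𝟙 U) ≫ T.map (T.map (T.assoc X Y Z) (𝟙 W)) (𝟙 U)) ⊗≫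
        (T.map (𝟙 X) (T.map (𝟙 Y) (T.assoc Z W U)) ≫ T.map (𝟙 X) (T.assoc Y (T.obj Z W) U)) ◁
          (S.ahat (𝟙 X) (T.assoc Y Z W) (𝟙 U)).hom ▷
          (T.map (T.assoc X (T.obj Y Z) W) (𝟙 U) ≫
            T.map (T.map (T.assoc X Y Z) (𝟙 W)) (𝟙 U)) ⊗≫
        S.idPi X Y Z W U ▷
          (T.assoc X (T.obj (T.obj Y Z) W) U ≫ T.map (T.assoc X (T.obj Y Z) W) (𝟙 U) ≫
            T.map (T.map (T.assoc X Y Z) (𝟙 W)) (𝟙 U)) ⊗≫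
        T.map (𝟙 X) (T.assoc Y Z (T.obj W U)) ◁ (S.pi X (T.obj Y Z) W U).hom ▷
          T.map (T.map (T.assoc X Y Z) (𝟙 W)) (𝟙 U) ⊗≫
        (T.map (𝟙 X) (T.assoc Y Z (T.obj W U)) ≫ T.assoc X (T.obj Y Z) (T.obj W U)) ◁
          (S.ahat (T.assoc X Y Z) (𝟙 W) (𝟙 U)).hom ⊗≫
        (T.map (𝟙 X) (T.assoc Y Z (T.obj W U)) ≫ T.assoc X (T.obj Y Z) (T.obj W U)) ◁
          T.map₂ (𝟙 (T.assoc X Y Z)) (S.unit W U).hom ▷ T.assoc (T.obj (T.obj X Y) Z) W U ⊗≫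
        (S.pi X Y Z (T.obj W U)).hom ▷ T.assoc (T.obj (T.obj X Y) Z) W U ⊗≫
        𝟙 (T.assoc X Y (T.obj Z (T.obj W U)) ≫ T.assoc (T.obj X Y) Z (T.obj W U) ≫
          T.assoc (T.obj (T.obj X Y) Z) W U) := by
  have hA := hS.assoc_identity
  -- Every factor of both pastings is an identity 2-cell, the associator occurring only at identity
  -- 1-cells. Two identity 2-cells with the same boundary coincide.
  refine IsIdentity₂.eq ?_ ?_
  · exact .bicategoricalComp (.id _) <|
      .bicategoricalComp (.whiskerLeft _ (hS.piId _ _ _ _ _)) <|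
      .bicategoricalComp (.whiskerLeft _ (.whiskerRight (hS.pi_identity _ _ _ _) _)) <|
      .bicategoricalComp (.whiskerRight (.inv (ha (.id _) (.id _) (hA _ _ _))) _) <|
      .bicategoricalComp (.whiskerLeft _ (.whiskerRight
        (.map₂ T (hS.unit_identity _ _) (.id _)) _)) <|
      .whiskerLeft _ (hS.pi_identity _ _ _ _)
  · exact .bicategoricalComp (.id _) <|
      .bicategoricalComp (.whiskerLeft _ (.whiskerRight (ha (.id _) (hA _ _ _) (.id _)) _)) <|
      .bicategoricalComp (.whiskerRight (hS.idPi _ _ _ _ _) _) <|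
      .bicategoricalComp (.whiskerLeft _ (.whiskerRight (hS.pi_identity _ _ _ _) _)) <|
      .bicategoricalComp (.whiskerLeft _ (ha (hA _ _ _) (.id _) (.id _))) <|
      .bicategoricalComp (.whiskerLeft _ (.whiskerRight
        (.map₂ T (.id _) (hS.unit_identity _ _)) _)) <|
      .bicategoricalComp (.whiskerRight (hS.pi_identity _ _ _ _) _) (.id _)

end IsCubical

/-! ### The identities of a Gray semigroup -/

namespace IsGray

variable {C : Type u} [Bicategory.{w, v} C] {T : TensorCore C} {S : SemigroupalCells T}

theorem isCubical (hS : IsGray T S) : IsCubical T S where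
  tens_identity_left := hS.tens_identity_left
  tens_identity_right := hS.tens_identity_right
  unit_identity := hS.unit_identity
  assoc_identity := hS.assoc_identity
  pi_identity := hS.pi_identity

section Strict

variable [Bicategory.Strict C]

/-- This is naturality of the associator after its identity 1-cells and identity 2-cells have been
removed. -/
theorem sim_map₂_assoc (hS : IsGray T S) {X X' Y Y' Z Z' : C} {f f₁ : X ⟶ X'} {g g₁ : Y ⟶ Y'}
    {h h₁ : Z ⟶ Z'} (τ : f ⟶ f₁) (σ : g ⟶ g₁) (η : h ⟶ h₁) :
    Sim (T.map₂ (T.map₂ τ σ) η) (T.map₂ τ (T.map₂ σ η)) := by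
  have hl : Sim (T.assoc X Y Z ◁ T.map₂ (T.map₂ τ σ) η ≫ (S.ahat f₁ g₁ h₁).hom)
      (T.map₂ (T.map₂ τ σ) η) :=
    .comp_triv (sim_whiskerLeft (hS.assoc_identity X Y Z) (.refl _)) (hS.ahat_identity _ _ _)
  have hr : Sim ((S.ahat f g h).hom ≫ T.map₂ τ (T.map₂ σ η) ▷ T.assoc X' Y' Z')
      (T.map₂ τ (T.map₂ σ η)) :=
    .triv_comp (hS.ahat_identity _ _ _) (sim_whiskerRight (.refl _) (hS.assoc_identity X' Y' Z'))
  exact hl.symm.trans ((Sim.of_eq (hS.semigroupal.ahat_natural τ σ η).symm).trans hr)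

/-- The two structural 2-isomorphisms of the triple tensor product agree. -/
theorem sim_tens_assoc (hS : IsGray T S) {X X' X'' Y Y' Y'' Z Z' Z'' : C} (f : X ⟶ X')
    (f' : X' ⟶ X'') (g : Y ⟶ Y') (g' : Y' ⟶ Y'') (h : Z ⟶ Z') (h' : Z' ⟶ Z'') :
    Sim ((S.tens (T.map f g) (T.map f' g') h h').hom ≫
        T.map₂ (S.tens f f' g g').hom (𝟙 (h ≫ h')))
      ((S.tens f f' (T.map g h) (T.map g' h')).hom ≫
        T.map₂ (𝟙 (f ≫ f')) (S.tens g g' h h').hom) := by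
  have hl : Sim (T.assoc X Y Z ◁ (S.tens (T.map f g) (T.map f' g') h h').hom ≫
        T.assoc X Y Z ◁ T.map₂ (S.tens f f' g g').hom (𝟙 (h ≫ h')) ≫
        (S.ahat (f ≫ f') (g ≫ g') (h ≫ h')).hom)
      ((S.tens (T.map f g) (T.map f' g') h h').hom ≫
        T.map₂ (S.tens f f' g g').hom (𝟙 (h ≫ h'))) :=
    .comp (sim_whiskerLeft (hS.assoc_identity X Y Z) (.refl _))
      (.comp_triv (sim_whiskerLeft (hS.assoc_identity X Y Z) (.refl _)) (hS.ahat_identity _ _ _))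
  -- The remaining side of `ahat_comp` is a pasting of identities with the right-bracketed
  -- interchangers.
  rw [hS.semigroupal.ahat_comp] at hl
  refine hl.symm.trans ?_
  exact .triv_comp (.associator_inv _ _ _) <|
    .triv_comp (.whiskerRight (hS.ahat_identity _ _ _) _) <|
    .triv_comp (.associator_hom _ _ _) <|
    .triv_comp (.whiskerLeft _ (hS.ahat_identity _ _ _)) <|
    .triv_comp (.associator_inv _ _ _) <|
    .comp (sim_whiskerRight (.refl _) (hS.assoc_identity _ _ _))
      (sim_whiskerRight (.refl _) (hS.assoc_identity _ _ _))

end Strict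

end IsGray

/-! ### The extension of scalars -/

section Cells

variable {K : Type*} {B : Type u} [Bicategory.{w, v} B] [∀ X Y : B, Preadditive (X ⟶ Y)]
  {X Y : DualExt K B}

theorem dualIso_eqToIso {f g : X ⟶ Y} (h : f = g) (h' : f.hom = g.hom) :
    dualIso (eqToIso h') = eqToIso h := by
  subst h
  exact Iso.ext (dual_ext rfl rfl)

/-- The 2-cell `1 + a ε`. -/
def oneAdd {f : X ⟶ Y} (a : f.hom ⟶ f.hom) : f ⟶ f := ⟨𝟙 f.hom, a⟩

@[simp]
theorem oneAdd_re {f : X ⟶ Y} (a : f.hom ⟶ f.hom) : (oneAdd a : f ⟶ f).re = 𝟙 f.hom := rfl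

@[simp]
theorem oneAdd_eps {f : X ⟶ Y} (a : f.hom ⟶ f.hom) : (oneAdd a : f ⟶ f).eps = a := rfl

/-- Since `ε² = 0`, composition becomes addition. This turns the coherence axioms into linear
cocycle conditions. -/
theorem oneAdd_comp {f : X ⟶ Y} (a b : f.hom ⟶ f.hom) :
    (oneAdd a : f ⟶ f) ≫ oneAdd b = oneAdd (a + b) :=
  dual_ext (by simp) (by simp [add_comm])

theorem oneAdd_zero (f : X ⟶ Y) : (oneAdd 0 : f ⟶ f) = 𝟙 f := rfl

theorem oneAdd_inj {f : X ⟶ Y} {a b : f.hom ⟶ f.hom} :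
    (oneAdd a : f ⟶ f) = oneAdd b ↔ a = b :=
  ⟨fun h => congrArg DualCell.eps h, fun h => by rw [h]⟩

theorem eps_comp {f g h : X ⟶ Y} {α : f ⟶ g} {β : g ⟶ h} (hα : α.eps = 0) (hβ : β.eps = 0) :
    (α ≫ β).eps = 0 := by
  simp [hα, hβ]

/-- The `ε`-part of `α` contributes the same summand to both sides and cancels. Naturality against
all 2-cells of the extension therefore reduces to naturality against 2-cells of the original
bicategory. -/
theorem oneAdd_comp_eq_iff {f g : X ⟶ Y} {a : f.hom ⟶ f.hom}
    {b : g.hom ⟶ g.hom} {α : f ⟶ g} :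
    oneAdd a ≫ α = α ≫ oneAdd b ↔ a ≫ α.re = α.re ≫ b := by
  constructor
  · intro h
    have := congrArg DualCell.eps h
    simpa [add_comm] using this
  · intro h
    exact dual_ext (by simp) (by simp [h, add_comm])

/-- Linear form of the modification axiom of the pentagonator, with the terms arranged in the order
and with the signs of `δv` in degree 2. -/
theorem oneAdd_pentagon_iff {f : X ⟶ Y} {a b c d e : f.hom ⟶ f.hom} :
    (oneAdd a : f ⟶ f) ≫ oneAdd b = oneAdd c ≫ oneAdd d ≫ oneAdd e ↔
      e - a + d - b + c = 0 := by
  rw [oneAdd_comp, oneAdd_comp, oneAdd_comp, oneAdd_inj, ← sub_eq_zero, ← neg_eq_zero]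
  refine Eq.congr_left ?_
  abel

/-- Linear form of the modification axiom of `ω`: `a` and `r` stand for the two associators, and the
bracket for `δv` of a 1-cochain. -/
theorem oneAdd_hexagon_iff {f : X ⟶ Y} {a b c d e r : f.hom ⟶ f.hom} :
    (oneAdd a : f ⟶ f) ≫ oneAdd b ≫ oneAdd c = oneAdd d ≫ oneAdd e ≫ oneAdd r ↔
      a + (c - d + b - e) = r := by
  rw [oneAdd_comp, oneAdd_comp, oneAdd_comp, oneAdd_comp, oneAdd_inj, ← sub_eq_zero,
    ← sub_eq_zero (b := r)]
  refine Eq.congr_left ?_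
  abel

end Cells

section Dual

variable {K : Type*} [CommRing K] {B : Type u} [Bicategory.{w, v} B]
  [∀ X Y : B, Preadditive (X ⟶ Y)] [∀ X Y : B, Linear K (X ⟶ Y)]

theorem TensorCore.IsBilinear.map₂_zero {T : TensorCore B} (hT : T.IsBilinear K) {X X' Y Y' : B}
    {f f' : X ⟶ X'} (α : f ⟶ f') (g g' : Y ⟶ Y') : T.map₂ α (0 : g ⟶ g') = 0 := by
  simpa using hT.map₂_smul (0 : K) α (0 : g ⟶ g')

theorem TensorCore.IsBilinear.zero_map₂ {T : TensorCore B} (hT : T.IsBilinear K) {X X' Y Y' : B}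
    (f f' : X ⟶ X') {g g' : Y ⟶ Y'} (β : g ⟶ g') : T.map₂ (0 : f ⟶ f') β = 0 := by
  simpa using hT.smul_map₂ (0 : K) (0 : f ⟶ f') β

theorem Sim.add {X Y X' Y' : B} {f g : X ⟶ Y} {f' g' : X' ⟶ Y'} {α β : f ⟶ g} {α' β' : f' ⟶ g'}
    (hα : Sim α α') (hβ : Sim β β') : Sim (α + β) (α' + β') := by
  cases hα
  cases hβ
  exact .refl _

theorem Sim.zero {X Y X' Y' : B} {f g : X ⟶ Y} {f' g' : X' ⟶ Y'} (h : total f = total f')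
    (h' : total g = total g') : Sim (0 : f ⟶ g) (0 : f' ⟶ g') := by
  cases h
  cases h'
  exact .refl _

variable [LinearBicategory K B]

@[simp]
theorem dual_whiskerLeft_re {X Y Z : DualExt K B} (f : X ⟶ Y) {g h : Y ⟶ Z} (α : g ⟶ h) :
    (f ◁ α).re = f.hom ◁ α.re := rfl

@[simp]
theorem dual_whiskerLeft_eps {X Y Z : DualExt K B} (f : X ⟶ Y) {g h : Y ⟶ Z} (α : g ⟶ h) :
    (f ◁ α).eps = f.hom ◁ α.eps := rfl

@[simp]
theorem dual_whiskerRight_re {X Y Z : DualExt K B} {f g : X ⟶ Y} (α : f ⟶ g) (h : Y ⟶ Z) :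
    (α ▷ h).re = α.re ▷ h.hom := rfl

@[simp]
theorem dual_whiskerRight_eps {X Y Z : DualExt K B} {f g : X ⟶ Y} (α : f ⟶ g) (h : Y ⟶ Z) :
    (α ▷ h).eps = α.eps ▷ h.hom := rfl

theorem dual_associator {X Y Z W : DualExt K B} (f : X ⟶ Y) (g : Y ⟶ Z) (h : Z ⟶ W) :
    α_ f g h = dualIso (α_ f.hom g.hom h.hom) := rfl

theorem dual_leftUnitor {X Y : DualExt K B} (f : X ⟶ Y) : λ_ f = dualIso (λ_ f.hom) := rfl

theorem dual_rightUnitor {X Y : DualExt K B} (f : X ⟶ Y) : ρ_ f = dualIso (ρ_ f.hom) := rfl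

instance dualStrict [Bicategory.Strict B] : Bicategory.Strict (DualExt K B) where
  id_comp f := DualHom.ext (Strict.id_comp f.hom)
  comp_id f := DualHom.ext (Strict.comp_id f.hom)
  assoc f g h := DualHom.ext (Strict.assoc f.hom g.hom h.hom)
  leftUnitor_eqToIso f := by
    rw [dual_leftUnitor, Strict.leftUnitor_eqToIso]
    exact dualIso_eqToIso _ _
  rightUnitor_eqToIso f := by
    rw [dual_rightUnitor, Strict.rightUnitor_eqToIso]
    exact dualIso_eqToIso _ _
  associator_eqToIso f g h := by
    rw [dual_associator, Strict.associator_eqToIso]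
    exact dualIso_eqToIso _ _

variable {X Y X' Y' : DualExt K B}

theorem IsIdentity₁.dual {f : X ⟶ Y} (hf : IsIdentity₁ f.hom) : IsIdentity₁ f := by
  obtain ⟨X⟩ := X
  obtain ⟨Y⟩ := Y
  obtain ⟨f⟩ := f
  obtain ⟨h, h'⟩ := hf
  dsimp only at h h'
  subst h h'
  exact ⟨rfl, rfl⟩

theorem IsIdentity₂.dual {f g : X ⟶ Y} {α : f ⟶ g} (h : IsIdentity₂ α.re) (h' : α.eps = 0) :
    IsIdentity₂ α := by
  obtain ⟨f⟩ := f
  obtain ⟨g⟩ := g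
  obtain ⟨a, b⟩ := α
  obtain ⟨e, h⟩ := h
  dsimp only at a b e h h'
  subst e h h'
  exact ⟨rfl, rfl⟩

theorem total_dual {f : X ⟶ Y} {f' : X' ⟶ Y'} (h : total f.hom = total f'.hom) :
    total f = total f' := by
  obtain ⟨X⟩ := X
  obtain ⟨Y⟩ := Y
  obtain ⟨X'⟩ := X'
  obtain ⟨Y'⟩ := Y'
  obtain ⟨f⟩ := f
  obtain ⟨f'⟩ := f'
  cases h
  rfl

theorem Sim.dual {f g : X ⟶ Y} {f' g' : X' ⟶ Y'} {α : f ⟶ g} {α' : f' ⟶ g'}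
    (h : Sim α.re α'.re) (h' : Sim α.eps α'.eps) : Sim α α' := by
  obtain ⟨X⟩ := X
  obtain ⟨Y⟩ := Y
  obtain ⟨X'⟩ := X'
  obtain ⟨Y'⟩ := Y'
  obtain ⟨f⟩ := f
  obtain ⟨f'⟩ := f'
  obtain ⟨g⟩ := g
  obtain ⟨g'⟩ := g'
  obtain ⟨a, b⟩ := α
  obtain ⟨a', b'⟩ := α'
  dsimp only at h h'
  cases h
  cases h'
  exact .refl _

/-- The 2-isomorphism `1 + a ε`. -/
def oneAddIso {f : X ⟶ Y} (a : f.hom ⟶ f.hom) : f ≅ f where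
  hom := oneAdd a
  inv := oneAdd (-a)
  hom_inv_id := by rw [oneAdd_comp, add_neg_cancel, oneAdd_zero]
  inv_hom_id := by rw [oneAdd_comp, neg_add_cancel, oneAdd_zero]

theorem sim_oneAdd_transport {f : X ⟶ Y} {f' : X' ⟶ Y'} (h : total f.hom = total f'.hom)
    (a : f.hom ⟶ f.hom) : Sim (oneAdd a : f ⟶ f) (oneAdd (transport h a) : f' ⟶ f') :=
  .dual (.id h) (sim_transport h a)

theorem map₂_oneAdd_id {T : TensorCore B} (hT : T.IsBilinear K) {f : X ⟶ Y} (a : f.hom ⟶ f.hom)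
    (g : X' ⟶ Y') :
    (T.dual hT).map₂ (oneAdd a : f ⟶ f) (𝟙 g) = oneAdd (T.map₂ a (𝟙 g.hom)) :=
  dual_ext (T.map₂_id _ _) 
    ((congrArg (· + _) (hT.map₂_zero _ _ _)).trans (zero_add _))

theorem map₂_id_oneAdd {T : TensorCore B} (hT : T.IsBilinear K) (f : X ⟶ Y) {g : X' ⟶ Y'}
    (b : g.hom ⟶ g.hom) :
    (T.dual hT).map₂ (𝟙 f) (oneAdd b : g ⟶ g) = oneAdd (T.map₂ (𝟙 f.hom) b) :=
  dual_ext (T.map₂_id _ _) 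
    ((congrArg (_ + ·) (hT.zero_map₂ _ _ _)).trans (add_zero _))

variable {T : TensorCore B} {S : SemigroupalCells T} {hT : T.IsBilinear K}

/-- Constant 2-cells are closed under `⊗`, as they are under whiskering and composition. Structural
equations among constant cells therefore read `0 = 0` in their `ε`-part. -/
theorem eps_map₂ {T : TensorCore B} (hT : T.IsBilinear K) {f g : X ⟶ Y} {f' g' : X' ⟶ Y'}
    {α : f ⟶ g} {β : f' ⟶ g'} (hα : α.eps = 0) (hβ : β.eps = 0) :
    ((T.dual hT).map₂ α β).eps = 0 := by
  change T.map₂ α.re β.eps + T.map₂ α.eps β.re = 0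
  rw [hα, hβ, hT.map₂_zero, hT.zero_map₂, add_zero]

theorem eps_whiskerLeft {Z : DualExt K B} (f : X ⟶ Y) {g h : Y ⟶ Z} {α : g ⟶ h}
    (hα : α.eps = 0) : (f ◁ α).eps = 0 := by
  rw [dual_whiskerLeft_eps, hα, whiskerLeft_zero K]

theorem eps_whiskerRight {Z : DualExt K B} {f g : X ⟶ Y} {α : f ⟶ g} (hα : α.eps = 0)
    (h : Y ⟶ Z) : (α ▷ h).eps = 0 := by
  rw [dual_whiskerRight_eps, hα, zero_whiskerRight K]

theorem IsCubical.dual (hS : IsCubical T S) : IsCubical (T.dual hT) (S.dual hT) where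
  tens_identity_left _ _ _ := .dual (hS.tens_identity_left _ _ _) rfl
  tens_identity_right _ _ _ := .dual (hS.tens_identity_right _ _ _) rfl
  unit_identity _ _ := .dual (hS.unit_identity _ _) rfl
  assoc_identity _ _ _ := .dual (hS.assoc_identity _ _ _)
  pi_identity _ _ _ _ := .dual (hS.pi_identity _ _ _ _) rfl

theorem IsGray.ahat_dual (hS : IsGray T S) {X X' Y Y' Z Z' : DualExt K B} (f : X ⟶ X')
    (g : Y ⟶ Y') (h : Z ⟶ Z') : IsIdentity₂ ((S.dual hT).ahat f g h).hom :=
  .dual (hS.ahat_identity _ _ _) rfl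

theorem IsGray.sim_dual_map₂_assoc [Bicategory.Strict B] (hS : IsGray T S)
    {X X' Y Y' Z Z' : DualExt K B} {f f₁ : X ⟶ X'} {g g₁ : Y ⟶ Y'} {h h₁ : Z ⟶ Z'} (τ : f ⟶ f₁)
    (σ : g ⟶ g₁) (η : h ⟶ h₁) :
    Sim ((T.dual hT).map₂ ((T.dual hT).map₂ τ σ) η)
      ((T.dual hT).map₂ τ ((T.dual hT).map₂ σ η)) := by
  refine .dual (hS.sim_map₂_assoc τ.re σ.re η.re) ?_
  -- The `ε`-part of a triple product has three summands, one for each factor that supplies `ε`.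
  -- Both bracketings list them in the same order.
  simp only [TensorCore.dual, hT.map₂_add, hT.add_map₂, ← add_assoc]
  exact .add (.add (hS.sim_map₂_assoc _ _ _) (hS.sim_map₂_assoc _ _ _))
    (hS.sim_map₂_assoc _ _ _)

theorem IsGray.sim_dual_tens_assoc [Bicategory.Strict B] (hS : IsGray T S)
    {X X' X'' Y Y' Y'' Z Z' Z'' : DualExt K B} (f : X ⟶ X') (f' : X' ⟶ X'') (g : Y ⟶ Y')
    (g' : Y' ⟶ Y'') (h : Z ⟶ Z') (h' : Z' ⟶ Z'') :
    Sim (((S.dual hT).tens ((T.dual hT).map f g) ((T.dual hT).map f' g') h h').hom ≫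
        (T.dual hT).map₂ ((S.dual hT).tens f f' g g').hom (𝟙 (h ≫ h')))
      (((S.dual hT).tens f f' ((T.dual hT).map g h) ((T.dual hT).map g' h')).hom ≫
        (T.dual hT).map₂ (𝟙 (f ≫ f')) ((S.dual hT).tens g g' h h').hom) := by
  refine .dual (hS.sim_tens_assoc _ _ _ _ _ _) ?_
  rw [eps_comp rfl (eps_map₂ hT rfl rfl), eps_comp rfl (eps_map₂ hT rfl rfl)]
  -- Both `ε`-parts are zero, but over different bracketings; relating them still requires the
  -- sources and the targets to agree.
  exact .zero (total_comp (total_assoc hS _ _ _) (total_assoc hS _ _ _)) (total_assoc hS _ _ _)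

end Dual

/-! ### The structural equations of the tensor product on the extension -/

section Tens

variable {K : Type*} [CommRing K] {B : Type u} [Bicategory.{w, v} B]
  [∀ X Y : B, Preadditive (X ⟶ Y)] [∀ X Y : B, Linear K (X ⟶ Y)] [LinearBicategory K B]
  {T : TensorCore B} {S : SemigroupalCells T} (hT : T.IsBilinear K)

theorem dual_tens_natural (hS : S.IsSemigroupal) {X X' X'' Y Y' Y'' : DualExt K B}
    {f f₁ : X ⟶ X'} {f' f₁' : X' ⟶ X''}
    {g g₁ : Y ⟶ Y'} {g' g₁' : Y' ⟶ Y''} (τ : f ⟶ f₁) (τ' : f' ⟶ f₁') (σ : g ⟶ g₁)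
    (σ' : g' ⟶ g₁') :
    hcomp ((T.dual hT).map₂ τ σ) ((T.dual hT).map₂ τ' σ') ≫
        ((S.dual hT).tens f₁ f₁' g₁ g₁').hom =
      ((S.dual hT).tens f f' g g').hom ≫ (T.dual hT).map₂ (hcomp τ τ') (hcomp σ σ') := by
  refine dual_ext (hS.tens_natural _ _ _ _) ?_
  -- Naturality is multilinear in the four 2-cells. Its `ε`-part is a sum of four instances of
  -- naturality in the original bicategory, in each of which one argument is replaced by its
  -- `ε`-part.
  have h₁ := hS.tens_natural τ.eps τ'.re σ.re σ'.re
  have h₂ := hS.tens_natural τ.re τ'.eps σ.re σ'.re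
  have h₃ := hS.tens_natural τ.re τ'.re σ.eps σ'.re
  have h₄ := hS.tens_natural τ.re τ'.re σ.re σ'.eps
  simp only [hcomp] at h₁ h₂ h₃ h₄
  change (hcomp (T.map₂ τ.re σ.re) (T.map₂ τ'.re σ'.re)) ≫
        (0 : T.map f₁.hom g₁.hom ≫ T.map f₁'.hom g₁'.hom ⟶
          T.map (f₁.hom ≫ f₁'.hom) (g₁.hom ≫ g₁'.hom)) +
      (T.map₂ τ.re σ.re ▷ T.map f'.hom g'.hom ≫
          T.map f₁.hom g₁.hom ◁ (T.map₂ τ'.re σ'.eps + T.map₂ τ'.eps σ'.re) +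
        (T.map₂ τ.re σ.eps + T.map₂ τ.eps σ.re) ▷ T.map f'.hom g'.hom ≫
          T.map f₁.hom g₁.hom ◁ T.map₂ τ'.re σ'.re) ≫ (S.tens f₁.hom f₁'.hom g₁.hom g₁'.hom).hom =
    (S.tens f.hom f'.hom g.hom g'.hom).hom ≫
      (T.map₂ (hcomp τ.re τ'.re)
          (σ.re ▷ g'.hom ≫ g₁.hom ◁ σ'.eps + σ.eps ▷ g'.hom ≫ g₁.hom ◁ σ'.re) +
        T.map₂ (τ.re ▷ f'.hom ≫ f₁.hom ◁ τ'.eps + τ.eps ▷ f'.hom ≫ f₁.hom ◁ τ'.re)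
          (hcomp σ.re σ'.re)) +
      (0 : T.map f.hom g.hom ≫ T.map f'.hom g'.hom ⟶
          T.map (f.hom ≫ f'.hom) (g.hom ≫ g'.hom)) ≫
        T.map₂ (hcomp τ.re τ'.re) (hcomp σ.re σ'.re)
  simp only [hcomp, Limits.comp_zero, Limits.zero_comp, hT.map₂_add, hT.add_map₂,
    LinearBicategory.whiskerLeft_add (K := K), LinearBicategory.add_whiskerRight (K := K),
    Preadditive.comp_add, Preadditive.add_comp, h₁, h₂, h₃, h₄]
  abel

theorem dual_tens_assoc (hS : S.IsSemigroupal) {X X' X'' X₃ Y Y' Y'' Y₃ : DualExt K B}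
    (f : X ⟶ X') (f' : X' ⟶ X'') (f'' : X'' ⟶ X₃) (g : Y ⟶ Y') (g' : Y' ⟶ Y'') (g'' : Y'' ⟶ Y₃) :
    (T.dual hT).map f g ◁ ((S.dual hT).tens f' f'' g' g'').hom ≫
        ((S.dual hT).tens f (f' ≫ f'') g (g' ≫ g'')).hom =
      (α_ _ _ _).inv ≫ ((S.dual hT).tens f f' g g').hom ▷ (T.dual hT).map f'' g'' ≫
        ((S.dual hT).tens (f ≫ f') f'' (g ≫ g') g'').hom ≫
        (T.dual hT).map₂ (α_ f f' f'').hom (α_ g g' g'').hom := by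
  refine dual_ext (hS.tens_assoc _ _ _ _ _ _) ?_
  rw [eps_comp (eps_whiskerLeft _ rfl) rfl, eps_comp rfl (eps_comp (eps_whiskerRight rfl _)
    (eps_comp rfl (eps_map₂ hT rfl rfl)))]

theorem dual_tens_id_right (hS : S.IsSemigroupal) {X X' Y Y' : DualExt K B} (f : X ⟶ X')
    (g : Y ⟶ Y') :
    ((S.dual hT).tens f (𝟙 X') g (𝟙 Y')).hom ≫ (T.dual hT).map₂ (ρ_ f).hom (ρ_ g).hom =
      (T.dual hT).map f g ◁ ((S.dual hT).unit X' Y').hom ≫ (ρ_ ((T.dual hT).map f g)).hom := by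
  refine dual_ext (hS.tens_id_right _ _) ?_
  rw [eps_comp rfl (eps_map₂ hT rfl rfl), eps_comp (eps_whiskerLeft _ rfl) rfl]

theorem dual_tens_id_left (hS : S.IsSemigroupal) {X X' Y Y' : DualExt K B} (f : X ⟶ X')
    (g : Y ⟶ Y') :
    ((S.dual hT).tens (𝟙 X) f (𝟙 Y) g).hom ≫ (T.dual hT).map₂ (λ_ f).hom (λ_ g).hom =
      ((S.dual hT).unit X Y).hom ▷ (T.dual hT).map f g ≫ (λ_ ((T.dual hT).map f g)).hom := by
  refine dual_ext (hS.tens_id_left _ _) ?_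
  rw [eps_comp rfl (eps_map₂ hT rfl rfl), eps_comp (eps_whiskerRight rfl _) rfl]

end Tens

/-! ### Axioms of a deformed associator as equations on its first order part -/

section

variable {K : Type*} [CommRing K] {B : Type u} [Bicategory.{w, v} B]
  [∀ X Y : B, Preadditive (X ⟶ Y)] [∀ X Y : B, Linear K (X ⟶ Y)]

theorem IsIdentity₂.sim_id {C : Type u} [Bicategory.{w, v} C] {X Y X' Y' : C} {f g : X ⟶ Y}
    {f' : X' ⟶ Y'} {α : f ⟶ g} (hα : IsIdentity₂ α) (h : total f = total f') : Sim α (𝟙 f') :=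
  hα.sim.trans (.id h)

/-- Because `t` is constant, the `ε`-part of this compatibility with composition is a Leibniz rule
along `t`. The right-hand side is arranged as a value of `δh`. -/
theorem oneAdd_icon_iff [LinearBicategory K B] {X Y Z : DualExt K B} {f : X ⟶ Y} {f' : Y ⟶ Z}
    {k : X ⟶ Z} {t : f ≫ f' ⟶ k} (ht : t.eps = 0) (a : f.hom ⟶ f.hom) (b : f'.hom ⟶ f'.hom)
    (c : k.hom ⟶ k.hom) :
    t ≫ oneAdd c = oneAdd a ▷ f' ≫ f ◁ oneAdd b ≫ t ↔
      f.hom ◁ b ≫ t.re - t.re ≫ c + a ▷ f'.hom ≫ t.re = 0 := by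
  have h : (oneAdd a ▷ f' ≫ f ◁ oneAdd b ≫ t).eps =
      f.hom ◁ b ≫ t.re + a ▷ f'.hom ≫ t.re := by
    simp [ht]
  have h' : (t ≫ oneAdd c).eps = t.re ≫ c := by simp [ht]
  constructor
  · intro e
    have := congrArg DualCell.eps e
    rw [h, h'] at this
    rw [this]
    abel
  · intro e
    refine dual_ext (by simp) ?_
    rw [h, h', ← sub_eq_zero, ← neg_eq_zero, ← e]
    abel

namespace GraySemigroup

section

variable (G : GraySemigroup K B)

/-- The component of a family at a triple of 1-cells. -/
def triple (φ : G.Family₀ 2) {X X' Y Y' Z Z' : B} (f : X ⟶ X') (g : Y ⟶ Y') (h : Z ⟶ Z') :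
    G.core.map f (G.core.map g h) ⟶ G.core.map f (G.core.map g h) :=
  φ (X, (Y, Z)) (X', (Y', Z')) (f, (g, h))

/-- The component of a family at a pair of 1-cells. -/
def pair (θ : G.Family₀ 1) {X X' Y Y' : B} (f : X ⟶ X') (g : Y ⟶ Y') :
    G.core.map f g ⟶ G.core.map f g :=
  θ (X, Y) (X', Y') (f, g)

/-- The recursion for `tTens` ends in an identity 2-cell, whose tensor with an identity contributes
a superfluous last factor. -/
theorem tTens_one {X X' X'' Y Y' Y'' : B} (f : X ⟶ X') (f' : X' ⟶ X'') (g : Y ⟶ Y')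
    (g' : Y' ⟶ Y'') :
    G.cells.tTens 1 (X := (X, Y)) (Y := (X', Y')) (Z := (X'', Y'')) (f, g) (f', g') =
      (G.cells.tens f f' g g').hom :=
  (congrArg ((G.cells.tens f f' g g').hom ≫ ·) (G.core.map₂_id _ _)).trans (Category.comp_id _)

/-- The structural 2-isomorphism of the triple tensor product. -/
def tens₂ {X X' X'' Y Y' Y'' Z Z' Z'' : B} (f : X ⟶ X') (f' : X' ⟶ X'') (g : Y ⟶ Y')
    (g' : Y' ⟶ Y'') (h : Z ⟶ Z') (h' : Z' ⟶ Z'') :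
    G.core.map f (G.core.map g h) ≫ G.core.map f' (G.core.map g' h') ⟶
      G.core.map (f ≫ f') (G.core.map (g ≫ g') (h ≫ h')) :=
  (G.cells.tens f f' (G.core.map g h) (G.core.map g' h')).hom ≫
    G.core.map₂ (𝟙 (f ≫ f')) (G.cells.tens g g' h h').hom

theorem tTens_two {X X' X'' Y Y' Y'' Z Z' Z'' : B} (f : X ⟶ X') (f' : X' ⟶ X'') (g : Y ⟶ Y')
    (g' : Y' ⟶ Y'') (h : Z ⟶ Z') (h' : Z' ⟶ Z'') :
    G.cells.tTens 2 (X := (X, (Y, Z))) (Y := (X', (Y', Z'))) (Z := (X'', (Y'', Z'')))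
      (f, (g, h)) (f', (g', h')) = G.tens₂ f f' g g' h h' :=
  congrArg (fun α => (G.cells.tens f f' (G.core.map g h) (G.core.map g' h')).hom ≫
    G.core.map₂ (𝟙 (f ≫ f')) α) (G.tTens_one g g' h h')

end

section

variable [Bicategory.Strict B] (G : GraySemigroup K B)

theorem δv_one (θ : G.Family₀ 1) (X Y : Tup B 2) (f : TupHom 2 X Y) :
    G.δv 1 θ X Y f = G.oneTensor θ f -
      transport (total_merge G.gray 1 0 f) (θ _ _ (G.core.mergeHom 1 0 f)) +
      transport (total_merge G.gray 1 1 f) (θ _ _ (G.core.mergeHom 1 1 f)) -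
      transport (total_init G.gray 1 f)
        (G.core.map₂ (θ _ _ (tupHomInit 1 f)) (𝟙 (tupHomLast 1 f))) := by
  change G.oneTensor θ f + ∑ i ∈ Finset.range (1 + 1), (-1 : K) ^ (i + 1) •
      transport (total_merge G.gray 1 i f) (θ _ _ (G.core.mergeHom 1 i f)) +
    (-1 : K) ^ (1 + 2) • transport (total_init G.gray 1 f)
      (G.core.map₂ (θ _ _ (tupHomInit 1 f)) (𝟙 (tupHomLast 1 f))) = _
  rw [Finset.sum_range_succ, Finset.sum_range_succ, Finset.sum_range_zero]
  module

theorem δv_two (φ : G.Family₀ 2) (X Y : Tup B 3) (f : TupHom 3 X Y) :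
    G.δv 2 φ X Y f = G.oneTensor φ f -
      transport (total_merge G.gray 2 0 f) (φ _ _ (G.core.mergeHom 2 0 f)) +
      transport (total_merge G.gray 2 1 f) (φ _ _ (G.core.mergeHom 2 1 f)) -
      transport (total_merge G.gray 2 2 f) (φ _ _ (G.core.mergeHom 2 2 f)) +
      transport (total_init G.gray 2 f)
        (G.core.map₂ (φ _ _ (tupHomInit 2 f)) (𝟙 (tupHomLast 2 f))) := by
  change G.oneTensor φ f + ∑ i ∈ Finset.range (2 + 1), (-1 : K) ^ (i + 1) •
      transport (total_merge G.gray 2 i f) (φ _ _ (G.core.mergeHom 2 i f)) +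
    (-1 : K) ^ (2 + 2) • transport (total_init G.gray 2 f)
      (G.core.map₂ (φ _ _ (tupHomInit 2 f)) (𝟙 (tupHomLast 2 f))) = _
  rw [Finset.sum_range_succ, Finset.sum_range_succ, Finset.sum_range_succ, Finset.sum_range_zero]
  module

end

variable [LinearBicategory K B] (G : GraySemigroup K B)

theorem δh_one (θ : G.Family₀ 1) {X X' X'' Y Y' Y'' : B} (f : X ⟶ X') (f' : X' ⟶ X'')
    (g : Y ⟶ Y') (g' : Y' ⟶ Y'') :
    G.δh 1 θ (X, Y) (X', Y') (X'', Y'') (f, g) (f', g') =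
      G.core.map f g ◁ G.pair θ f' g' ≫ (G.cells.tens f f' g g').hom -
        (G.cells.tens f f' g g').hom ≫ G.pair θ (f ≫ f') (g ≫ g') +
        G.pair θ f g ▷ G.core.map f' g' ≫ (G.cells.tens f f' g g').hom :=
  congrArg (fun t : G.core.map f g ≫ G.core.map f' g' ⟶ G.core.map (f ≫ f') (g ≫ g') =>
    G.core.map f g ◁ G.pair θ f' g' ≫ t - t ≫ G.pair θ (f ≫ f') (g ≫ g') +
      G.pair θ f g ▷ G.core.map f' g' ≫ t) (G.tTens_one f f' g g')

theorem δh_two (φ : G.Family₀ 2) {X X' X'' Y Y' Y'' Z Z' Z'' : B} (f : X ⟶ X') (f' : X' ⟶ X'')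
    (g : Y ⟶ Y') (g' : Y' ⟶ Y'') (h : Z ⟶ Z') (h' : Z' ⟶ Z'') :
    G.δh 2 φ (X, (Y, Z)) (X', (Y', Z')) (X'', (Y'', Z'')) (f, (g, h)) (f', (g', h')) =
      G.core.map f (G.core.map g h) ◁ G.triple φ f' g' h' ≫ G.tens₂ f f' g g' h h' -
        G.tens₂ f f' g g' h h' ≫ G.triple φ (f ≫ f') (g ≫ g') (h ≫ h') +
        G.triple φ f g h ▷ G.core.map f' (G.core.map g' h') ≫ G.tens₂ f f' g g' h h' :=
  congrArg (fun t : G.core.map f (G.core.map g h) ≫ G.core.map f' (G.core.map g' h') ⟶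
      G.core.map (f ≫ f') (G.core.map (g ≫ g') (h ≫ h')) =>
    G.core.map f (G.core.map g h) ◁ G.triple φ f' g' h' ≫ t -
      t ≫ G.triple φ (f ≫ f') (g ≫ g') (h ≫ h') +
      G.triple φ f g h ▷ G.core.map f' (G.core.map g' h') ≫ t) (G.tTens_two f f' g g' h h')

/-- The tensor product on the extension of scalars. -/
abbrev dualCore : TensorCore (DualExt K B) := G.core.dual G.bilinear

/-- The structural 2-isomorphisms of the null deformation. -/
abbrev dualCells : SemigroupalCells G.dualCore := G.cells.dual G.bilinear

/-- The structural 2-isomorphisms obtained by deforming the associator by the family `φ`. -/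
def deformedCells (φ : G.Family₀ 2) : SemigroupalCells G.dualCore where
  tens f f' g g' := G.dualCells.tens f f' g g'
  unit X Y := G.dualCells.unit X Y
  ahat {_ X' _ Y' _ Z'} f g h := G.dualCells.ahat f g h ≪≫
    whiskerRightIso (oneAddIso (G.triple φ f.hom g.hom h.hom)) (G.dualCore.assoc X' Y' Z')
  pi X Y Z W := G.dualCells.pi X Y Z W

theorem dual_cubical : IsCubical G.dualCore G.dualCells := G.gray.isCubical.dual

variable (φ : G.Family₀ 2)

theorem deformed_cubical : IsCubical G.dualCore (G.deformedCells φ) :=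
  { G.dual_cubical with }

variable [Bicategory.Strict B]

section

variable {X X' Y Y' Z Z' : DualExt K B} (f : X ⟶ X') (g : Y ⟶ Y') (h : Z ⟶ Z')

/-- The component of a family at a triple of 1-cells, as a 2-cell of the extension. -/
def cell₃ : G.dualCore.map f (G.dualCore.map g h) ⟶ G.dualCore.map f (G.dualCore.map g h) :=
  oneAdd (G.triple φ f.hom g.hom h.hom)

theorem sim_cell₃ : Sim (G.cell₃ φ f g h ▷ G.dualCore.assoc X' Y' Z') (G.cell₃ φ f g h) :=
  sim_whiskerRight (.refl _) (G.dual_cubical.assoc_identity _ _ _)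

/-- The undeformed associator 2-cell and the whisker by `a` are identities, so only `1 + φ(f, g, h)
ε` remains. -/
theorem sim_ahat : Sim ((G.deformedCells φ).ahat f g h).hom (G.cell₃ φ f g h) :=
  .triv_comp (G.gray.ahat_dual f g h) (G.sim_cell₃ φ f g h)

theorem dual_total_assoc :
    total (G.dualCore.map (G.dualCore.map f g) h) = total (G.dualCore.map f (G.dualCore.map g h)) :=
  total_dual (total_assoc G.gray _ _ _)

end

theorem deformed_ahat_natural_iff {X X' Y Y' Z Z' : DualExt K B} {f f₁ : X ⟶ X'} {g g₁ : Y ⟶ Y'}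
    {h h₁ : Z ⟶ Z'} (τ : f ⟶ f₁) (σ : g ⟶ g₁) (η : h ⟶ h₁) :
    ((G.deformedCells φ).ahat f g h).hom ≫
          G.dualCore.map₂ τ (G.dualCore.map₂ σ η) ▷ G.dualCore.assoc X' Y' Z' =
        G.dualCore.assoc X Y Z ◁ G.dualCore.map₂ (G.dualCore.map₂ τ σ) η ≫
          ((G.deformedCells φ).ahat f₁ g₁ h₁).hom ↔
      G.triple φ f.hom g.hom h.hom ≫ G.core.map₂ τ.re (G.core.map₂ σ.re η.re) =
        G.core.map₂ τ.re (G.core.map₂ σ.re η.re) ≫ G.triple φ f₁.hom g₁.hom h₁.hom := by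
  have hA := G.dual_cubical.assoc_identity
  refine (Sim.eq_iff (.comp (G.sim_ahat φ f g h) (sim_whiskerRight (.refl _) (hA _ _ _)))
    (.comp (sim_whiskerLeft (hA _ _ _) (G.gray.sim_dual_map₂_assoc τ σ η))
      (G.sim_ahat φ f₁ g₁ h₁))).trans ?_
  exact oneAdd_comp_eq_iff

theorem deformed_ahat_comp_iff {X X' X'' Y Y' Y'' Z Z' Z'' : DualExt K B} (f : X ⟶ X')
    (f' : X' ⟶ X'') (g : Y ⟶ Y') (g' : Y' ⟶ Y'') (h : Z ⟶ Z') (h' : Z' ⟶ Z'') :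
    G.dualCore.assoc X Y Z ◁
          ((G.deformedCells φ).tens (G.dualCore.map f g) (G.dualCore.map f' g') h h').hom ≫
        G.dualCore.assoc X Y Z ◁
          G.dualCore.map₂ ((G.deformedCells φ).tens f f' g g').hom (𝟙 (h ≫ h')) ≫
        ((G.deformedCells φ).ahat (f ≫ f') (g ≫ g') (h ≫ h')).hom =
      (α_ _ _ _).inv ≫
        ((G.deformedCells φ).ahat f g h).hom ▷ G.dualCore.map (G.dualCore.map f' g') h' ≫
        (α_ _ _ _).hom ≫ G.dualCore.map f (G.dualCore.map g h) ◁
          ((G.deformedCells φ).ahat f' g' h').hom ≫ (α_ _ _ _).inv ≫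
        ((G.deformedCells φ).tens f f' (G.dualCore.map g h) (G.dualCore.map g' h')).hom ▷
          G.dualCore.assoc X'' Y'' Z'' ≫
        G.dualCore.map₂ (𝟙 (f ≫ f')) ((G.deformedCells φ).tens g g' h h').hom ▷
          G.dualCore.assoc X'' Y'' Z'' ↔
    G.δh 2 φ (X.obj, (Y.obj, Z.obj)) (X'.obj, (Y'.obj, Z'.obj)) (X''.obj, (Y''.obj, Z''.obj))
      (f.hom, (g.hom, h.hom)) (f'.hom, (g'.hom, h'.hom)) = 0 := by
  have hA := G.dual_cubical.assoc_identity
  -- The interchangers are rebracketed to the right, so that the same cell `t` appears on both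
  -- sides, as `oneAdd_icon_iff` requires.
  have hl := Sim.comp ((Sim.comp (sim_whiskerLeft (hA X Y Z) (.refl _))
    (sim_whiskerLeft (hA X Y Z) (.refl _))).trans (G.gray.sim_dual_tens_assoc f f' g g' h h'))
    (G.sim_ahat φ (f ≫ f') (g ≫ g') (h ≫ h'))
  rw [Category.assoc] at hl
  refine (Sim.eq_iff hl (.triv_comp (.associator_inv _ _ _) <|
    .comp (.whiskerRight (G.sim_ahat φ f g h) (G.dual_total_assoc f' g' h')) <|
    .triv_comp (.associator_hom _ _ _) <|
    .comp (.whiskerLeft rfl (G.sim_ahat φ f' g' h')) <|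
    .triv_comp (.associator_inv _ _ _) <|
    .comp (sim_whiskerRight (.refl _) (hA _ _ _))
      (sim_whiskerRight (.refl _) (hA _ _ _)))).trans ?_
  rw [δh_two]
  exact oneAdd_icon_iff
    (t := (G.dualCells.tens f f' (G.dualCore.map g h) (G.dualCore.map g' h')).hom ≫
      G.dualCore.map₂ (𝟙 (f ≫ f')) (G.dualCells.tens g g' h h').hom)
    (eps_comp rfl (eps_map₂ G.bilinear rfl rfl)) (G.triple φ f.hom g.hom h.hom)
    (G.triple φ f'.hom g'.hom h'.hom)
    (G.triple φ (f.hom ≫ f'.hom) (g.hom ≫ g'.hom) (h.hom ≫ h'.hom))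

/-- The right-hand side is assembled from `⊗₀`, hence is an identity, and the equation says `1 +
φ(1, 1, 1) ε = 1`. -/
theorem deformed_ahat_id_iff (X Y Z : DualExt K B) :
    ((G.deformedCells φ).ahat (𝟙 X) (𝟙 Y) (𝟙 Z)).hom =
        G.dualCore.assoc X Y Z ◁
            (G.dualCore.map₂ ((G.deformedCells φ).unit X Y).hom (𝟙 (𝟙 Z)) ≫
              ((G.deformedCells φ).unit (G.dualCore.obj X Y) Z).hom) ⊗≫
          (((G.deformedCells φ).unit X (G.dualCore.obj Y Z)).inv ≫
            G.dualCore.map₂ (𝟙 (𝟙 X)) ((G.deformedCells φ).unit Y Z).inv) ▷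
              G.dualCore.assoc X Y Z ↔
      G.triple φ (𝟙 X.obj) (𝟙 Y.obj) (𝟙 Z.obj) = 0 := by
  have hU := G.dual_cubical.unit_identity
  refine (Sim.eq_iff (G.sim_ahat φ (𝟙 X) (𝟙 Y) (𝟙 Z)) (IsIdentity₂.sim_id
    (.bicategoricalComp (.whiskerLeft _ (.comp (.map₂ _ (hU X Y) (.id _)) (hU _ Z)))
      (.whiskerRight (.comp (.inv (hU X _)) (.map₂ _ (.id _) (.inv (hU Y Z)))) _)) ?_)).trans ?_
  · exact ((G.dual_cubical.assoc_identity X Y Z).total_comp_left _).trans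
      (G.dual_total_assoc _ _ _)
  · exact oneAdd_inj (b := 0)

/-- With trivial pentagonator, two associator cells remain on one side and three on the other. They
are the five faces in `δv φ`; the outer faces `1 ⊗ φ` and `φ ⊗ 1` arise where the associator is
tensored with an identity. -/
theorem deformed_pi_natural_iff {X X' Y Y' Z Z' W W' : DualExt K B} (f : X ⟶ X') (g : Y ⟶ Y')
    (h : Z ⟶ Z') (k : W ⟶ W') :
    ((G.deformedCells φ).pi X Y Z W).hom ▷
          G.dualCore.map (G.dualCore.map (G.dualCore.map f g) h) k ⊗≫
        G.dualCore.assoc X Y (G.dualCore.obj Z W) ◁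
          ((G.deformedCells φ).ahat (G.dualCore.map f g) h k).hom ⊗≫
        ((G.deformedCells φ).ahat f g (G.dualCore.map h k)).hom ▷
          G.dualCore.assoc (G.dualCore.obj X' Y') Z' W' ⊗≫
        𝟙 (G.dualCore.map f (G.dualCore.map g (G.dualCore.map h k)) ≫
          G.dualCore.assoc X' Y' (G.dualCore.obj Z' W') ≫
            G.dualCore.assoc (G.dualCore.obj X' Y') Z' W') =
      𝟙 ((G.dualCore.map (𝟙 X) (G.dualCore.assoc Y Z W) ≫
            G.dualCore.assoc X (G.dualCore.obj Y Z) W ≫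
            G.dualCore.map (G.dualCore.assoc X Y Z) (𝟙 W)) ≫
          G.dualCore.map (G.dualCore.map (G.dualCore.map f g) h) k) ⊗≫
        (G.dualCore.map (𝟙 X) (G.dualCore.assoc Y Z W) ≫
            G.dualCore.assoc X (G.dualCore.obj Y Z) W) ◁
          (((G.deformedCells φ).tens (G.dualCore.assoc X Y Z)
              (G.dualCore.map (G.dualCore.map f g) h) (𝟙 W) k).hom ≫
            G.dualCore.map₂ ((G.deformedCells φ).ahat f g h).hom ((λ_ k).hom ≫ (ρ_ k).inv) ≫
            ((G.deformedCells φ).tens (G.dualCore.map f (G.dualCore.map g h))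
              (G.dualCore.assoc X' Y' Z') k (𝟙 W')).inv) ⊗≫
        G.dualCore.map (𝟙 X) (G.dualCore.assoc Y Z W) ◁
          ((G.deformedCells φ).ahat f (G.dualCore.map g h) k).hom ▷
          G.dualCore.map (G.dualCore.assoc X' Y' Z') (𝟙 W') ⊗≫
        (((G.deformedCells φ).tens (𝟙 X) f (G.dualCore.assoc Y Z W)
              (G.dualCore.map (G.dualCore.map g h) k)).hom ≫
            G.dualCore.map₂ ((λ_ f).hom ≫ (ρ_ f).inv) ((G.deformedCells φ).ahat g h k).hom ≫
            ((G.deformedCells φ).tens f (𝟙 X') (G.dualCore.map g (G.dualCore.map h k))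
              (G.dualCore.assoc Y' Z' W')).inv) ▷
          (G.dualCore.assoc X' (G.dualCore.obj Y' Z') W' ≫
            G.dualCore.map (G.dualCore.assoc X' Y' Z') (𝟙 W')) ⊗≫
        G.dualCore.map f (G.dualCore.map g (G.dualCore.map h k)) ◁
          ((G.deformedCells φ).pi X' Y' Z' W').hom ↔
    G.δv 2 φ (X.obj, (Y.obj, (Z.obj, W.obj))) (X'.obj, (Y'.obj, (Z'.obj, W'.obj)))
      (f.hom, (g.hom, (h.hom, k.hom))) = 0 := by
  have hC := G.deformed_cubical φ
  have hA := hC.assoc_identity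
  have hM {V V' : DualExt K B} {x : V ⟶ V'} (hx : IsIdentity₁ x) (U : DualExt K B) :
      IsIdentity₁ (G.dualCore.map x (𝟙 U)) := hC.map_id hx (.id U)
  have hM' {V V' : DualExt K B} {x : V ⟶ V'} (hx : IsIdentity₁ x) (U : DualExt K B) :
      IsIdentity₁ (G.dualCore.map (𝟙 U) x) := hC.map_id (.id U) hx
  have hU {V V' : DualExt K B} (x : V ⟶ V') : Sim ((λ_ x).hom ≫ (ρ_ x).inv) (𝟙 x) :=
    IsIdentity₂.sim_id (.comp (.leftUnitor_hom x) (.rightUnitor_inv x))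
      ((IsIdentity₁.id V).total_comp_left x)
  -- The right-bracketed product is where `δv φ` takes its values. All five associator cells are
  -- moved to endomorphisms of it, so that they can be added.
  let F : G.dualCore.obj X (G.dualCore.obj Y (G.dualCore.obj Z W)) ⟶ _ :=
    G.dualCore.map f (G.dualCore.map g (G.dualCore.map h k))
  let q : TupHom 3 (X.obj, (Y.obj, (Z.obj, W.obj))) (X'.obj, (Y'.obj, (Z'.obj, W'.obj))) :=
    (f.hom, (g.hom, (h.hom, k.hom)))
  have h₁ : Sim ((G.deformedCells φ).ahat (G.dualCore.map f g) h k).hom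
      (oneAdd (transport (total_merge G.gray 2 0 q) (φ _ _ (G.core.mergeHom 2 0 q))) : F ⟶ F) :=
    (G.sim_ahat φ _ _ _).trans (sim_oneAdd_transport _ _)
  have h₂ : Sim ((G.deformedCells φ).ahat f (G.dualCore.map g h) k).hom
      (oneAdd (transport (total_merge G.gray 2 1 q) (φ _ _ (G.core.mergeHom 2 1 q))) : F ⟶ F) :=
    (G.sim_ahat φ _ _ _).trans (sim_oneAdd_transport _ _)
  have h₃ : Sim ((G.deformedCells φ).ahat f g (G.dualCore.map h k)).hom
      (oneAdd (transport (total_merge G.gray 2 2 q) (φ _ _ (G.core.mergeHom 2 2 q))) : F ⟶ F) :=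
    (G.sim_ahat φ _ _ _).trans (sim_oneAdd_transport _ _)
  have h₄ : Sim (G.dualCore.map₂ ((G.deformedCells φ).ahat f g h).hom ((λ_ k).hom ≫ (ρ_ k).inv))
      (oneAdd (transport (total_init G.gray 2 q)
        (G.core.map₂ (φ _ _ (tupHomInit 2 q)) (𝟙 (tupHomLast 2 q)))) : F ⟶ F) :=
    (Sim.map₂ _ (G.sim_ahat φ _ _ _) (hU k)).trans
      ((Sim.of_eq (map₂_oneAdd_id G.bilinear _ _)).trans (sim_oneAdd_transport _ _))
  have h₅ : Sim (G.dualCore.map₂ ((λ_ f).hom ≫ (ρ_ f).inv) ((G.deformedCells φ).ahat g h k).hom)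
      (oneAdd (G.oneTensor φ q) : F ⟶ F) :=
    (Sim.map₂ _ (hU f) (G.sim_ahat φ _ _ _)).trans (Sim.of_eq (map₂_id_oneAdd G.bilinear _ _))
  refine (Sim.eq_iff
    (.triv_bicategoricalComp (.whiskerRight (hC.pi_identity _ _ _ _) _) <|
      .bicategoricalComp (sim_whiskerLeft (hA _ _ _) h₁) <|
      .bicategoricalComp_triv (sim_whiskerRight h₃ (hA _ _ _)) (.id _))
    (.triv_bicategoricalComp (.id _) <|
      .bicategoricalComp (sim_whiskerLeft (.comp (hM' (hA _ _ _) _) (hA _ _ _))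
        (.triv_comp (hC.tens_right _ _ _ (hA _ _ _)) (.comp_triv h₄
          (.inv (hC.tens_left _ _ _ (.id _)))))) <|
      .bicategoricalComp (sim_whiskerLeft (hM' (hA _ _ _) _)
        (sim_whiskerRight h₂ (hM (hA _ _ _) _))) <|
      .bicategoricalComp_triv (sim_whiskerRight (.triv_comp (hC.tens_right _ _ _ (.id _))
        (.comp_triv h₅ (.inv (hC.tens_left _ _ _ (hA _ _ _)))))
          (.comp (hA _ _ _) (hM (hA _ _ _) _)))
        (.whiskerLeft _ (hC.pi_identity _ _ _ _)))).trans ?_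
  exact oneAdd_pentagon_iff.trans (Eq.congr_left (G.δv_two φ _ _ q).symm)

theorem deformed_ahat_identity (hφ : ∀ X Y Z : B, G.triple φ (𝟙 X) (𝟙 Y) (𝟙 Z) = 0)
    {X X' Y Y' Z Z' : DualExt K B} {f : X ⟶ X'} {g : Y ⟶ Y'} {h : Z ⟶ Z'} (hf : IsIdentity₁ f)
    (hg : IsIdentity₁ g) (hh : IsIdentity₁ h) :
    IsIdentity₂ ((G.deformedCells φ).ahat f g h).hom := by
  obtain ⟨rfl, rfl⟩ := hf
  obtain ⟨rfl, rfl⟩ := hg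
  obtain ⟨rfl, rfl⟩ := hh
  refine .of_sim (G.sim_ahat φ _ _ _) (.dual (.id _) ?_)
  exact hφ X.obj Y.obj Z.obj

/-- The family `φ` defines a semigroupal structure if and only if it is a 2-cocycle. -/
theorem deformed_semigroupal_iff : (G.deformedCells φ).IsSemigroupal ↔ φ ∈ G.cocycles 2 := by
  constructor
  · intro hS
    refine ⟨⟨⟨?_, ?_⟩, ?_⟩, ?_⟩
    · rintro ⟨X, Y, Z⟩ ⟨X', Y', Z'⟩ ⟨f, g, h⟩ ⟨f₁, g₁, h₁⟩ ⟨τ, σ, η⟩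
      -- A 2-cell is regarded as a constant 2-cell of the extension; testing naturality against
      -- constants suffices.
      let c {V V' : B} {x y : V ⟶ V'} (α : x ⟶ y) :
          Quiver.Hom (V := (⟨V⟩ : DualExt K B) ⟶ ⟨V'⟩) ⟨x⟩ ⟨y⟩ := ⟨α, 0⟩
      exact ((G.deformed_ahat_natural_iff φ (c τ) (c σ) (c η)).1 (hS.ahat_natural _ _ _)).symm
    · rintro ⟨X, Y, Z⟩
      exact (G.deformed_ahat_id_iff φ ⟨X⟩ ⟨Y⟩ ⟨Z⟩).1 (hS.ahat_id _ _ _)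
    · refine LinearMap.mem_ker.2 ?_
      funext ⟨X, Y, Z⟩ ⟨X', Y', Z'⟩ ⟨X'', Y'', Z''⟩ ⟨f, g, h⟩ ⟨f', g', h'⟩
      exact (G.deformed_ahat_comp_iff φ (X := ⟨X⟩) (X' := ⟨X'⟩) (X'' := ⟨X''⟩) (Y := ⟨Y⟩)
        (Y' := ⟨Y'⟩) (Y'' := ⟨Y''⟩) (Z := ⟨Z⟩) (Z' := ⟨Z'⟩) (Z'' := ⟨Z''⟩) ⟨f⟩ ⟨f'⟩ ⟨g⟩ ⟨g'⟩
        ⟨h⟩ ⟨h'⟩).1 (hS.ahat_comp _ _ _ _ _ _)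
    · refine LinearMap.mem_ker.2 ?_
      funext ⟨X, Y, Z, W⟩ ⟨X', Y', Z', W'⟩ ⟨f, g, h, k⟩
      exact (G.deformed_pi_natural_iff φ (X := ⟨X⟩) (X' := ⟨X'⟩) (Y := ⟨Y⟩) (Y' := ⟨Y'⟩)
        (Z := ⟨Z⟩) (Z' := ⟨Z'⟩) (W := ⟨W⟩) (W' := ⟨W'⟩) ⟨f⟩ ⟨g⟩ ⟨h⟩ ⟨k⟩).1 (hS.pi_natural _ _ _ _)
  · rintro ⟨⟨⟨hn, h1⟩, hh⟩, hv⟩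
    have hid (X Y Z : B) : G.triple φ (𝟙 X) (𝟙 Y) (𝟙 Z) = 0 := h1 (X, (Y, Z))
    have hS := G.gray.semigroupal
    exact
      { tens_natural := dual_tens_natural G.bilinear hS
        tens_assoc := dual_tens_assoc G.bilinear hS
        tens_id_right := dual_tens_id_right G.bilinear hS
        tens_id_left := dual_tens_id_left G.bilinear hS
        ahat_natural := fun {X X' Y Y' Z Z' f f₁ g g₁ h h₁} τ σ η =>
          (G.deformed_ahat_natural_iff φ τ σ η).2 (hn (X.obj, (Y.obj, Z.obj))
            (X'.obj, (Y'.obj, Z'.obj)) (f.hom, (g.hom, h.hom)) (f₁.hom, (g₁.hom, h₁.hom))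
            (τ.re, (σ.re, η.re))).symm
        ahat_comp := fun f f' g g' h h' => (G.deformed_ahat_comp_iff φ f f' g g' h h').2
          (congrFun (congrFun (congrFun (congrFun (congrFun (LinearMap.mem_ker.1 hh) _) _) _) _) _)
        ahat_id := fun X Y Z => (G.deformed_ahat_id_iff φ X Y Z).2 (hid _ _ _)
        pi_natural := fun f g h k => (G.deformed_pi_natural_iff φ f g h k).2
          (congrFun (congrFun (congrFun (LinearMap.mem_ker.1 hv) _) _) _)
        -- The `K₅` relation needs only the vanishing of `φ` at identities.
        pi_coherence := (G.deformed_cubical φ).pi_coherence (G.deformed_ahat_identity φ hid) }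

end GraySemigroup

end

/-! ### Semigroupal structures on the identity with identity 1-cells -/

namespace IsCubical

variable {C : Type u} [Bicategory.{w, v} C] [Bicategory.Strict C] {T : TensorCore C}
  {S S' : SemigroupalCells T}

theorem omegaNull_identity (hS : IsCubical T S) (X Y Z : C) : IsIdentity₂ (omegaNull S X Y Z).hom :=
  .comp (.whiskerRight (hS.unit_identity _ _) _) <| .comp (.leftUnitor_hom _) <|
    .comp (.leftUnitor_hom _) <| .comp (.rightUnitor_inv _) <|
    .whiskerLeft _ (.comp (.inv (hS.unit_identity _ _)) (.rightUnitor_inv _))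

variable {ψ : ∀ X Y : C, T.obj X Y ⟶ T.obj X Y}
  {ψhat : ∀ {X X' Y Y' : C} (f : X ⟶ X') (g : Y ⟶ Y'), ψ X Y ≫ T.map f g ≅ T.map f g ≫ ψ X' Y'}
  {ω : ∀ X Y Z : C, T.map (𝟙 X) (ψ Y Z) ≫ ψ X (T.obj Y Z) ≫ T.assoc X Y Z ≅
    T.assoc X Y Z ≫ T.map (ψ X Y) (𝟙 Z) ≫ ψ (T.obj X Y) Z}

theorem idOmega_identity (hS : IsCubical T S') (hω : ∀ X Y Z : C, IsIdentity₂ (ω X Y Z).hom)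
    (X Y Z W : C) : IsIdentity₂ (idOmega S' ψ ω X Y Z W) :=
  .comp (hS.tens₃_right _ _ _) <| .comp (.map₂ T (.id _) (hω _ _ _)) (.inv (hS.tens₃_right _ _ _))

theorem omegaId_identity (hS : IsCubical T S') (hω : ∀ X Y Z : C, IsIdentity₂ (ω X Y Z).hom)
    (X Y Z W : C) : IsIdentity₂ (omegaId S' ψ ω X Y Z W) :=
  .comp (hS.tens₃_left _ _ _) <| .comp (.map₂ T (hω _ _ _) (.id _)) (.inv (hS.tens₃_left _ _ _))

theorem chi_identity (hS : IsCubical T S) (hS' : IsCubical T S') (hψ : ∀ X Y : C, IsIdentity₁ (ψ X Y))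
    (hψhat : ∀ {X X' Y Y' : C} {f : X ⟶ X'} {g : Y ⟶ Y'}, IsIdentity₁ f → IsIdentity₁ g →
      IsIdentity₂ (ψhat f g).hom) (X Y Z W : C) :
    IsIdentity₂ (chi S S' ψ ψhat X Y Z W) :=
  .comp (hS'.tens_left _ _ _ (.id _)) <|
    .comp (.map₂ T (.comp (.inv (hψhat (.id _) (.id _))) (.whiskerLeft _ (hS.unit_identity _ _)))
      (.comp (.whiskerLeft _ (.inv (hS.unit_identity _ _))) (hψhat (.id _) (.id _))))
    (.inv (hS'.tens_left _ _ _ (hψ _ _)))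

/-- Every associator cell and every `ψhat` here is taken at identity 1-cells, since the 1-cells `ψ`
and `a` are identities. All factors are then identities, and the relation holds without any cocycle
condition. -/
theorem omega_coherence (hS : IsCubical T S) (hS' : IsCubical T S')
    (ha : ∀ {X X' Y Y' Z Z' : C} {f : X ⟶ X'} {g : Y ⟶ Y'} {h : Z ⟶ Z'}, IsIdentity₁ f →
      IsIdentity₁ g → IsIdentity₁ h → IsIdentity₂ (S'.ahat f g h).hom)
    (hψ : ∀ X Y : C, IsIdentity₁ (ψ X Y))
    (hψhat : ∀ {X X' Y Y' : C} {f : X ⟶ X'} {g : Y ⟶ Y'}, IsIdentity₁ f → IsIdentity₁ g →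
      IsIdentity₂ (ψhat f g).hom)
    (hω : ∀ X Y Z : C, IsIdentity₂ (ω X Y Z).hom) (X Y Z W : C) :
    𝟙 (T.map (𝟙 X) (T.map (𝟙 Y) (ψ Z W)) ≫ T.map (𝟙 X) (ψ Y (T.obj Z W)) ≫
          ψ X (T.obj Y (T.obj Z W)) ≫ T.map (𝟙 X) (T.assoc Y Z W) ≫ T.assoc X (T.obj Y Z) W ≫
          T.map (T.assoc X Y Z) (𝟙 W)) ⊗≫
        (T.map (𝟙 X) (T.map (𝟙 Y) (ψ Z W)) ≫ T.map (𝟙 X) (ψ Y (T.obj Z W)) ≫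
          ψ X (T.obj Y (T.obj Z W))) ◁ (S.pi X Y Z W).hom ⊗≫
        T.map (𝟙 X) (T.map (𝟙 Y) (ψ Z W)) ◁ (ω X Y (T.obj Z W)).hom ▷
          T.assoc (T.obj X Y) Z W ⊗≫
        (S'.ahat (𝟙 X) (𝟙 Y) (ψ Z W)).inv ▷
          (T.map (ψ X Y) (𝟙 (T.obj Z W)) ≫ ψ (T.obj X Y) (T.obj Z W) ≫
            T.assoc (T.obj X Y) Z W) ⊗≫
        T.assoc X Y (T.obj Z W) ◁ chi S S' ψ ψhat X Y Z W ▷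
          (ψ (T.obj X Y) (T.obj Z W) ≫ T.assoc (T.obj X Y) Z W) ⊗≫
        (T.assoc X Y (T.obj Z W) ≫ T.map (ψ X Y) (T.map (𝟙 Z) (𝟙 W))) ◁
          (ω (T.obj X Y) Z W).hom ⊗≫
        T.assoc X Y (T.obj Z W) ◁ (S'.ahat (ψ X Y) (𝟙 Z) (𝟙 W)).inv ▷
          (T.map (ψ (T.obj X Y) Z) (𝟙 W) ≫ ψ (T.obj (T.obj X Y) Z) W) ⊗≫
        𝟙 (T.assoc X Y (T.obj Z W) ≫ T.assoc (T.obj X Y) Z W ≫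
          T.map (T.map (ψ X Y) (𝟙 Z)) (𝟙 W) ≫ T.map (ψ (T.obj X Y) Z) (𝟙 W) ≫
          ψ (T.obj (T.obj X Y) Z) W) =
      𝟙 (T.map (𝟙 X) (T.map (𝟙 Y) (ψ Z W)) ≫ T.map (𝟙 X) (ψ Y (T.obj Z W)) ≫
          ψ X (T.obj Y (T.obj Z W)) ≫ T.map (𝟙 X) (T.assoc Y Z W) ≫ T.assoc X (T.obj Y Z) W ≫
          T.map (T.assoc X Y Z) (𝟙 W)) ⊗≫
        (T.map (𝟙 X) (T.map (𝟙 Y) (ψ Z W)) ≫ T.map (𝟙 X) (ψ Y (T.obj Z W))) ◁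
          (ψhat (𝟙 X) (T.assoc Y Z W)).hom ▷
          (T.assoc X (T.obj Y Z) W ≫ T.map (T.assoc X Y Z) (𝟙 W)) ⊗≫
        idOmega S' ψ ω X Y Z W ▷
          (ψ X (T.obj (T.obj Y Z) W) ≫ T.assoc X (T.obj Y Z) W ≫
            T.map (T.assoc X Y Z) (𝟙 W)) ⊗≫
        (T.map (𝟙 X) (T.assoc Y Z W) ≫ T.map (𝟙 X) (T.map (ψ Y Z) (𝟙 W))) ◁
          (ω X (T.obj Y Z) W).hom ▷ T.map (T.assoc X Y Z) (𝟙 W) ⊗≫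
        T.map (𝟙 X) (T.assoc Y Z W) ◁ (S'.ahat (𝟙 X) (ψ Y Z) (𝟙 W)).inv ▷
          (T.map (ψ X (T.obj Y Z)) (𝟙 W) ≫ ψ (T.obj X (T.obj Y Z)) W ≫
            T.map (T.assoc X Y Z) (𝟙 W)) ⊗≫
        (T.map (𝟙 X) (T.assoc Y Z W) ≫ T.assoc X (T.obj Y Z) W ≫
          T.map (T.map (𝟙 X) (ψ Y Z)) (𝟙 W) ≫ T.map (ψ X (T.obj Y Z)) (𝟙 W)) ◁
          (ψhat (T.assoc X Y Z) (𝟙 W)).hom ⊗≫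
        (T.map (𝟙 X) (T.assoc Y Z W) ≫ T.assoc X (T.obj Y Z) W) ◁
          omegaId S' ψ ω X Y Z W ▷ ψ (T.obj (T.obj X Y) Z) W ⊗≫
        (S'.pi X Y Z W).hom ▷
          (T.map (T.map (ψ X Y) (𝟙 Z)) (𝟙 W) ≫ T.map (ψ (T.obj X Y) Z) (𝟙 W) ≫
            ψ (T.obj (T.obj X Y) Z) W) ⊗≫
        𝟙 (T.assoc X Y (T.obj Z W) ≫ T.assoc (T.obj X Y) Z W ≫
          T.map (T.map (ψ X Y) (𝟙 Z)) (𝟙 W) ≫ T.map (ψ (T.obj X Y) Z) (𝟙 W) ≫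
          ψ (T.obj (T.obj X Y) Z) W) := by
  have hA := hS.assoc_identity
  refine IsIdentity₂.eq ?_ ?_
  · exact .bicategoricalComp (.id _) <|
      .bicategoricalComp (.whiskerLeft _ (hS.pi_identity _ _ _ _)) <|
      .bicategoricalComp (.whiskerLeft _ (.whiskerRight (hω _ _ _) _)) <|
      .bicategoricalComp (.whiskerRight (.inv (ha (.id _) (.id _) (hψ _ _))) _) <|
      .bicategoricalComp (.whiskerLeft _ (.whiskerRight (hS.chi_identity hS' hψ hψhat _ _ _ _) _)) <|
      .bicategoricalComp (.whiskerLeft _ (hω _ _ _)) <|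
      .bicategoricalComp (.whiskerLeft _ (.whiskerRight
        (.inv (ha (hψ _ _) (.id _) (.id _))) _)) (.id _)
  · exact .bicategoricalComp (.id _) <|
      .bicategoricalComp (.whiskerLeft _ (.whiskerRight (hψhat (.id _) (hA _ _ _)) _)) <|
      .bicategoricalComp (.whiskerRight (hS'.idOmega_identity hω _ _ _ _) _) <|
      .bicategoricalComp (.whiskerLeft _ (.whiskerRight (hω _ _ _) _)) <|
      .bicategoricalComp (.whiskerLeft _ (.whiskerRight
        (.inv (ha (.id _) (hψ _ _) (.id _))) _)) <|
      .bicategoricalComp (.whiskerLeft _ (hψhat (hA _ _ _) (.id _))) <|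
      .bicategoricalComp (.whiskerLeft _ (.whiskerRight (hS'.omegaId_identity hω _ _ _ _) _)) <|
      .bicategoricalComp (.whiskerRight (hS'.pi_identity _ _ _ _) _) (.id _)

/-- The six nontrivial cells live on differently bracketed 1-cells. Representing each by an
endomorphism of a single `F` leaves an equation between two threefold composites, which
`oneAdd_hexagon_iff` linearises. -/
theorem omega_natural_iff (hS' : IsCubical T S') (hψ : ∀ X Y : C, IsIdentity₁ (ψ X Y))
    (hω : ∀ X Y Z : C, IsIdentity₂ (ω X Y Z).hom) {X X' Y Y' Z Z' : C} (f : X ⟶ X') (g : Y ⟶ Y')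
    (h : Z ⟶ Z') {V V' : C} {F : V ⟶ V'} {a₁ a₂ a₃ b₁ b₂ b₃ : F ⟶ F}
    (ha₁ : Sim (S.ahat f g h).hom a₁) (ha₂ : Sim (ψhat f (T.map g h)).hom a₂)
    (ha₃ : Sim (T.map₂ ((λ_ f).hom ≫ (ρ_ f).inv) (ψhat g h).hom) a₃)
    (hb₁ : Sim (ψhat (T.map f g) h).hom b₁)
    (hb₂ : Sim (T.map₂ (ψhat f g).hom ((λ_ h).hom ≫ (ρ_ h).inv)) b₂)
    (hb₃ : Sim (S'.ahat f g h).hom b₃) :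
    𝟙 ((T.map (𝟙 X) (ψ Y Z) ≫ ψ X (T.obj Y Z) ≫ T.assoc X Y Z) ≫ T.map (T.map f g) h) ⊗≫
        (T.map (𝟙 X) (ψ Y Z) ≫ ψ X (T.obj Y Z)) ◁ (S.ahat f g h).hom ⊗≫
        T.map (𝟙 X) (ψ Y Z) ◁ (ψhat f (T.map g h)).hom ▷ T.assoc X' Y' Z' ⊗≫
        ((S'.tens (𝟙 X) f (ψ Y Z) (T.map g h)).hom ≫
            T.map₂ ((λ_ f).hom ≫ (ρ_ f).inv) (ψhat g h).hom ≫
            (S'.tens f (𝟙 X') (T.map g h) (ψ Y' Z')).inv) ▷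
          (ψ X' (T.obj Y' Z') ≫ T.assoc X' Y' Z') ⊗≫
        T.map f (T.map g h) ◁ (ω X' Y' Z').hom =
      (ω X Y Z).hom ▷ T.map (T.map f g) h ⊗≫
        (T.assoc X Y Z ≫ T.map (ψ X Y) (𝟙 Z)) ◁ (ψhat (T.map f g) h).hom ⊗≫
        T.assoc X Y Z ◁
          ((S'.tens (ψ X Y) (T.map f g) (𝟙 Z) h).hom ≫
            T.map₂ (ψhat f g).hom ((λ_ h).hom ≫ (ρ_ h).inv) ≫
            (S'.tens (T.map f g) (ψ X' Y') h (𝟙 Z')).inv) ▷ ψ (T.obj X' Y') Z' ⊗≫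
        (S'.ahat f g h).hom ▷ (T.map (ψ X' Y') (𝟙 Z') ≫ ψ (T.obj X' Y') Z') ⊗≫
        𝟙 (T.map f (T.map g h) ≫
          T.assoc X' Y' Z' ≫ T.map (ψ X' Y') (𝟙 Z') ≫ ψ (T.obj X' Y') Z') ↔
      a₁ ≫ a₂ ≫ a₃ = b₁ ≫ b₂ ≫ b₃ := by
  have hA := hS'.assoc_identity
  have hM (X Y Z : C) : IsIdentity₁ (T.map (ψ X Y) (𝟙 Z)) := hS'.map_id (hψ _ _) (.id _)
  have hM' (X Y Z : C) : IsIdentity₁ (T.map (𝟙 X) (ψ Y Z)) := hS'.map_id (.id _) (hψ _ _)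
  exact Sim.eq_iff
    (.triv_bicategoricalComp (.id _) <|
      .bicategoricalComp (sim_whiskerLeft (.comp (hM' _ _ _) (hψ _ _)) ha₁) <|
      .bicategoricalComp (sim_whiskerLeft (hM' _ _ _) (sim_whiskerRight ha₂ (hA _ _ _))) <|
      .bicategoricalComp_triv (sim_whiskerRight (.triv_comp (hS'.tens_right _ _ _ (.id _))
        (.comp_triv ha₃ (.inv (hS'.tens_left _ _ _ (hψ _ _))))) (.comp (hψ _ _) (hA _ _ _)))
        (.whiskerLeft _ (hω _ _ _)))
    (.triv_bicategoricalComp (.whiskerRight (hω _ _ _) _) <|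
      .bicategoricalComp (sim_whiskerLeft (.comp (hA _ _ _) (hM _ _ _)) hb₁) <|
      .bicategoricalComp (sim_whiskerLeft (hA _ _ _) (sim_whiskerRight
        (.triv_comp (hS'.tens_right _ _ _ (hψ _ _))
          (.comp_triv hb₂ (.inv (hS'.tens_left _ _ _ (.id _))))) (hψ _ _))) <|
      .bicategoricalComp_triv (sim_whiskerRight hb₃ (.comp (hM _ _ _) (hψ _ _))) (.id _))

end IsCubical

/-! ### Pseudonatural isomorphisms given by 1-cochains -/

namespace GraySemigroup

variable {K : Type*} [CommRing K] {B : Type u} [Bicategory.{w, v} B]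
  [∀ X Y : B, Preadditive (X ⟶ Y)] [∀ X Y : B, Linear K (X ⟶ Y)] [LinearBicategory K B]
  (G : GraySemigroup K B)

/-- The component of a family at a pair of 1-cells, as a 2-cell of the extension. -/
def cell₂ (θ : G.Family₀ 1) {X X' Y Y' : DualExt K B} (f : X ⟶ X') (g : Y ⟶ Y') :
    G.dualCore.map f g ⟶ G.dualCore.map f g :=
  oneAdd (G.pair θ f.hom g.hom)

/-- The 2-isomorphisms of the pseudonatural isomorphism `ψ` defined by the family `θ`. -/
def psiCells (θ : G.Family₀ 1) {X X' Y Y' : DualExt K B} (f : X ⟶ X') (g : Y ⟶ Y') :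
    𝟙 (G.dualCore.obj X Y) ≫ G.dualCore.map f g ≅ G.dualCore.map f g ≫ 𝟙 (G.dualCore.obj X' Y') :=
  λ_ _ ≪≫ oneAddIso (G.pair θ f.hom g.hom) ≪≫ (ρ_ _).symm

variable [Bicategory.Strict B] (φ φ' : G.Family₀ 2) (θ : G.Family₀ 1)

theorem sim_psi {X X' Y Y' : DualExt K B} (f : X ⟶ X') (g : Y ⟶ Y') :
    Sim (G.psiCells θ f g).hom (G.cell₂ θ f g) :=
  .triv_comp (.leftUnitor_hom _) (.comp_triv (.refl _) (.rightUnitor_inv _))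

theorem psi_natural_iff {X X' Y Y' : DualExt K B} {f f₁ : X ⟶ X'} {g g₁ : Y ⟶ Y'} (τ : f ⟶ f₁)
    (σ : g ⟶ g₁) :
    (G.psiCells θ f g).hom ≫ G.dualCore.map₂ τ σ ▷ 𝟙 (G.dualCore.obj X' Y') =
        𝟙 (G.dualCore.obj X Y) ◁ G.dualCore.map₂ τ σ ≫ (G.psiCells θ f₁ g₁).hom ↔
      G.pair θ f.hom g.hom ≫ G.core.map₂ τ.re σ.re =
        G.core.map₂ τ.re σ.re ≫ G.pair θ f₁.hom g₁.hom :=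
  (Sim.eq_iff (.comp (G.sim_psi θ f g) (sim_whiskerRight (.refl _) (.id _)))
    (.comp (sim_whiskerLeft (.id _) (.refl _)) (G.sim_psi θ f₁ g₁))).trans oneAdd_comp_eq_iff

/-- The interchangers are not deformed, so both structures contribute the same constant cell `t` and
the axiom does not depend on `φ` or `φ'`. -/
theorem psi_comp_iff {X X' X'' Y Y' Y'' : DualExt K B} (f : X ⟶ X') (f' : X' ⟶ X'') (g : Y ⟶ Y')
    (g' : Y' ⟶ Y'') :
    𝟙 (G.dualCore.obj X Y) ◁ ((G.deformedCells φ).tens f f' g g').hom ≫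
          (G.psiCells θ (f ≫ f') (g ≫ g')).hom =
        (α_ _ _ _).inv ≫ (G.psiCells θ f g).hom ▷ G.dualCore.map f' g' ≫ (α_ _ _ _).hom ≫
          G.dualCore.map f g ◁ (G.psiCells θ f' g').hom ≫ (α_ _ _ _).inv ≫
          ((G.deformedCells φ').tens f f' g g').hom ▷ 𝟙 (G.dualCore.obj X'' Y'') ↔
      G.δh 1 θ (X.obj, Y.obj) (X'.obj, Y'.obj) (X''.obj, Y''.obj) (f.hom, g.hom)
        (f'.hom, g'.hom) = 0 := by
  refine (Sim.eq_iff (.comp (sim_whiskerLeft (.id _) (.refl _)) (G.sim_psi θ (f ≫ f') (g ≫ g')))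
    (.triv_comp (.associator_inv _ _ _) <|
    .comp (.whiskerRight (G.sim_psi θ f g) rfl) <|
    .triv_comp (.associator_hom _ _ _) <|
    .comp (.whiskerLeft rfl (G.sim_psi θ f' g')) <|
    .triv_comp (.associator_inv _ _ _) <|
    sim_whiskerRight (.refl _) (.id _))).trans ?_
  rw [δh_one]
  exact oneAdd_icon_iff (t := (G.dualCells.tens f f' g g').hom) rfl (G.pair θ f.hom g.hom)
    (G.pair θ f'.hom g'.hom) (G.pair θ (f.hom ≫ f'.hom) (g.hom ≫ g'.hom))

theorem psi_id_iff (X Y : DualExt K B) :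
    (G.psiCells θ (𝟙 X) (𝟙 Y)).hom =
        𝟙 (G.dualCore.obj X Y) ◁ ((G.deformedCells φ).unit X Y).hom ≫ (ρ_ _).hom ≫ (λ_ _).inv ≫
          ((G.deformedCells φ').unit X Y).inv ▷ 𝟙 (G.dualCore.obj X Y) ↔
      G.pair θ (𝟙 X.obj) (𝟙 Y.obj) = 0 := by
  have hU := G.dual_cubical.unit_identity
  refine (Sim.eq_iff (G.sim_psi θ (𝟙 X) (𝟙 Y)) (IsIdentity₂.sim_id
    (.comp (.whiskerLeft _ (hU X Y)) <| .comp (.rightUnitor_hom _) <| .comp (.leftUnitor_inv _)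
      (.whiskerRight (.inv (hU X Y)) _))
    ((IsIdentity₁.id _).total_comp_left _))).trans ?_
  exact oneAdd_inj (b := 0)

theorem psi_identity (hθ : ∀ X Y : B, G.pair θ (𝟙 X) (𝟙 Y) = 0) {X X' Y Y' : DualExt K B}
    {f : X ⟶ X'} {g : Y ⟶ Y'} (hf : IsIdentity₁ f) (hg : IsIdentity₁ g) :
    IsIdentity₂ (G.psiCells θ f g).hom := by
  obtain ⟨rfl, rfl⟩ := hf
  obtain ⟨rfl, rfl⟩ := hg
  refine .of_sim (G.sim_psi θ _ _) (.dual (.id _) ?_)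
  exact hθ X.obj Y.obj

/-- The pseudonaturality axioms of `1 + θ ε` give membership in `X¹_ass`, and the modification axiom
of `ω` compares the two associators. The normalisation of `φ'` enters only in the coherence relation
for `ω`, which contains the target associator at identities. -/
theorem psi_structure_iff (hφ' : ∀ X Y Z : B, G.triple φ' (𝟙 X) (𝟙 Y) (𝟙 Z) = 0) :
    IsSemigroupalStructureOnId (G.deformedCells φ) (G.deformedCells φ') (fun _ _ => 𝟙 _)
        (G.psiCells θ) (omegaNull G.dualCells) ↔
      θ ∈ G.Xass 1 ∧ φ + G.δv 1 θ = φ' := by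
  have hC := G.deformed_cubical φ
  have hC' := G.deformed_cubical φ'
  have hω := G.dual_cubical.omegaNull_identity
  have hU {V V' : DualExt K B} (x : V ⟶ V') : Sim ((λ_ x).hom ≫ (ρ_ x).inv) (𝟙 x) :=
    IsIdentity₂.sim_id (.comp (.leftUnitor_hom x) (.rightUnitor_inv x))
      ((IsIdentity₁.id V).total_comp_left x)
  -- The modification axiom at each triple: the four cells built from `ψhat` supply the four faces
  -- in `δv θ`, and the two associators supply `φ` and `φ'`.
  have key {X X' Y Y' Z Z' : DualExt K B} (f : X ⟶ X') (g : Y ⟶ Y') (h : Z ⟶ Z') := by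
    let q : TupHom 2 (X.obj, (Y.obj, Z.obj)) (X'.obj, (Y'.obj, Z'.obj)) :=
      (f.hom, (g.hom, h.hom))
    let F : G.dualCore.obj X (G.dualCore.obj Y Z) ⟶ _ := G.dualCore.map f (G.dualCore.map g h)
    have h₁ : Sim (G.psiCells θ f (G.dualCore.map g h)).hom
        (oneAdd (transport (total_merge G.gray 1 1 q) (θ _ _ (G.core.mergeHom 1 1 q))) : F ⟶ F) :=
      (G.sim_psi θ _ _).trans (sim_oneAdd_transport _ _)
    have h₂ : Sim (G.dualCore.map₂ ((λ_ f).hom ≫ (ρ_ f).inv) (G.psiCells θ g h).hom)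
        (oneAdd (G.oneTensor θ q) : F ⟶ F) :=
      (Sim.map₂ _ (hU f) (G.sim_psi θ _ _)).trans (Sim.of_eq (map₂_id_oneAdd G.bilinear _ _))
    have h₃ : Sim (G.psiCells θ (G.dualCore.map f g) h).hom
        (oneAdd (transport (total_merge G.gray 1 0 q) (θ _ _ (G.core.mergeHom 1 0 q))) : F ⟶ F) :=
      (G.sim_psi θ _ _).trans (sim_oneAdd_transport _ _)
    have h₄ : Sim (G.dualCore.map₂ (G.psiCells θ f g).hom ((λ_ h).hom ≫ (ρ_ h).inv))
        (oneAdd (transport (total_init G.gray 1 q)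
          (G.core.map₂ (θ _ _ (tupHomInit 1 q)) (𝟙 (tupHomLast 1 q)))) : F ⟶ F) :=
      (Sim.map₂ _ (G.sim_psi θ _ _) (hU h)).trans
        ((Sim.of_eq (map₂_oneAdd_id G.bilinear _ _)).trans (sim_oneAdd_transport _ _))
    exact (hC'.omega_natural_iff (S := G.deformedCells φ) (ψ := fun _ _ => 𝟙 _)
      (ψhat := G.psiCells θ) (fun _ _ => .id _) hω f g h (G.sim_ahat φ f g h) h₁ h₂ h₃ h₄
      (G.sim_ahat φ' f g h)).trans ((oneAdd_hexagon_iff).trans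
        (Eq.congr_left (congrArg (G.triple φ f.hom g.hom h.hom + ·) (G.δv_one θ _ _ q).symm)))
  constructor
  · intro hS
    refine ⟨⟨⟨?_, ?_⟩, ?_⟩, ?_⟩
    · rintro ⟨X, Y⟩ ⟨X', Y'⟩ ⟨f, g⟩ ⟨f₁, g₁⟩ ⟨τ, σ⟩
      let c {V V' : B} {x y : V ⟶ V'} (α : x ⟶ y) :
          Quiver.Hom (V := (⟨V⟩ : DualExt K B) ⟶ ⟨V'⟩) ⟨x⟩ ⟨y⟩ := ⟨α, 0⟩
      exact ((G.psi_natural_iff θ (c τ) (c σ)).1 (hS.psi_natural _ _)).symm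
    · rintro ⟨X, Y⟩
      exact (G.psi_id_iff φ φ' θ ⟨X⟩ ⟨Y⟩).1 (hS.psi_id _ _)
    · refine LinearMap.mem_ker.2 ?_
      funext ⟨X, Y⟩ ⟨X', Y'⟩ ⟨X'', Y''⟩ ⟨f, g⟩ ⟨f', g'⟩
      exact (G.psi_comp_iff φ φ' θ (X := ⟨X⟩) (X' := ⟨X'⟩) (X'' := ⟨X''⟩) (Y := ⟨Y⟩)
        (Y' := ⟨Y'⟩) (Y'' := ⟨Y''⟩) ⟨f⟩ ⟨f'⟩ ⟨g⟩ ⟨g'⟩).1 (hS.psi_comp _ _ _ _)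
    · funext ⟨X, Y, Z⟩ ⟨X', Y', Z'⟩ ⟨f, g, h⟩
      exact (key (X := ⟨X⟩) (X' := ⟨X'⟩) (Y := ⟨Y⟩) (Y' := ⟨Y'⟩)
        (Z := ⟨Z⟩) (Z' := ⟨Z'⟩) ⟨f⟩ ⟨g⟩ ⟨h⟩).1 (hS.omega_natural _ _ _)
  · rintro ⟨⟨⟨hn, h1⟩, hh⟩, hv⟩
    have hid (X Y : B) : G.pair θ (𝟙 X) (𝟙 Y) = 0 := h1 (X, Y)
    exact
      { psi_iso := fun X Y => ⟨𝟙 _, Strict.id_comp _, Strict.id_comp _⟩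
        psi_natural := fun {X X' Y Y' f f₁ g g₁} τ σ => (G.psi_natural_iff θ τ σ).2
          (hn (X.obj, Y.obj) (X'.obj, Y'.obj) (f.hom, g.hom) (f₁.hom, g₁.hom) (τ.re, σ.re)).symm
        psi_comp := fun f f' g g' => (G.psi_comp_iff φ φ' θ f f' g g').2
          (congrFun (congrFun (congrFun (congrFun (congrFun (LinearMap.mem_ker.1 hh) _) _) _) _) _)
        psi_id := fun X Y => (G.psi_id_iff φ φ' θ X Y).2 (hid _ _)
        omega_natural := fun {X X' Y Y' Z Z'} f g h => (key f g h).2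
          (congrFun (congrFun (congrFun hv (X.obj, (Y.obj, Z.obj))) (X'.obj, (Y'.obj, Z'.obj)))
            (f.hom, (g.hom, h.hom)))
        omega_coherence := hC.omega_coherence hC' (G.deformed_ahat_identity φ' hφ')
          (fun _ _ => .id _) (G.psi_identity θ hid) hω }

end GraySemigroup

/-! ### Naturality of the interchangers and additivity lemmas -/

namespace SemigroupalCells.IsSemigroupal

variable {B : Type u} [Bicategory.{w, v} B] {T : TensorCore B} {S : SemigroupalCells T}

theorem whiskerLeft_tens (hS : S.IsSemigroupal) {X X' X'' Y Y' Y'' : B} (f : X ⟶ X')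
    {f' f₁' : X' ⟶ X''} (g : Y ⟶ Y') {g' g₁' : Y' ⟶ Y''} (τ : f' ⟶ f₁') (σ : g' ⟶ g₁') :
    T.map f g ◁ T.map₂ τ σ ≫ (S.tens f f₁' g g₁').hom =
      (S.tens f f' g g').hom ≫ T.map₂ (f ◁ τ) (g ◁ σ) := by
  simpa [hcomp, T.map₂_id] using hS.tens_natural (𝟙 f) τ (𝟙 g) σ

theorem whiskerRight_tens (hS : S.IsSemigroupal) {X X' X'' Y Y' Y'' : B} {f f₁ : X ⟶ X'}
    (f' : X' ⟶ X'') {g g₁ : Y ⟶ Y'} (g' : Y' ⟶ Y'') (τ : f ⟶ f₁) (σ : g ⟶ g₁) :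
    T.map₂ τ σ ▷ T.map f' g' ≫ (S.tens f₁ f' g₁ g').hom =
      (S.tens f f' g g').hom ≫ T.map₂ (τ ▷ f') (σ ▷ g') := by
  simpa [hcomp, T.map₂_id] using hS.tens_natural τ (𝟙 f') σ (𝟙 g')

end SemigroupalCells.IsSemigroupal

section

variable {K : Type*} [CommRing K] {B : Type u} [Bicategory.{w, v} B]
  [∀ X Y : B, Preadditive (X ⟶ Y)] [∀ X Y : B, Linear K (X ⟶ Y)]

theorem transport_sub {X Y X' Y' : B} {f : X ⟶ Y} {f' : X' ⟶ Y'} (h : total f = total f')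
    (α β : f ⟶ f) : transport h (α - β) = transport h α - transport h β := by
  cases h
  rfl

theorem TensorCore.IsBilinear.map₂_sub {T : TensorCore B} (hT : T.IsBilinear K) {X X' Y Y' : B}
    {f f' : X ⟶ X'} {g g' : Y ⟶ Y'} (α : f ⟶ f') (β γ : g ⟶ g') :
    T.map₂ α (β - γ) = T.map₂ α β - T.map₂ α γ :=
  (AddMonoidHom.mk' (T.map₂ α) (hT.map₂_add α)).map_sub β γ

theorem TensorCore.IsBilinear.sub_map₂ {T : TensorCore B} (hT : T.IsBilinear K) {X X' Y Y' : B}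
    {f f' : X ⟶ X'} {g g' : Y ⟶ Y'} (α β : f ⟶ f') (γ : g ⟶ g') :
    T.map₂ (α - β) γ = T.map₂ α γ - T.map₂ β γ :=
  (AddMonoidHom.mk' (fun δ => T.map₂ δ γ) (fun δ δ' => hT.add_map₂ δ δ' γ)).map_sub α β

theorem whiskerLeft_sub' [LinearBicategory K B] {X Y Z : B} (f : X ⟶ Y) {g h : Y ⟶ Z}
    (α β : g ⟶ h) : f ◁ (α - β) = f ◁ α - f ◁ β :=
  (AddMonoidHom.mk' (f ◁ · : (g ⟶ h) → _)
    (LinearBicategory.whiskerLeft_add (K := K) f)).map_sub α β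

theorem sub_whiskerRight' [LinearBicategory K B] {X Y Z : B} {f g : X ⟶ Y} (α β : f ⟶ g)
    (h : Y ⟶ Z) : (α - β) ▷ h = α ▷ h - β ▷ h :=
  (AddMonoidHom.mk' (fun γ : f ⟶ g => γ ▷ h)
    (fun γ γ' => LinearBicategory.add_whiskerRight (K := K) γ γ' h)).map_sub α β

end

/-! ### Faces of a 1-cochain and the square of the vertical coboundary -/

namespace GraySemigroup

variable {K : Type*} [CommRing K] {B : Type u} [Bicategory.{w, v} B]
  [∀ X Y : B, Preadditive (X ⟶ Y)] [∀ X Y : B, Linear K (X ⟶ Y)]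
  (G : GraySemigroup K B) [Bicategory.Strict B]

section

variable {X X' Y Y' Z Z' : B}

/-- The face `1 ⊗ θ(g, h)` of a family. -/
def face₀ (θ : G.Family₀ 1) (f : X ⟶ X') (g : Y ⟶ Y') (h : Z ⟶ Z') :
    G.core.map f (G.core.map g h) ⟶ G.core.map f (G.core.map g h) :=
  G.core.map₂ (𝟙 f) (G.pair θ g h)

/-- The face `θ(f ⊗ g, h)` of a family. -/
def face₁ (θ : G.Family₀ 1) (f : X ⟶ X') (g : Y ⟶ Y') (h : Z ⟶ Z') :
    G.core.map f (G.core.map g h) ⟶ G.core.map f (G.core.map g h) :=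
  transport (total_assoc G.gray f g h) (G.pair θ (G.core.map f g) h)

/-- The face `θ(f, g ⊗ h)` of a family. -/
def face₂ (θ : G.Family₀ 1) (f : X ⟶ X') (g : Y ⟶ Y') (h : Z ⟶ Z') :
    G.core.map f (G.core.map g h) ⟶ G.core.map f (G.core.map g h) :=
  G.pair θ f (G.core.map g h)

/-- The face `θ(f, g) ⊗ 1` of a family. -/
def face₃ (θ : G.Family₀ 1) (f : X ⟶ X') (g : Y ⟶ Y') (h : Z ⟶ Z') :
    G.core.map f (G.core.map g h) ⟶ G.core.map f (G.core.map g h) :=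
  transport (total_assoc G.gray f g h) (G.core.map₂ (G.pair θ f g) (𝟙 h))

variable (θ : G.Family₀ 1) (f : X ⟶ X') (g : Y ⟶ Y') (h : Z ⟶ Z')

theorem triple_δv : G.triple (G.δv 1 θ) f g h =
    G.face₀ θ f g h - G.face₁ θ f g h + G.face₂ θ f g h - G.face₃ θ f g h :=
  G.δv_one θ (X, (Y, Z)) (X', (Y', Z')) (f, (g, h))

theorem sim_face₁ : Sim (G.pair θ (G.core.map f g) h) (G.face₁ θ f g h) := sim_transport _ _

theorem sim_face₃ : Sim (G.core.map₂ (G.pair θ f g) (𝟙 h)) (G.face₃ θ f g h) := sim_transport _ _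

/-- Needed when the arguments of a family are rebracketed: the resulting 1-cells are equal, but not
by definition. -/
theorem sim_pair {V V' W W' : B} {x : X ⟶ X'} {x' : V ⟶ V'} {y : Y ⟶ Y'} {y' : W ⟶ W'}
    (hx : total x = total x') (hy : total y = total y') :
    Sim (G.pair θ x y) (G.pair θ x' y') := by
  cases hx
  cases hy
  exact .refl _

end

theorem pair_identity {θ : G.Family₀ 1} (hθ : ∀ X Y : B, G.pair θ (𝟙 X) (𝟙 Y) = 0)
    {X X' Y Y' : B} {f : X ⟶ X'} {g : Y ⟶ Y'} (hf : IsIdentity₁ f) (hg : IsIdentity₁ g) :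
    G.pair θ f g = 0 := by
  obtain ⟨rfl, rfl⟩ := hf
  obtain ⟨rfl, rfl⟩ := hg
  exact hθ X Y

theorem transport_zero {X Y X' Y' : B} {f : X ⟶ Y} {f' : X' ⟶ Y'} (h : total f = total f') :
    transport h (0 : f ⟶ f) = 0 := by
  cases h
  rfl

theorem triple_δv_id {θ : G.Family₀ 1} (hθ : ∀ X Y : B, G.pair θ (𝟙 X) (𝟙 Y) = 0) (X Y Z : B) :
    G.triple (G.δv 1 θ) (𝟙 X) (𝟙 Y) (𝟙 Z) = 0 := by
  have hM (X Y : B) := G.gray.isCubical.map_id (.id X) (.id Y)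
  simp only [triple_δv, face₀, face₁, face₂, face₃, G.pair_identity hθ (.id _) (.id _),
    G.pair_identity hθ (hM _ _) (.id _), G.pair_identity hθ (.id _) (hM _ _),
    G.bilinear.map₂_zero, G.bilinear.zero_map₂, transport_zero, sub_zero, add_zero]

section

variable {θ : G.Family₀ 1}
  (hθ : ∀ {X X' Y Y' : B} {f f₁ : X ⟶ X'} {g g₁ : Y ⟶ Y'} (τ : f ⟶ f₁) (σ : g ⟶ g₁),
    G.core.map₂ τ σ ≫ G.pair θ f₁ g₁ = G.pair θ f g ≫ G.core.map₂ τ σ)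
  {X X' Y Y' Z Z' : B} {f f₁ : X ⟶ X'} {g g₁ : Y ⟶ Y'}
  {h h₁ : Z ⟶ Z'} (τ : f ⟶ f₁) (σ : g ⟶ g₁) (η : h ⟶ h₁)
include hθ

/-- Each face is natural by itself: the outer ones by functoriality of `⊗`, the inner ones by
naturality of `θ` at a tensor product of 2-cells. -/
theorem triple_δv_natural :
    G.core.map₂ τ (G.core.map₂ σ η) ≫ G.triple (G.δv 1 θ) f₁ g₁ h₁ =
      G.triple (G.δv 1 θ) f g h ≫ G.core.map₂ τ (G.core.map₂ σ η) := by
  have hs := G.gray.sim_map₂_assoc τ σ η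
  have e₀ : G.core.map₂ τ (G.core.map₂ σ η) ≫ G.face₀ θ f₁ g₁ h₁ =
      G.face₀ θ f g h ≫ G.core.map₂ τ (G.core.map₂ σ η) := by
    rw [face₀, face₀, ← G.core.map₂_comp, ← G.core.map₂_comp, hθ, Category.comp_id,
      Category.id_comp]
  have e₁ : G.core.map₂ τ (G.core.map₂ σ η) ≫ G.face₁ θ f₁ g₁ h₁ =
      G.face₁ θ f g h ≫ G.core.map₂ τ (G.core.map₂ σ η) :=
    (Sim.eq_iff (hs.comp (G.sim_face₁ θ _ _ _)) ((G.sim_face₁ θ _ _ _).comp hs)).1 (hθ _ _)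
  have e₂ : G.core.map₂ τ (G.core.map₂ σ η) ≫ G.face₂ θ f₁ g₁ h₁ =
      G.face₂ θ f g h ≫ G.core.map₂ τ (G.core.map₂ σ η) := hθ τ (G.core.map₂ σ η)
  have e₃ : G.core.map₂ τ (G.core.map₂ σ η) ≫ G.face₃ θ f₁ g₁ h₁ =
      G.face₃ θ f g h ≫ G.core.map₂ τ (G.core.map₂ σ η) := by
    refine (Sim.eq_iff (hs.comp (G.sim_face₃ θ _ _ _)) ((G.sim_face₃ θ _ _ _).comp hs)).1 ?_
    rw [← G.core.map₂_comp, ← G.core.map₂_comp, hθ, Category.comp_id, Category.id_comp]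
  simp only [triple_δv, Preadditive.comp_add, Preadditive.comp_sub, Preadditive.add_comp,
    Preadditive.sub_comp, e₀, e₁, e₂, e₃]

end

theorem total_assoc₄ {X X' Y Y' Z Z' W W' : B} (f : X ⟶ X') (g : Y ⟶ Y') (h : Z ⟶ Z')
    (k : W ⟶ W') : total (G.core.map (G.core.map f (G.core.map g h)) k) =
      total (G.core.map f (G.core.map g (G.core.map h k))) :=
  (total_assoc G.gray f _ k).trans (total_map G.core rfl (total_assoc G.gray g h k))

theorem δv_two_apply (φ : G.Family₀ 2) {X X' Y Y' Z Z' W W' : B} (f : X ⟶ X') (g : Y ⟶ Y')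
    (h : Z ⟶ Z') (k : W ⟶ W') :
    G.δv 2 φ (X, (Y, (Z, W))) (X', (Y', (Z', W'))) (f, (g, (h, k))) =
      G.core.map₂ (𝟙 f) (G.triple φ g h k) -
        transport (total_assoc G.gray f g (G.core.map h k)) (G.triple φ (G.core.map f g) h k) +
        transport (total_map G.core rfl (total_assoc G.gray g h k))
          (G.triple φ f (G.core.map g h) k) -
        G.triple φ f g (G.core.map h k) +
        transport (G.total_assoc₄ f g h k) (G.core.map₂ (G.triple φ f g h) (𝟙 k)) :=
  G.δv_two φ (X, (Y, (Z, W))) (X', (Y', (Z', W'))) (f, (g, (h, k)))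

/-- Each of the five faces of `δv θ` expands into four terms. The twenty terms cancel in pairs by
the simplicial identities, which hold because `⊗` is strictly associative on 1-cells and 2-cells. -/
theorem δv_δv_apply (θ : G.Family₀ 1) {X X' Y Y' Z Z' W W' : B} (f : X ⟶ X') (g : Y ⟶ Y')
    (h : Z ⟶ Z') (k : W ⟶ W') :
    G.δv 2 (G.δv 1 θ) (X, (Y, (Z, W))) (X', (Y', (Z', W'))) (f, (g, (h, k))) = 0 := by
  refine (G.δv_two_apply (G.δv 1 θ) f g h k).trans ?_
  change _ = (0 : G.core.map f (G.core.map g (G.core.map h k)) ⟶ _)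
  simp only [triple_δv, transport_sub, transport_add, G.bilinear.map₂_sub, G.bilinear.map₂_add,
    G.bilinear.sub_map₂, G.bilinear.add_map₂]
  -- The ten equations `e₁` to `e₁₀` are the simplicial identities; each matches two terms that
  -- occur with opposite signs.
  have e₁ : transport (total_assoc G.gray f g (G.core.map h k))
      (G.face₀ θ (G.core.map f g) h k) = G.core.map₂ (𝟙 f) (G.face₀ θ g h k) := by
    refine ((sim_transport _ _).symm.trans ?_).eq
    rw [face₀, ← G.core.map₂_id]
    exact G.gray.sim_map₂_assoc _ _ _
  have e₂ : transport (total_map G.core rfl (total_assoc G.gray g h k))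
      (G.face₀ θ f (G.core.map g h) k) = G.core.map₂ (𝟙 f) (G.face₁ θ g h k) :=
    ((sim_transport _ _).symm.trans (Sim.map₂ _ (.refl _) (G.sim_face₁ θ _ _ _))).eq
  have e₃ : G.face₀ θ f g (G.core.map h k) = G.core.map₂ (𝟙 f) (G.face₂ θ g h k) := rfl
  have e₄ : transport (G.total_assoc₄ f g h k) (G.core.map₂ (G.face₀ θ f g h) (𝟙 k)) =
      G.core.map₂ (𝟙 f) (G.face₃ θ g h k) :=
    ((sim_transport _ _).symm.trans ((G.gray.sim_map₂_assoc _ _ _).trans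
      (Sim.map₂ _ (.refl _) (G.sim_face₃ θ _ _ _)))).eq
  have e₅ : transport (total_map G.core rfl (total_assoc G.gray g h k))
      (G.face₁ θ f (G.core.map g h) k) =
        transport (total_assoc G.gray f g (G.core.map h k)) (G.face₁ θ (G.core.map f g) h k) :=
    ((sim_transport _ _).symm.trans ((G.sim_face₁ θ _ _ _).symm.trans
      ((G.sim_pair θ (total_assoc G.gray f g h).symm rfl).trans
        ((G.sim_face₁ θ _ _ _).trans (sim_transport _ _))))).eq
  have e₆ : G.face₁ θ f g (G.core.map h k) =
      transport (total_assoc G.gray f g (G.core.map h k)) (G.face₂ θ (G.core.map f g) h k) := rfl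
  have e₇ : transport (G.total_assoc₄ f g h k) (G.core.map₂ (G.face₁ θ f g h) (𝟙 k)) =
      transport (total_assoc G.gray f g (G.core.map h k)) (G.face₃ θ (G.core.map f g) h k) :=
    ((sim_transport _ _).symm.trans ((Sim.map₂ _ (G.sim_face₁ θ _ _ _).symm (.refl _)).trans
      ((G.sim_face₃ θ _ _ _).trans (sim_transport _ _)))).eq
  have e₈ : transport (total_map G.core rfl (total_assoc G.gray g h k))
      (G.face₂ θ f (G.core.map g h) k) = G.face₂ θ f g (G.core.map h k) :=
    ((sim_transport _ _).symm.trans (G.sim_pair θ rfl (total_assoc G.gray g h k))).eq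
  have e₉ : transport (G.total_assoc₄ f g h k) (G.core.map₂ (G.face₂ θ f g h) (𝟙 k)) =
      transport (total_map G.core rfl (total_assoc G.gray g h k))
        (G.face₃ θ f (G.core.map g h) k) :=
    ((sim_transport _ _).symm.trans ((G.sim_face₃ θ _ _ _).trans (sim_transport _ _))).eq
  have e₁₀ : transport (G.total_assoc₄ f g h k) (G.core.map₂ (G.face₃ θ f g h) (𝟙 k)) =
      G.face₃ θ f g (G.core.map h k) := by
    refine ((sim_transport _ _).symm.trans
      ((Sim.map₂ _ (G.sim_face₃ θ _ _ _).symm (.refl _)).trans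
        ((G.gray.sim_map₂_assoc _ _ _).trans (.trans ?_ (G.sim_face₃ θ _ _ _))))).eq
    rw [G.core.map₂_id]
    exact .refl _
  rw [e₁, e₂, e₃, e₄, e₅, e₆, e₇, e₈, e₉, e₁₀]
  abel

/-- The vertical coboundary of a vertical coboundary vanishes. -/
theorem δv_δv (θ : G.Family₀ 1) : G.δv 2 (G.δv 1 θ) = 0 := by
  funext ⟨X, Y, Z, W⟩ ⟨X', Y', Z', W'⟩ ⟨f, g, h, k⟩
  exact G.δv_δv_apply θ f g h k

end GraySemigroup

/-! ### Compatibility of the vertical coboundary with composition -/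

namespace GraySemigroup

variable {K : Type*} [CommRing K] {B : Type u} [Bicategory.{w, v} B]
  [∀ X Y : B, Preadditive (X ⟶ Y)] [∀ X Y : B, Linear K (X ⟶ Y)]
  (G : GraySemigroup K B) [Bicategory.Strict B]

/-- A family of endomorphisms `c` of a composite and `a`, `b` of its factors is compatible with the
2-cell `t`, to first order. -/
def IsDerivation {X Y Z : B} {f : X ⟶ Y} {f' : Y ⟶ Z} {k : X ⟶ Z} (t : f ≫ f' ⟶ k) (a : f ⟶ f)
    (b : f' ⟶ f') (c : k ⟶ k) : Prop :=
  t ≫ c = f ◁ b ≫ t + a ▷ f' ≫ t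

theorem isDerivation_iff {X Y Z : B} {f : X ⟶ Y} {f' : Y ⟶ Z} {k : X ⟶ Z} {t : f ≫ f' ⟶ k}
    {a : f ⟶ f} {b : f' ⟶ f'} {c : k ⟶ k} :
    IsDerivation t a b c ↔ f ◁ b ≫ t - t ≫ c + a ▷ f' ≫ t = 0 := by
  rw [IsDerivation, eq_comm, ← sub_eq_zero]
  refine Eq.congr_left ?_
  abel

theorem IsDerivation.sim {X Y Z X' Y' Z' : B} {f : X ⟶ Y} {f' : Y ⟶ Z} {k : X ⟶ Z}
    {t : f ≫ f' ⟶ k} {a : f ⟶ f} {b : f' ⟶ f'} {c : k ⟶ k} {g : X' ⟶ Y'} {g' : Y' ⟶ Z'}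
    {l : X' ⟶ Z'} {s : g ≫ g' ⟶ l} {x : g ⟶ g} {y : g' ⟶ g'} {z : l ⟶ l}
    (h : IsDerivation t a b c) (hf : total f = total g) (hf' : total f' = total g')
    (ht : Sim t s) (ha : Sim a x) (hb : Sim b y) (hc : Sim c z) : IsDerivation s x y z :=
  (Sim.eq_iff (ht.comp hc) (((Sim.whiskerLeft hf hb).comp ht).add ((ha.whiskerRight hf').comp ht))).1
    h

/-- Used with `s` a tensor of an interchanger with an identity: naturality of `θ` then replaces its
value at a composite of tensor products by its value at a tensor product of composites. -/
theorem IsDerivation.comp_natural {X Y Z : B} {f : X ⟶ Y} {f' : Y ⟶ Z} {k l : X ⟶ Z}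
    {t : f ≫ f' ⟶ k} {a : f ⟶ f} {b : f' ⟶ f'} {c : k ⟶ k} {d : l ⟶ l} {s : k ⟶ l}
    (h : IsDerivation t a b c) (hs : s ≫ d = c ≫ s) : IsDerivation (t ≫ s) a b d := by
  have h' := congrArg (· ≫ s) h
  simpa [IsDerivation, hs] using h'

section

variable {X X' X'' Y Y' Y'' : B} {f : X ⟶ X'} {f' : X' ⟶ X''} {k : X ⟶ X''} {g : Y ⟶ Y'}
  {g' : Y' ⟶ Y''} {l : Y ⟶ Y''}

/-- Naturality of the interchanger carries `1 ⊗ a` and `1 ⊗ b` past it. The Leibniz rule for `s` can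
then be applied inside the second tensor factor. -/
theorem IsDerivation.map₂_id_tens {s : g ≫ g' ⟶ l} {a : g ⟶ g} {b : g' ⟶ g'} {c : l ⟶ l}
    (h : IsDerivation s a b c) (f : X ⟶ X') (f' : X' ⟶ X'') :
    IsDerivation ((G.cells.tens f f' g g').hom ≫ G.core.map₂ (𝟙 (f ≫ f')) s)
      (G.core.map₂ (𝟙 f) a) (G.core.map₂ (𝟙 f') b) (G.core.map₂ (𝟙 (f ≫ f')) c) := by
  have hS := G.gray.semigroupal
  rw [IsDerivation, ← Category.assoc (_ ◁ _), hS.whiskerLeft_tens, ← Category.assoc (_ ▷ _),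
    hS.whiskerRight_tens, Category.assoc, Category.assoc, Category.assoc, ← G.core.map₂_comp,
    ← G.core.map₂_comp, ← G.core.map₂_comp, h, whiskerLeft_id, id_whiskerRight, Category.comp_id,
    G.bilinear.map₂_add, Preadditive.comp_add]

theorem IsDerivation.map₂_tens_id {t : f ≫ f' ⟶ k} {a : f ⟶ f} {b : f' ⟶ f'} {c : k ⟶ k}
    (h : IsDerivation t a b c) (g : Y ⟶ Y') (g' : Y' ⟶ Y'') :
    IsDerivation ((G.cells.tens f f' g g').hom ≫ G.core.map₂ t (𝟙 (g ≫ g')))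
      (G.core.map₂ a (𝟙 g)) (G.core.map₂ b (𝟙 g')) (G.core.map₂ c (𝟙 (g ≫ g'))) := by
  have hS := G.gray.semigroupal
  rw [IsDerivation, ← Category.assoc (_ ◁ _), hS.whiskerLeft_tens, ← Category.assoc (_ ▷ _),
    hS.whiskerRight_tens, Category.assoc, Category.assoc, Category.assoc, ← G.core.map₂_comp,
    ← G.core.map₂_comp, ← G.core.map₂_comp, h, whiskerLeft_id, id_whiskerRight, Category.comp_id,
    G.bilinear.add_map₂, Preadditive.comp_add]

end

variable [LinearBicategory K B]

section

variable (K) {X X' X'' : B} {f : X ⟶ X'} {f' : X' ⟶ X''} {k : X ⟶ X''}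
include K

theorem IsDerivation.add {t : f ≫ f' ⟶ k} {a a' : f ⟶ f} {b b' : f' ⟶ f'} {c c' : k ⟶ k}
    (h : IsDerivation t a b c) (h' : IsDerivation t a' b' c') :
    IsDerivation t (a + a') (b + b') (c + c') := by
  rw [IsDerivation] at *
  rw [Preadditive.comp_add, h, h', LinearBicategory.whiskerLeft_add (K := K),
    LinearBicategory.add_whiskerRight (K := K), Preadditive.add_comp, Preadditive.add_comp]
  abel

theorem IsDerivation.sub {t : f ≫ f' ⟶ k} {a a' : f ⟶ f} {b b' : f' ⟶ f'} {c c' : k ⟶ k}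
    (h : IsDerivation t a b c) (h' : IsDerivation t a' b' c') :
    IsDerivation t (a - a') (b - b') (c - c') := by
  rw [IsDerivation] at *
  rw [Preadditive.comp_sub, h, h', whiskerLeft_sub' (K := K), sub_whiskerRight' (K := K),
    Preadditive.sub_comp, Preadditive.sub_comp]
  abel

end

/-- The Leibniz rule is additive in the cochain, so it may be verified on each face of `δv θ`. -/
theorem triple_δv_derivation {θ : G.Family₀ 1}
    (hθ : ∀ {X X' Y Y' : B} {f f₁ : X ⟶ X'} {g g₁ : Y ⟶ Y'} (τ : f ⟶ f₁) (σ : g ⟶ g₁),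
      G.core.map₂ τ σ ≫ G.pair θ f₁ g₁ = G.pair θ f g ≫ G.core.map₂ τ σ)
    (hθ' : ∀ {X X' X'' Y Y' Y'' : B} (f : X ⟶ X') (f' : X' ⟶ X'') (g : Y ⟶ Y') (g' : Y' ⟶ Y''),
      IsDerivation (G.cells.tens f f' g g').hom (G.pair θ f g) (G.pair θ f' g')
        (G.pair θ (f ≫ f') (g ≫ g')))
    {X X' X'' Y Y' Y'' Z Z' Z'' : B} (f : X ⟶ X') (f' : X' ⟶ X'') (g : Y ⟶ Y') (g' : Y' ⟶ Y'')
    (h : Z ⟶ Z') (h' : Z' ⟶ Z'') :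
    IsDerivation (G.tens₂ f f' g g' h h') (G.triple (G.δv 1 θ) f g h)
      (G.triple (G.δv 1 θ) f' g' h') (G.triple (G.δv 1 θ) (f ≫ f') (g ≫ g') (h ≫ h')) := by
  simp only [triple_δv]
  have hs := G.gray.sim_tens_assoc f f' g g' h h'
  have ha := total_assoc G.gray f g h
  have ha' := total_assoc G.gray f' g' h'
  -- The goals are the four faces in order. Faces 0 and 2 hold along the right-bracketed
  -- interchanger directly; faces 1 and 3 hold along the left-bracketed one and are moved across
  -- `hs`.
  refine .sub K (.add K (.sub K ?_ ?_) ?_) ?_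
  · exact (hθ' g g' h h').map₂_id_tens G f f'
  · exact ((hθ' (G.core.map f g) (G.core.map f' g') h h').comp_natural (hθ _ _)).sim ha ha' hs
      (G.sim_face₁ θ _ _ _) (G.sim_face₁ θ _ _ _) (G.sim_face₁ θ _ _ _)
  · exact (hθ' f f' (G.core.map g h) (G.core.map g' h')).comp_natural (hθ _ _)
  · exact ((hθ' f f' g g').map₂_tens_id G h h').sim ha ha' hs
      (G.sim_face₃ θ _ _ _) (G.sim_face₃ θ _ _ _) (G.sim_face₃ θ _ _ _)

/-- The vertical coboundary of a 1-cochain is a 2-cocycle. -/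
theorem δv_mem_cocycles {θ : G.Family₀ 1} (hθ : θ ∈ G.Xass 1) : G.δv 1 θ ∈ G.cocycles 2 := by
  obtain ⟨⟨hn, h1⟩, hh⟩ := hθ
  have hn' {X X' Y Y' : B} {f f₁ : X ⟶ X'} {g g₁ : Y ⟶ Y'} (τ : f ⟶ f₁) (σ : g ⟶ g₁) :
      G.core.map₂ τ σ ≫ G.pair θ f₁ g₁ = G.pair θ f g ≫ G.core.map₂ τ σ :=
    hn (X, Y) (X', Y') (f, g) (f₁, g₁) (τ, σ)
  refine ⟨⟨⟨?_, ?_⟩, ?_⟩, LinearMap.mem_ker.2 (G.δv_δv θ)⟩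
  · rintro ⟨X, Y, Z⟩ ⟨X', Y', Z'⟩ ⟨f, g, h⟩ ⟨f₁, g₁, h₁⟩ ⟨τ, σ, η⟩
    exact G.triple_δv_natural hn' τ σ η
  · rintro ⟨X, Y, Z⟩
    exact G.triple_δv_id (fun X Y => h1 (X, Y)) X Y Z
  · refine LinearMap.mem_ker.2 ?_
    funext ⟨X, Y, Z⟩ ⟨X', Y', Z'⟩ ⟨X'', Y'', Z''⟩ ⟨f, g, h⟩ ⟨f', g', h'⟩
    refine (G.δh_two _ f f' g g' h h').trans (isDerivation_iff.1
      (G.triple_δv_derivation hn' (fun f f' g g' => isDerivation_iff.2 ?_) f f' g g' h h'))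
    rw [← δh_one, LinearMap.mem_ker.1 hh]
    rfl

end GraySemigroup

/-! ### Recovering cochains from deformations and equivalences -/

theorem SemigroupalCells.ext_of_eq {B : Type u} [Bicategory.{w, v} B] {T : TensorCore B}
    {S S' : SemigroupalCells T}
    (ht : ∀ {X X' X'' Y Y' Y'' : B} (f : X ⟶ X') (f' : X' ⟶ X'') (g : Y ⟶ Y') (g' : Y' ⟶ Y''),
      S.tens f f' g g' = S'.tens f f' g g')
    (hu : ∀ X Y : B, S.unit X Y = S'.unit X Y)
    (ha : ∀ {X X' Y Y' Z Z' : B} (f : X ⟶ X') (g : Y ⟶ Y') (h : Z ⟶ Z'),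
      S.ahat f g h = S'.ahat f g h)
    (hp : ∀ X Y Z W : B, S.pi X Y Z W = S'.pi X Y Z W) : S = S' := by
  cases S
  cases S'
  congr
  · funext X X' X'' Y Y' Y'' f f' g g'
    exact ht f f' g g'
  · funext X Y
    exact hu X Y
  · funext X X' Y Y' Z Z' f g h
    exact ha f g h
  · funext X Y Z W
    exact hp X Y Z W

theorem eq_unitor_conj {B : Type u} [Bicategory.{w, v} B] {X Y : B} {f : X ⟶ Y}
    (β : 𝟙 X ≫ f ⟶ f ≫ 𝟙 Y) :
    β = (λ_ f).hom ≫ ((λ_ f).inv ≫ β ≫ (ρ_ f).hom) ≫ (ρ_ f).inv := by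
  simp

theorem exists_whiskerRight_id {B : Type u} [Bicategory.{w, v} B] {X Y : B} {f g : X ⟶ Y}
    (β : f ≫ 𝟙 Y ⟶ g ≫ 𝟙 Y) : ∃ α : f ⟶ g, α ▷ 𝟙 Y = β :=
  ⟨(ρ_ f).inv ≫ β ≫ (ρ_ g).hom, by simp⟩

/-- Whiskering with an identity 1-cell is onto, so a cochain can be read off from a 2-cell that
carries the whisker `a`. -/
theorem IsIdentity₁.exists_whiskerRight {B : Type u} [Bicategory.{w, v} B] {X Y Z : B} {e : Y ⟶ Z}
    (he : IsIdentity₁ e) {f g : X ⟶ Y} (β : f ≫ e ⟶ g ≫ e) : ∃ α : f ⟶ g, α ▷ e = β := by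
  obtain ⟨rfl, rfl⟩ := he
  exact exists_whiskerRight_id β

namespace GraySemigroup

variable {K : Type*} [CommRing K] {B : Type u} [Bicategory.{w, v} B]
  [∀ X Y : B, Preadditive (X ⟶ Y)] [∀ X Y : B, Linear K (X ⟶ Y)] [LinearBicategory K B]
  [Bicategory.Strict B] (G : GraySemigroup K B)

/-- Composing the `ε`-part of the deformed associator with the inverse of the undeformed one leaves
a 2-cell between composites ending in `a`, which comes from an endomorphism by whiskering. -/
theorem exists_isFirstOrderPart (D : G.Deformation) :
    ∃ φ : G.Family₀ 2, G.IsFirstOrderPart D φ := by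
  have h {X X' Y Y' Z Z' : B} (f : X ⟶ X') (g : Y ⟶ Y') (h : Z ⟶ Z') :
      ∃ α : G.core.map f (G.core.map g h) ⟶ G.core.map f (G.core.map g h),
        (D.cells.ahat (X := ⟨X⟩) (X' := ⟨X'⟩) (Y := ⟨Y⟩) (Y' := ⟨Y'⟩) (Z := ⟨Z⟩) (Z' := ⟨Z'⟩)
          ⟨f⟩ ⟨g⟩ ⟨h⟩).hom.eps = (G.cells.ahat f g h).hom ≫ α ▷ G.core.assoc X' Y' Z' := by
    obtain ⟨α, hα⟩ := (G.gray.assoc_identity X' Y' Z').exists_whiskerRight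
      (f := G.core.map f (G.core.map g h)) (g := G.core.map f (G.core.map g h))
      ((G.cells.ahat f g h).inv ≫ (D.cells.ahat (X := ⟨X⟩) (X' := ⟨X'⟩) (Y := ⟨Y⟩) (Y' := ⟨Y'⟩)
        (Z := ⟨Z⟩) (Z' := ⟨Z'⟩) ⟨f⟩ ⟨g⟩ ⟨h⟩).hom.eps)
    refine ⟨α, ?_⟩
    rw [hα]
    exact (Iso.hom_inv_id_assoc _ _).symm
  choose φ hφ using @h
  exact ⟨fun _ _ f => φ f.1 f.2.1 f.2.2, fun f g h => hφ f g h⟩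

/-- In an associator-deformation everything except the `ε`-part of the associator is prescribed, and
a 2-isomorphism is determined by its forward 2-cell. -/
theorem isFirstOrderPart_iff (D : G.Deformation) (φ : G.Family₀ 2) :
    G.IsFirstOrderPart D φ ↔ D.cells = G.deformedCells φ := by
  have he {X X' Y Y' Z Z' : DualExt K B} (f : X ⟶ X') (g : Y ⟶ Y') (h : Z ⟶ Z') :
      ((G.deformedCells φ).ahat f g h).hom.eps = (G.cells.ahat f.hom g.hom h.hom).hom ≫
        G.triple φ f.hom g.hom h.hom ▷ G.core.assoc X'.obj Y'.obj Z'.obj := by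
    refine (congrArg (_ + ·) Limits.zero_comp).trans (add_zero _)
  have hr {X X' Y Y' Z Z' : DualExt K B} (f : X ⟶ X') (g : Y ⟶ Y') (h : Z ⟶ Z') :
      ((G.deformedCells φ).ahat f g h).hom.re = (G.cells.ahat f.hom g.hom h.hom).hom :=
    (congrArg (_ ≫ ·) (id_whiskerRight _ _)).trans (Category.comp_id _)
  constructor
  · intro hφ
    refine SemigroupalCells.ext_of_eq D.tens_eq D.unit_eq (fun f g h => Iso.ext (dual_ext ?_ ?_))
      D.pi_eq
    · exact (D.ahat_re f g h).trans (hr f g h).symm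
    · exact (hφ f.hom g.hom h.hom).trans (he f g h).symm
  · intro hD X X' Y Y' Z Z' f g h
    rw [hD]
    exact he (X := ⟨X⟩) (X' := ⟨X'⟩) (Y := ⟨Y⟩) (Y' := ⟨Y'⟩) (Z := ⟨Z⟩) (Z' := ⟨Z'⟩) ⟨f⟩ ⟨g⟩ ⟨h⟩

theorem deformedCells_injective : Function.Injective G.deformedCells := by
  intro φ φ' h
  funext ⟨X, Y, Z⟩ ⟨X', Y', Z'⟩ ⟨f, g, h'⟩
  have hs := G.sim_ahat φ (X := ⟨X⟩) (X' := ⟨X'⟩) (Y := ⟨Y⟩) (Y' := ⟨Y'⟩) (Z := ⟨Z⟩) (Z' := ⟨Z'⟩)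
    ⟨f⟩ ⟨g⟩ ⟨h'⟩
  rw [h] at hs
  exact oneAdd_inj.1 (hs.symm.trans (G.sim_ahat φ' (X := ⟨X⟩) (X' := ⟨X'⟩) (Y := ⟨Y⟩) (Y' := ⟨Y'⟩)
    (Z := ⟨Z⟩) (Z' := ⟨Z'⟩) ⟨f⟩ ⟨g⟩ ⟨h'⟩)).eq

theorem exists_cocycle (D : G.Deformation) :
    ∃ z : G.cocycles 2, G.IsFirstOrderPart D z := by
  obtain ⟨φ, hφ⟩ := G.exists_isFirstOrderPart D
  have h := D.semigroupal
  rw [(G.isFirstOrderPart_iff D φ).1 hφ] at h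
  exact ⟨⟨φ, (G.deformed_semigroupal_iff φ).1 h⟩, hφ⟩

/-- The deformation with first order part a given 2-cocycle. -/
def ofCocycle (z : G.cocycles 2) : G.Deformation where
  cells := G.deformedCells z
  semigroupal := (G.deformed_semigroupal_iff z).2 z.2
  tens_re _ _ _ _ := rfl
  unit_re _ _ := rfl
  ahat_re _ _ _ := (congrArg (_ ≫ ·) (id_whiskerRight _ _)).trans (Category.comp_id _)
  pi_re _ _ _ _ := rfl
  tens_eq _ _ _ _ := rfl
  unit_eq _ _ := rfl
  pi_eq _ _ _ _ := rfl

theorem isFirstOrderPart_unique {D : G.Deformation} {φ φ' : G.Family₀ 2}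
    (h : G.IsFirstOrderPart D φ) (h' : G.IsFirstOrderPart D φ') : φ = φ' :=
  G.deformedCells_injective
    (((G.isFirstOrderPart_iff D φ).1 h).symm.trans ((G.isFirstOrderPart_iff D φ').1 h'))

/-- Deformations are `ψ`-equivalent if and only if their first order parts are cohomologous. -/
theorem psiEquiv_iff {D D' : G.Deformation} {z z' : G.cocycles 2} (h : G.IsFirstOrderPart D z)
    (h' : G.IsFirstOrderPart D' z') :
    G.PsiEquiv D D' ↔ ∃ θ ∈ G.Xass 1, (z : G.Family₀ 2) + G.δv 1 θ = z' := by
  have hz' (X Y Z : B) : G.triple z' (𝟙 X) (𝟙 Y) (𝟙 Z) = 0 := z'.2.1.1.2 (X, (Y, Z))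
  rw [PsiEquiv, PsiEquivalent, (G.isFirstOrderPart_iff D z).1 h,
    (G.isFirstOrderPart_iff D' z').1 h']
  constructor
  · rintro ⟨ψhat, hψ, hre⟩
    -- The `ε`-part of `ψhat` goes from `𝟙 ≫ (f ⊗ g)` to `(f ⊗ g) ≫ 𝟙`; conjugating by the unitors
    -- makes it an endomorphism of `f ⊗ g`.
    let θ : G.Family₀ 1 := fun X Y f => (λ_ (G.core.tHom 1 f)).inv ≫
      (ψhat (X := ⟨X.1⟩) (X' := ⟨Y.1⟩) (Y := ⟨X.2⟩) (Y' := ⟨Y.2⟩) ⟨f.1⟩ ⟨f.2⟩).hom.eps ≫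
        (ρ_ (G.core.tHom 1 f)).hom
    have hθ : @ψhat = @psiCells _ _ _ _ _ _ _ G θ := by
      funext X X' Y Y' f g
      refine Iso.ext (dual_ext ?_ ?_)
      · refine (hre f g).trans ?_
        exact (congrArg (_ ≫ ·) (Category.id_comp _)).symm
      · have : (G.psiCells θ f g).hom.eps = (λ_ (G.core.map f.hom g.hom)).hom ≫
            G.pair θ f.hom g.hom ≫ (ρ_ (G.core.map f.hom g.hom)).inv := by
          simp [psiCells, oneAddIso, dual_leftUnitor, dual_rightUnitor]
          rfl
        exact (eq_unitor_conj (ψhat f g).hom.eps).trans this.symm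
    -- The body of `θ` mentions `ψhat`. Forgetting it allows `ψhat` to be eliminated through `hθ`.
    clear_value θ
    subst hθ
    exact ⟨θ, (G.psi_structure_iff z z' θ hz').1 hψ⟩
  · rintro ⟨θ, hθ⟩
    refine ⟨G.psiCells θ, (G.psi_structure_iff z z' θ hz').2 hθ, fun f g => ?_⟩
    exact congrArg (_ ≫ ·) (Category.id_comp _)

/-- The first order part of a deformation. -/
noncomputable def firstOrderPart (D : G.Deformation) : G.cocycles 2 := (G.exists_cocycle D).choose

theorem isFirstOrderPart (D : G.Deformation) : G.IsFirstOrderPart D (G.firstOrderPart D) :=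
  (G.exists_cocycle D).choose_spec

theorem firstOrderPart_ofCocycle (z : G.cocycles 2) : G.firstOrderPart (G.ofCocycle z) = z :=
  Subtype.ext (G.isFirstOrderPart_unique (G.isFirstOrderPart _)
    ((G.isFirstOrderPart_iff (G.ofCocycle z) z).2 rfl))

/-- Exhibits `ψ`-equivalence as the kernel relation of a map into `H²_ass`. This yields reflexivity,
symmetry and transitivity without composing or inverting transformations. -/
theorem psiEquiv_iff_mk_eq (D D' : G.Deformation) :
    G.PsiEquiv D D' ↔ (Submodule.Quotient.mk (G.firstOrderPart D) : G.Hass 2) =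
      Submodule.Quotient.mk (G.firstOrderPart D') := by
  -- The coboundary goes from the source cocycle to the target one, so the equality in the quotient
  -- is reversed to produce the difference target minus source.
  rw [G.psiEquiv_iff (G.isFirstOrderPart D) (G.isFirstOrderPart D'), eq_comm, Submodule.Quotient.eq]
  change _ ↔ ∃ θ ∈ G.Xass 1, G.δv 1 θ = (G.firstOrderPart D' : G.Family₀ 2) - G.firstOrderPart D
  simp only [eq_sub_iff_add_eq']

end GraySemigroup

end GrayDeformation

/-! ### The bijection with second cohomology -/

theorem mainTheorem6 {K : Type*} [CommRing K] {B : Type u} [Bicategory.{w, v} B]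
    [Bicategory.Strict B] [∀ X Y : B, Preadditive (X ⟶ Y)] [∀ X Y : B, Linear K (X ⟶ Y)]
    [GrayDeformation.LinearBicategory K B] (G : GrayDeformation.GraySemigroup K B) :
    (G.Xass 1).map (G.δv 1) ≤ G.Xass 2 ⊓ LinearMap.ker (G.δv 2) ∧
    ∃ (hE : _root_.Equivalence G.PsiEquiv) (e : Quotient ⟨G.PsiEquiv, hE⟩ ≃ G.Hass 2),
      ∀ D : G.Deformation, ∃ z : G.cocycles 2,
        G.IsFirstOrderPart D z ∧
          e (Quotient.mk ⟨G.PsiEquiv, hE⟩ D) = Submodule.Quotient.mk z := by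
  have hE : _root_.Equivalence G.PsiEquiv :=
    ⟨fun D => (G.psiEquiv_iff_mk_eq D D).2 rfl,
      fun h => (G.psiEquiv_iff_mk_eq _ _).2 ((G.psiEquiv_iff_mk_eq _ _).1 h).symm,
      fun h h' => (G.psiEquiv_iff_mk_eq _ _).2
        (((G.psiEquiv_iff_mk_eq _ _).1 h).trans ((G.psiEquiv_iff_mk_eq _ _).1 h'))⟩
  refine ⟨?_, hE, Equiv.ofBijective (Quotient.lift
    (fun D => (Submodule.Quotient.mk (G.firstOrderPart D) : G.Hass 2))
    (fun D D' h => (G.psiEquiv_iff_mk_eq D D').1 h)) ⟨?_, ?_⟩,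
    fun D => ⟨G.firstOrderPart D, G.isFirstOrderPart D, rfl⟩⟩
  · rintro _ ⟨θ, hθ, rfl⟩
    exact G.δv_mem_cocycles hθ
  · rintro ⟨D⟩ ⟨D'⟩ h
    exact Quotient.sound ((G.psiEquiv_iff_mk_eq D D').2 h)
  · intro x
    obtain ⟨z, rfl⟩ := Submodule.Quotient.mk_surjective _ x
    exact ⟨Quotient.mk _ (G.ofCocycle z),
      congrArg Submodule.Quotient.mk (G.firstOrderPart_ofCocycle z)⟩
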